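/- Let $d\ge 3$ and let $H=(V,E)$ be a finite simple bipartite graph that is $d$-sparse, i.e. $H$ contains no complete bipartite graph $K_{a,b}$ with $a,b\ge 1$ and $a+b>d$ as a (not necessarily induced) subgraph. Suppose that $H$ satisfies Sidorenko's conjecture: for every finite simple graph $G$ with at least one node, $t(H,G)\ge t(K_2,G)^{|E|}$, where $t(F,G)=|\mathrm{Hom}(F,G)|/|V(G)|^{|V(F)|}$ is the homomorphism density. Then the ortho-homomorphism density of $H$ in dimension $d$ satisfies $t(H,d)\ge 1$ (the value $+\infty$ being allowed). Here $t(H,d)$ is defined as follows. Let $p:V\to\{1,\dots,|V|\}$ be a bijection (an ordering of the nodes), and let $N_p(v)$ be the set of neighbors of $v$ preceding $v$, $d_p(v)=|N_p(v)|$. Choose unit vectors $x_v\in\mathbb{R}^d$ one by one in the order $p$, each $x_v$ being uniformly distributed on the unit sphere of the subspace orthogonal to all $x_u$, $u\in N_p(v)$; let $\rho_p$ be the distribution of the resulting $x=(x_v)_{v\in V}$. Let $A_k$ be the surface area of the unit sphere $S^k\subseteq\mathbb{R}^{k+1}$, let $\mathrm{Det}(x_i:i\in S)=\sqrt{\det(x_i^{\sf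 T}x_j)_{i,j\in S}}$ (equal to $1$ for $S=\emptyset$), and $$f_p(x)=\prod_{v\in V}\frac{A_{d-1}^{d_p(v)-1}A_{d-d_p(v)-1}}{A_{d-2}^{d_p(v)}}\,\frac{1}{\mathrm{Det}(x_i: i\in N_p(v))},\qquad \varphi_p=f_p\cdot\rho_p .$$ Let $\Sigma_{H,d}$ be the set of maps $x:V\to S^{d-1}$ that take adjacent nodes to orthogonal vectors and any at most $d$ nodes to linearly independent vectors. Then $t(H,d)=\varphi_p(\Sigma_{H,d})\in[0,\infty]$; the inequality $t(H,d)\ge 1$ is asserted for this quantity computed with any ordering $p$. -/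

import Mathlib

open MeasureTheory

namespace OrthoHom

/-- `d`-sparse: no (not necessarily induced) complete bipartite subgraph `K_{a,b}` with
`a, b ≥ 1` and `a + b > d`. -/
def IsSparse {V : Type*} (G : SimpleGraph V) (d : ℕ) : Prop :=
  ∀ a b : ℕ, 1 ≤ a → 1 ≤ b → d < a + b →
    (completeBipartiteGraph (Fin a) (Fin b)).Free G

/-- Homomorphism density of `H` in the finite graph `G`: the probability that a uniformly random
map `V(H) → V(G)` is a homomorphism. -/
noncomputable def homDensity {V W : Type*} (H : SimpleGraph V) (G : SimpleGraph W) : ℝ :=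
  (Nat.card (H →g G) : ℝ) / (Nat.card W : ℝ) ^ Nat.card V

/-- `H` satisfies Sidorenko's conjecture: `t(H,G) ≥ t(K₂,G)^{|E(H)|}` for every finite simple
graph `G` with at least one node. -/
def SatisfiesSidorenko {V : Type*} (H : SimpleGraph V) : Prop :=
  ∀ (n : ℕ) (G : SimpleGraph (Fin (n + 1))),
    homDensity (⊤ : SimpleGraph (Fin 2)) G ^ H.edgeSet.ncard ≤ homDensity H G

/-- `A_k`, the surface area of the unit sphere `S^k ⊆ ℝ^{k+1}`. -/
noncomputable def sphereArea (k : ℕ) : ℝ :=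
  ((volume : Measure (EuclideanSpace ℝ (Fin (k + 1)))).toSphere).real Set.univ

/-- The uniform probability distribution on the unit sphere of the (nonzero) linear subspace `L`
of `ℝ^d`, as a measure on `ℝ^d`: the normalized surface measure. -/
noncomputable def sphereUniform {d : ℕ} (L : Submodule ℝ (EuclideanSpace ℝ (Fin d))) :
    Measure (EuclideanSpace ℝ (Fin d)) :=
  ((volume : Measure L).toSphere Set.univ)⁻¹ •
    (volume : Measure L).toSphere.map
      (fun y : Metric.sphere (0 : L) 1 => ((y : L) : EuclideanSpace ℝ (Fin d)))

section

variable {V : Type*} [Fintype V]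

open Classical in
/-- `N_p(v)`: the neighbors of `v` that precede `v` in the ordering `p`. -/
noncomputable def backNbrs (G : SimpleGraph V) (p : V ≃ Fin (Fintype.card V)) (v : V) :
    Finset V :=
  Finset.univ.filter fun w => p w < p v ∧ G.Adj w v

open Classical in
/-- One step of the random sequential construction: the vectors of `x` being given, replace `x_v`
by a uniformly random unit vector orthogonal to `x_w` for all `w ∈ N_p(v)`. -/
noncomputable def seqStep {d : ℕ} (G : SimpleGraph V) (p : V ≃ Fin (Fintype.card V)) (v : V)
    (x : V → EuclideanSpace ℝ (Fin d)) : Measure (V → EuclideanSpace ℝ (Fin d)) :=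
  (sphereUniform (Submodule.span ℝ (x '' (backNbrs G p v : Set V)))ᗮ).map
    (fun y => Function.update x v y)

/-- The distribution after the first `k` nodes in the ordering `p` have been mapped (nodes not yet
mapped carry the dummy value `0`, which is never looked at). -/
noncomputable def seqLawAux (G : SimpleGraph V) (d : ℕ) (p : V ≃ Fin (Fintype.card V)) :
    ℕ → Measure (V → EuclideanSpace ℝ (Fin d))
  | 0 => Measure.dirac 0
  | k + 1 =>
    if h : k < Fintype.card V then
      (seqLawAux G d p k).bind (seqStep G p (p.symm ⟨k, h⟩))
    else seqLawAux G d p k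

/-- `ρ_p`: the distribution of the random sequential ortho-homomorphism of `G` in dimension `d`
for the ordering `p`. -/
noncomputable def seqLaw (G : SimpleGraph V) (d : ℕ) (p : V ≃ Fin (Fintype.card V)) :
    Measure (V → EuclideanSpace ℝ (Fin d)) :=
  seqLawAux G d p (Fintype.card V)

open Classical in
/-- `Det(x_i : i ∈ S)`: the square root of the Gram determinant. -/
noncomputable def gramDet {d : ℕ} (S : Finset V) (x : V → EuclideanSpace ℝ (Fin d)) : ℝ :=
  Real.sqrt (Matrix.gram ℝ fun i : S => x i).det

/-- `s_{d,n}(x_i : i ∈ S)` for a set `S` of `n < d` nodes: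
`A_{d-1}^{n-1} A_{d-n-1} / A_{d-2}^n · 1 / Det(x_i : i ∈ S)`. -/
noncomputable def sDensity {d : ℕ} (S : Finset V) (x : V → EuclideanSpace ℝ (Fin d)) : ℝ :=
  sphereArea (d - 1) ^ ((S.card : ℤ) - 1) * sphereArea (d - S.card - 1) /
    sphereArea (d - 2) ^ S.card * (1 / gramDet S x)

/-- `f_p`, the product over all nodes `v` of `s_{d,n}` at the vectors of `N_p(v)`. -/
noncomputable def seqDensity {d : ℕ} (G : SimpleGraph V) (p : V ≃ Fin (Fintype.card V))
    (x : V → EuclideanSpace ℝ (Fin d)) : ℝ :=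
  ∏ v, sDensity (backNbrs G p v) x

/-- `φ_p = f_p · ρ_p`. -/
noncomputable def orthoMeasure (G : SimpleGraph V) (d : ℕ) (p : V ≃ Fin (Fintype.card V)) :
    Measure (V → EuclideanSpace ℝ (Fin d)) :=
  (seqLaw G d p).withDensity fun x => ENNReal.ofReal (seqDensity G p x)

/-- `Σ_{G,d}`: the ortho-homomorphisms of `G` in dimension `d` in general position, i.e. the maps
to the unit sphere taking adjacent nodes to orthogonal vectors and any at most `d` nodes to
linearly independent vectors. -/
def generalPosition (G : SimpleGraph V) (d : ℕ) : Set (V → EuclideanSpace ℝ (Fin d)) :=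
  {x | (∀ v, ‖x v‖ = 1) ∧ (∀ u v, G.Adj u v → inner ℝ (x u) (x v) = 0) ∧
    ∀ S : Finset V, S.card ≤ d → LinearIndependent ℝ (fun i : S => x i)}

/-- The ortho-homomorphism density `t(G,d) = φ_p(Σ_{G,d}) ∈ [0,∞]`, computed with the
ordering `p`. -/
noncomputable def orthoDensity (G : SimpleGraph V) (d : ℕ) (p : V ≃ Fin (Fintype.card V)) :
    ENNReal :=
  orthoMeasure G d p (generalPosition G d)

end

end OrthoHom

/-! Orthogonality is relaxed. For `ε > 0` call two unit vectors adjacent when `|⟪x, y⟫| < ε`, and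
let `κ = slabRate d`, so that independent uniform vectors are adjacent with probability asymptotic
to `κ ε`. The density of `H` in this measurable graph, divided by `(κ ε)^|E|`, is compared with
`φ_p(Σ)` as `ε → 0`.

If nodes are placed one by one, the choice of `x_v` with neighbors `N` already placed is an average
over a thin slab, scaled by `(κ ε)^(-|N|)`. By `tendsto_slabAvg` it tends to `s_{d,|N|}(x_N)` times
the average over the unit sphere of the orthogonal complement of `x_N`: exactly one step of the
sequential construction with its density factor. The limit is joint in `ε` and `x`, so steps can be
composed (`tendsto_slabIter`).

Before the limit, the iterated slab average is a single integral that does not know the order of the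
nodes (`slabIter_empty`). With a continuous cutoff vanishing near degenerate configurations
everything is bounded, so the limits agree for all orders; letting the cutoffs increase to the
indicator of independence shows that `φ_p(Σ)` does not depend on `p` (`iter_independentMaps_eq`).

So one color class `A` may be placed first. Its vectors are independent and uniform, and by sparsity
almost every completion is in general position (`ae_fill_mem_independentMaps`, a genericity argument
whose witness comes from Hall's theorem). Hence `φ_p(Σ)` is the expectation of the product of the
factors `s` over `v ∉ A`. If it is infinite, nothing remains to prove. If it is finite, that
product, up to a constant, dominates the slab averages, and no cutoff is needed: the expectation is
the limit of `t(H, ε) / (κ ε)^|E|` (`tendsto_almostMass`).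

Sidorenko's inequality passes from finite graphs to measurable relations by sampling
(`SatisfiesSidorenko.relDensity`), so `t(H, ε) ≥ t(K₂, ε)^|E|`. Since `t(K₂, ε) / (κ ε) → 1`, the
limit is at least `1`. -/

namespace OrthoHom

set_option linter.unusedSectionVars false

open Set Metric Module Filter Topology
open scoped ENNReal Pointwise

/-! ### Uniform measure on spheres, realized by the unit ball -/

section Sphere

variable {F : Type*} [NormedAddCommGroup F] [InnerProductSpace ℝ F] [FiniteDimensional ℝ F]
  [MeasurableSpace F] [BorelSpace F]

/-- Radial projection to the unit sphere (with value `0` at `0`). -/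
noncomputable def normalize (z : F) : F := ‖z‖⁻¹ • z

lemma norm_normalize {z : F} (hz : z ≠ 0) : ‖normalize z‖ = 1 := by
  simp [normalize, norm_smul, hz]

lemma normalize_smul {t : ℝ} (ht : 0 < t) (z : F) : normalize (t • z) = normalize z := by
  simp only [normalize, norm_smul, Real.norm_eq_abs, abs_of_pos ht, mul_inv, smul_smul]
  congr 1
  field_simp

lemma normalize_of_norm_eq_one {z : F} (hz : ‖z‖ = 1) : normalize z = z := by
  simp [normalize, hz]

lemma normalize_mem {L : Submodule ℝ F} {z : F} (hz : z ∈ L) : normalize z ∈ L :=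
  L.smul_mem _ hz

lemma measurable_normalize : Measurable (normalize : F → F) :=
  (measurable_norm.inv).smul measurable_id

lemma continuousAt_normalize {z : F} (hz : z ≠ 0) : ContinuousAt (normalize : F → F) z :=
  (continuousAt_id.norm.inv₀ (norm_ne_zero_iff.2 hz)).smul continuousAt_id

/-- `toSphere` measures a set by the cone over it; the cone over `s` consists of the nonzero points
of the ball whose radial projection lies in `s`. -/
lemma Ioo_smul_sphere_inter (s : Set F) :
    Ioo (0 : ℝ) 1 • (((↑) : sphere (0 : F) 1 → F) '' ((↑) ⁻¹' s)) =
      (normalize ⁻¹' s ∩ ball 0 1) \ {0} := by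
  ext z
  constructor
  · rintro ⟨t, ht, _, ⟨y, hy, rfl⟩, rfl⟩
    have h1 : ‖(y : F)‖ = 1 := by simp
    have hy0 : (y : F) ≠ 0 := norm_ne_zero_iff.1 (by rw [h1]; exact one_ne_zero)
    refine ⟨⟨?_, ?_⟩, ?_⟩
    · simpa [normalize_smul ht.1, normalize_of_norm_eq_one h1] using hy
    · simp [norm_smul, abs_of_pos ht.1, ht.2]
    · simp [ht.1.ne', hy0]
  · rintro ⟨⟨hs, hb⟩, h0⟩
    have h0' : z ≠ 0 := h0
    refine ⟨‖z‖, ⟨norm_pos_iff.2 h0', by simpa using hb⟩, normalize z,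
      ⟨⟨normalize z, by simp [norm_normalize h0']⟩, hs, rfl⟩, ?_⟩
    simp [normalize, smul_smul, h0']

lemma map_coe_toSphere [Nontrivial F] :
    (volume : Measure F).toSphere.map ((↑) : sphere (0 : F) 1 → F) =
      (finrank ℝ F : ℝ≥0∞) • (volume.restrict (ball (0 : F) 1)).map normalize := by
  ext s hs
  rw [Measure.map_apply measurable_subtype_coe hs,
    Measure.toSphere_apply' _ (measurable_subtype_coe hs), Ioo_smul_sphere_inter,
    measure_sdiff_null (measure_singleton _), Measure.smul_apply, smul_eq_mul,
    Measure.map_apply measurable_normalize hs,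
    Measure.restrict_apply (measurable_normalize hs)]

/-- The uniform probability measure on the unit ball. -/
noncomputable def ballMeasure (F : Type*) [NormedAddCommGroup F] [InnerProductSpace ℝ F]
    [FiniteDimensional ℝ F] [MeasurableSpace F] [BorelSpace F] : Measure F :=
  (volume (ball (0 : F) 1))⁻¹ • volume.restrict (ball (0 : F) 1)

lemma volume_ball_ne_zero : volume (ball (0 : F) 1) ≠ 0 :=
  (isOpen_ball.measure_pos _ ⟨0, by simp⟩).ne'

lemma volume_ball_ne_top : volume (ball (0 : F) 1) ≠ ∞ := measure_ball_lt_top.ne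

instance : IsProbabilityMeasure (ballMeasure F) := ⟨by
  simp [ballMeasure, ENNReal.inv_mul_cancel volume_ball_ne_zero volume_ball_ne_top]⟩

lemma lintegral_ballMeasure (f : F → ℝ≥0∞) :
    ∫⁻ z, f z ∂ballMeasure F =
      (volume (ball (0 : F) 1))⁻¹ * ∫⁻ z in ball (0 : F) 1, f z := by
  rw [ballMeasure, lintegral_smul_measure, smul_eq_mul]

lemma ballMeasure_absolutelyContinuous : ballMeasure F ≪ volume :=
  (Measure.absolutelyContinuous_of_le_smul (c := (volume (ball (0 : F) 1))⁻¹) (by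
    rw [ballMeasure]
    gcongr
    exact Measure.restrict_le_self))

/-- The dimension factor of `toSphere` cancels under normalization, so uniform points of the sphere
may be replaced by uniform points of the ball. -/
lemma inv_smul_map_coe_toSphere [Nontrivial F] :
    ((volume : Measure F).toSphere univ)⁻¹ •
      (volume : Measure F).toSphere.map ((↑) : sphere (0 : F) 1 → F) =
      (ballMeasure F).map normalize := by
  have hd : (finrank ℝ F : ℝ≥0∞) ≠ 0 := by exact_mod_cast finrank_pos.ne'
  rw [map_coe_toSphere, Measure.toSphere_apply_univ, smul_smul, ballMeasure, Measure.map_smul,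
    ENNReal.mul_inv (Or.inl hd) (Or.inl (ENNReal.natCast_ne_top _)), mul_right_comm,
    ENNReal.inv_mul_cancel hd (ENNReal.natCast_ne_top _), one_mul]

/-- Integration in polar coordinates of a `0`-homogeneous function against a power of the norm. -/
lemma lintegral_ball_norm_pow_mul [Nontrivial F] (n : ℕ) {φ : F → ℝ≥0∞} (hφ : Measurable φ) :
    ((finrank ℝ F + n : ℕ) : ℝ≥0∞) *
        ∫⁻ a in ball (0 : F) 1, ENNReal.ofReal ‖a‖ ^ n * φ (normalize a) =
      (finrank ℝ F : ℝ≥0∞) * ∫⁻ a in ball (0 : F) 1, φ (normalize a) := by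
  -- With `k` the dimension, the radial integral `∫₀¹ r^(k-1+m) dr` is `1/(k+m)`, so the scaled
  -- integral equals the sphere integral for every `m`; the cases `m = n` and `m = 0` are compared.
  have key : ∀ m : ℕ, ((finrank ℝ F + m : ℕ) : ℝ≥0∞) *
      ∫⁻ a in ball (0 : F) 1, ENNReal.ofReal ‖a‖ ^ m * φ (normalize a) =
      ∫⁻ y, φ (y : F) ∂(volume : Measure F).toSphere := by
    intro m
    have hdpos : 0 < finrank ℝ F := finrank_pos
    have hmeas : Measurable fun a : F => ENNReal.ofReal ‖a‖ ^ m * φ (normalize a) :=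
      (measurable_norm.ennreal_ofReal.pow_const m).mul (hφ.comp measurable_normalize)
    have h1 : ∫⁻ a in ball (0 : F) 1, ENNReal.ofReal ‖a‖ ^ m * φ (normalize a) =
        ∫⁻ a : ({0}ᶜ : Set F), (ball (0 : F) 1).indicator
          (fun a => ENNReal.ofReal ‖a‖ ^ m * φ (normalize a)) a
          ∂((volume : Measure F).comap ((↑) : ({0}ᶜ : Set F) → F)) := by
      rw [← lintegral_indicator measurableSet_ball,
        lintegral_subtype_comap (measurableSet_singleton _).compl,
        restrict_compl_singleton]
    have h2 : ∀ a : ({0}ᶜ : Set F), (ball (0 : F) 1).indicator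
          (fun a => ENNReal.ofReal ‖a‖ ^ m * φ (normalize a)) a =
        (fun q : sphere (0 : F) 1 × Ioi (0 : ℝ) =>
          φ q.1 * (Iio (1 : ℝ)).indicator (fun r => ENNReal.ofReal r ^ m) q.2)
          (homeomorphUnitSphereProd F a) := by
      intro a
      have e1 : ((homeomorphUnitSphereProd F a).1 : F) = normalize (a : F) := by
        simp [normalize]
      have e2 : ((homeomorphUnitSphereProd F a).2 : ℝ) = ‖(a : F)‖ := by simp
      simp only [e1, e2]
      by_cases h : ‖(a : F)‖ < 1
      · rw [indicator_of_mem (by simpa using h), indicator_of_mem (by simpa using h), mul_comm]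
      · rw [indicator_of_notMem (by simpa using h), indicator_of_notMem (by simpa using h),
          mul_zero]
    have hm1 : Measurable fun r : Ioi (0 : ℝ) =>
        (Iio (1 : ℝ)).indicator (fun r => ENNReal.ofReal r ^ m) (r : ℝ) :=
      ((ENNReal.measurable_ofReal.pow_const m).indicator measurableSet_Iio).comp
        measurable_subtype_coe
    have h3 : ∫⁻ r : Ioi (0 : ℝ), (Iio (1 : ℝ)).indicator (fun r => ENNReal.ofReal r ^ m) (r : ℝ)
        ∂Measure.volumeIoiPow (finrank ℝ F - 1) = ((finrank ℝ F + m : ℕ) : ℝ≥0∞)⁻¹ := by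
      -- The factor `r^m` is absorbed by raising the exponent of the radial measure, whose mass
      -- below `1` is known.
      have e := Measure.volumeIoiPow_apply_Iio (finrank ℝ F - 1 + m) ⟨1, mem_Ioi.2 one_pos⟩
      have hcast : ((finrank ℝ F - 1 + m : ℕ) : ℝ) + 1 = ((finrank ℝ F + m : ℕ) : ℝ) := by
        rw [← Nat.cast_add_one]
        congr 1
        omega
      rw [hcast, one_pow, one_div, ENNReal.ofReal_inv_of_pos (by positivity),
        ENNReal.ofReal_natCast] at e
      rw [← e, Measure.volumeIoiPow, Measure.volumeIoiPow,
        withDensity_apply _ measurableSet_Iio, lintegral_withDensity_eq_lintegral_mul _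
          (by fun_prop) hm1, ← lintegral_indicator measurableSet_Iio]
      refine lintegral_congr fun r => ?_
      have hr : (0 : ℝ) ≤ r := le_of_lt r.2
      by_cases h : (r : ℝ) < 1
      · have h' : r ∈ Iio (⟨1, mem_Ioi.2 one_pos⟩ : Ioi (0 : ℝ)) := h
        rw [indicator_of_mem h', Pi.mul_apply, indicator_of_mem (by simpa using h),
          ← ENNReal.ofReal_pow hr, ← ENNReal.ofReal_mul (by positivity), pow_add]
      · have h' : r ∉ Iio (⟨1, mem_Ioi.2 one_pos⟩ : Ioi (0 : ℝ)) := h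
        rw [indicator_of_notMem h', Pi.mul_apply, indicator_of_notMem (by simpa using h),
          mul_zero]
    have h4 := (Measure.measurePreserving_homeomorphUnitSphereProd
      (volume : Measure F)).lintegral_comp_emb (homeomorphUnitSphereProd F).measurableEmbedding
      (fun q : sphere (0 : F) 1 × Ioi (0 : ℝ) =>
          φ q.1 * (Iio (1 : ℝ)).indicator (fun r => ENNReal.ofReal r ^ m) q.2)
    rw [lintegral_prod_mul (f := fun y : sphere (0 : F) 1 => φ y)
      (hφ.comp measurable_subtype_coe).aemeasurable hm1.aemeasurable, h3] at h4
    rw [h1, lintegral_congr h2, h4, mul_comm, mul_assoc, ENNReal.inv_mul_cancel, mul_one]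
    · exact_mod_cast (by omega : finrank ℝ F + m ≠ 0)
    · exact ENNReal.natCast_ne_top _
  have h0 := key 0
  simp only [pow_zero, one_mul, add_zero] at h0
  rw [key n, h0]

lemma sphereUniform_eq_map_subtype {d : ℕ} {L : Submodule ℝ (EuclideanSpace ℝ (Fin d))}
    (hL : L ≠ ⊥) :
    sphereUniform L = (ballMeasure L).map fun a : L => normalize (a : EuclideanSpace ℝ (Fin d)) := by
  have : Nontrivial L := Submodule.nontrivial_iff_ne_bot.2 hL
  have h := congrArg (Measure.map ((↑) : L → EuclideanSpace ℝ (Fin d)))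
    (inv_smul_map_coe_toSphere (F := L))
  rw [Measure.map_smul, Measure.map_map measurable_subtype_coe measurable_subtype_coe,
    Measure.map_map measurable_subtype_coe measurable_normalize] at h
  exact h

/-- The normalized projection of a uniform point of the ball is uniform on the sphere of the
subspace. -/
lemma map_normalize_starProjection [Nontrivial F] (L : Submodule ℝ F) (hL : L ≠ ⊥) :
    (ballMeasure F).map (fun z => normalize (L.starProjection z)) =
      (ballMeasure L).map fun a : L => normalize (a : F) := by
  have : Nontrivial L := Submodule.nontrivial_iff_ne_bot.2 hL
  have hmL : Measurable fun a : L => normalize (a : F) :=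
    measurable_subtype_coe.comp measurable_normalize
  have hmF : Measurable fun z : F => normalize (L.starProjection z) :=
    measurable_normalize.comp L.starProjection.continuous.measurable
  -- Fubini along `F = L ⊕ Lᗮ`
  have key : ∃ c : ℝ≥0∞, ∀ s : Set F, MeasurableSet s →
      (ballMeasure F) ((fun z => normalize (L.starProjection z)) ⁻¹' s) =
        c * (ballMeasure L) ((fun a : L => normalize (a : F)) ⁻¹' s) := by
    have hmp : MeasurePreserving
        (fun z : F => (L.orthogonalProjectionOnto z, Lᗮ.orthogonalProjectionOnto z))
        volume volume := by
      have := (WithLp.volume_preserving_ofLp L Lᗮ).comp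
        L.orthogonalDecomposition.measurePreserving
      have e : (fun z : F => (L.orthogonalProjectionOnto z, Lᗮ.orthogonalProjectionOnto z)) =
          WithLp.ofLp ∘ ⇑L.orthogonalDecomposition := by
        funext z
        simp
      rw [e]
      exact this
    let ρ : Lᗮ → ℝ := fun u => √(1 - ‖u‖ ^ 2)
    refine ⟨(volume (ball (0 : F) 1))⁻¹ *
      (∫⁻ u : Lᗮ, ENNReal.ofReal (ρ u ^ finrank ℝ L)) * volume (ball (0 : L) 1),
      fun s hs => ?_⟩
    set S : Set L := (fun a : L => normalize (a : F)) ⁻¹' s ∩ ball 0 1 with hS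
    have hSm : MeasurableSet S := (hmL hs).inter measurableSet_ball
    set T : Set (L × Lᗮ) := {q | (normalize q.1 : F) ∈ s ∧ ‖q.1‖ ^ 2 + ‖q.2‖ ^ 2 < 1} with hT
    have hTm : MeasurableSet T :=
      ((hmL.comp measurable_fst) hs).inter
        (measurableSet_lt ((measurable_fst.norm.pow_const 2).add (measurable_snd.norm.pow_const 2))
          measurable_const)
    have h1 : (fun z => normalize (L.starProjection z)) ⁻¹' s ∩ ball (0 : F) 1 =
        (fun z : F => (L.orthogonalProjectionOnto z, Lᗮ.orthogonalProjectionOnto z)) ⁻¹' T := by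
      ext z
      have e1 : (normalize (L.orthogonalProjectionOnto z) : F) =
          normalize (L.starProjection z) := by
        rw [Submodule.coe_orthogonalProjectionOnto_apply]
      have e2 := L.norm_sq_eq_add_norm_sq_projection z
      simp only [mem_inter_iff, mem_preimage, mem_ball_zero_iff, hT, mem_ofPred_eq, e1, ← e2,
        sq_lt_one_iff₀ (norm_nonneg z)]
    -- The slice of the ball over `u` has radius `ρ u`; since `normalize` ignores positive scalars,
    -- the slice of `T` is `S` dilated by `ρ u`.
    have h2 : ∀ u : Lᗮ, volume ((fun a : L => (a, u)) ⁻¹' T) =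
        ENNReal.ofReal (ρ u ^ finrank ℝ L) * volume S := by
      intro u
      by_cases hu : ‖u‖ ^ 2 < 1
      · have hρ : 0 < ρ u := Real.sqrt_pos.2 (by linarith)
        have hρ2 : ρ u ^ 2 = 1 - ‖u‖ ^ 2 := Real.sq_sqrt (by linarith)
        rw [← Measure.addHaar_smul_of_nonneg _ hρ.le]
        congr 1
        ext a
        rw [mem_smul_set_iff_inv_smul_mem₀ hρ.ne']
        simp only [hT, hS, mem_preimage, mem_ofPred_eq, mem_inter_iff, mem_ball_zero_iff,
          Submodule.coe_smul, normalize_smul (inv_pos.2 hρ), norm_smul, norm_inv, Real.norm_eq_abs, abs_of_pos hρ]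
        refine and_congr_right fun _ => ?_
        rw [inv_mul_lt_iff₀ hρ, mul_one, ← pow_lt_pow_iff_left₀ (norm_nonneg a) hρ.le two_ne_zero,
          hρ2]
        exact ⟨fun h => by linarith, fun h => by linarith⟩
      · have hρ : ρ u = 0 := Real.sqrt_eq_zero_of_nonpos (by linarith)
        rw [hρ, zero_pow finrank_pos.ne', ENNReal.ofReal_zero, zero_mul]
        convert measure_empty (μ := volume)
        refine eq_empty_of_forall_notMem fun a ha => hu ?_
        have := ha.2
        simp only at this
        nlinarith [sq_nonneg ‖a‖]
    have h3 : (ballMeasure L) ((fun a : L => normalize (a : F)) ⁻¹' s) =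
        (volume (ball (0 : L) 1))⁻¹ * volume S := by
      rw [ballMeasure, Measure.smul_apply, Measure.restrict_apply (hmL hs), smul_eq_mul]
    rw [h3, ballMeasure, Measure.smul_apply, Measure.restrict_apply (hmF hs), smul_eq_mul, h1,
      hmp.measure_preimage hTm.nullMeasurableSet, Measure.volume_eq_prod,
      Measure.prod_apply_symm hTm]
    simp_rw [h2]
    rw [lintegral_mul_const _ (by fun_prop), mul_assoc, mul_assoc, ← mul_assoc (volume (ball _ _)),
      ENNReal.mul_inv_cancel volume_ball_ne_zero volume_ball_ne_top, one_mul]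
  obtain ⟨c, hc⟩ := key
  -- Both sides are probability measures, so the constant need not be computed.
  have hc1 : c = 1 := by
    have := hc univ MeasurableSet.univ
    simpa using this.symm
  ext s hs
  rw [Measure.map_apply hmF hs, Measure.map_apply hmL hs, hc s hs, hc1, one_mul]

end Sphere

open scoped NNReal
open Classical

/-! ### One step of the sequential construction: orthogonal complements, averages, weights -/

section Steps

/-- The ambient Euclidean space. -/
abbrev Euc (d : ℕ) := EuclideanSpace ℝ (Fin d)

variable {V : Type*} [Fintype V] {d : ℕ}

/-- The subspace orthogonal to the vectors indexed by `N`. -/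
noncomputable def perp (N : Finset V) (x : V → Euc d) : Submodule ℝ (Euc d) :=
  (Submodule.span ℝ (x '' (N : Set V)))ᗮ

lemma mem_perp {N : Finset V} {x : V → Euc d} {z : Euc d} :
    z ∈ perp N x ↔ ∀ u ∈ N, inner ℝ (x u) z = 0 := by
  rw [perp, Submodule.mem_orthogonal]
  constructor
  · intro h u hu
    exact h _ (Submodule.subset_span ⟨u, hu, rfl⟩)
  · intro h y hy
    induction hy using Submodule.span_induction with
    | mem y hy => obtain ⟨u, hu, rfl⟩ := hy; exact h u hu
    | zero => simp
    | add a b _ _ ha hb => rw [inner_add_left, ha, hb, add_zero]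
    | smul c a _ ha => rw [inner_smul_left, ha, mul_zero]

lemma perp_congr {N : Finset V} {x y : V → Euc d} (h : ∀ u ∈ N, x u = y u) :
    perp N x = perp N y := by
  ext z
  rw [mem_perp, mem_perp]
  exact forall₂_congr fun u hu => by rw [h u hu]

lemma perp_update {N : Finset V} {v : V} (hv : v ∉ N) (x : V → Euc d) (y : Euc d) :
    perp N (Function.update x v y) = perp N x :=
  perp_congr fun _ hu => Function.update_of_ne (fun h => hv (by rw [← h]; exact hu)) _ _

lemma perp_empty (x : V → Euc d) : perp ∅ x = ⊤ := by
  ext z; simp [mem_perp]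

lemma perp_ne_bot {N : Finset V} (hN : N.card < d) (x : V → Euc d) : perp N x ≠ ⊥ := by
  intro h
  have h1 := Submodule.finrank_add_finrank_orthogonal (Submodule.span ℝ (x '' (N : Set V)))
  rw [perp] at h
  rw [h, finrank_bot, finrank_euclideanSpace_fin, add_zero] at h1
  have h2 := finrank_span_finset_le_card (R := ℝ) (N.image x)
  rw [Finset.coe_image] at h2
  have h3 : (N.image x).card ≤ N.card := Finset.card_image_le
  simp only [Set.finrank] at h2
  omega

lemma finrank_perp {N : Finset V} {x : V → Euc d} (h : LinearIndependent ℝ fun i : N => x i) :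
    finrank ℝ (perp N x) = d - N.card := by
  have h1 := Submodule.finrank_add_finrank_orthogonal (Submodule.span ℝ (x '' (N : Set V)))
  have h2 := finrank_span_eq_card h
  have h3 : range (fun i : N => x i) = x '' (N : Set V) := by
    ext z; simp
  rw [h3, Fintype.card_coe] at h2
  rw [h2, finrank_euclideanSpace_fin] at h1
  rw [perp]
  omega

/-- Orthogonal projection to `perp N x`. -/
noncomputable def perpProj (N : Finset V) (x : V → Euc d) (z : Euc d) : Euc d :=
  (perp N x).starProjection z

/-- One Gram–Schmidt step. If `x a` already lies in the span, its projection is `0` and the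
correction vanishes. -/
lemma perpProj_insert (a : V) (N : Finset V) (x : V → Euc d) (z : Euc d) :
    perpProj (insert a N) x z = perpProj N x z -
      (inner ℝ (perpProj N x (x a)) (perpProj N x z) / ‖perpProj N x (x a)‖ ^ 2) •
        perpProj N x (x a) := by
  set p := perpProj N x (x a) with hp
  set q := perpProj N x z with hq
  have hpm : p ∈ perp N x := Submodule.starProjection_apply_mem _ _
  have hqm : q ∈ perp N x := Submodule.starProjection_apply_mem _ _
  have hspan : ∀ w, w - perpProj N x w ∈ Submodule.span ℝ (x '' (N : Set V)) := by
    intro w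
    have := Submodule.sub_starProjection_mem_orthogonal (K := perp N x) w
    rwa [perp, Submodule.orthogonal_orthogonal] at this
  have hle : Submodule.span ℝ (x '' (N : Set V)) ≤
      Submodule.span ℝ (x '' (insert a N : Finset V)) :=
    Submodule.span_mono (image_mono (by simp))
  have hpq : ∀ w ∈ perp N x, inner ℝ (x a) w = inner ℝ p w := by
    intro w hw
    have h0 : inner ℝ (x a - p) w = 0 :=
      (Submodule.mem_orthogonal _ _).1 hw _ (hspan (x a))
    rw [inner_sub_left] at h0
    linarith
  unfold perpProj
  apply Submodule.eq_starProjection_of_mem_orthogonal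
  · rw [mem_perp]
    intro u hu
    rcases Finset.mem_insert.1 hu with rfl | hu
    · rw [inner_sub_right, inner_smul_right, hpq q hqm, hpq p hpm, real_inner_self_eq_norm_sq]
      by_cases h0 : p = 0
      · simp [h0]
      · have : ‖p‖ ^ 2 ≠ 0 := pow_ne_zero _ (norm_ne_zero_iff.2 h0)
        field_simp
        ring
    · rw [inner_sub_right, inner_smul_right, mem_perp.1 hqm u hu, mem_perp.1 hpm u hu]
      simp
  · rw [perp, Submodule.orthogonal_orthogonal]
    have e : z - (q - (inner ℝ p q / ‖p‖ ^ 2) • p) =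
        (z - q) + (inner ℝ p q / ‖p‖ ^ 2) • (x a - (x a - p)) := by abel_nf
    rw [e]
    refine Submodule.add_mem _ (hle (hspan z)) (Submodule.smul_mem _ _ (Submodule.sub_mem _ ?_
      (hle (hspan (x a)))))
    exact Submodule.subset_span ⟨a, by simp, rfl⟩

lemma perpProj_empty (x : V → Euc d) (z : Euc d) : perpProj ∅ x z = z :=
  Submodule.starProjection_eq_self_iff.2 (by rw [perp_empty]; trivial)

/-- The subspace moves with `x`, possibly with jumps of dimension; the Gram–Schmidt recursion gives
joint measurability nevertheless. -/
lemma measurable_perpProj (N : Finset V) :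
    Measurable fun q : (V → Euc d) × Euc d => perpProj N q.1 q.2 := by
  induction N using Finset.induction_on with
  | empty =>
    have : (fun q : (V → Euc d) × Euc d => perpProj ∅ q.1 q.2) = Prod.snd := by
      funext q
      exact perpProj_empty _ _
    rw [this]
    exact measurable_snd
  | insert a N ha ih =>
    simp_rw [perpProj_insert]
    have h1 : Measurable fun q : (V → Euc d) × Euc d => perpProj N q.1 (q.1 a) :=
      ih.comp (measurable_fst.prodMk ((measurable_pi_apply a).comp measurable_fst))
    exact ih.sub (((h1.inner ih).div (h1.norm.pow_const 2)).smul h1)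

/-- The source measure no longer depends on `x`, so averages over moving spheres become parametric
integrals against one fixed measure. -/
lemma sphereUniform_perp {N : Finset V} (hN : N.card < d) (x : V → Euc d) :
    sphereUniform (perp N x) = (ballMeasure (Euc d)).map fun z => normalize (perpProj N x z) := by
  have hd : 0 < d := by omega
  have : Nontrivial (Euc d) := by
    have : Nonempty (Fin d) := ⟨⟨0, hd⟩⟩
    infer_instance
  have h := perp_ne_bot hN x
  exact (sphereUniform_eq_map_subtype h).trans
    (map_normalize_starProjection (F := Euc d) (perp N x) h).symm

lemma measurable_normalize_perpProj (N : Finset V) (x : V → Euc d) :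
    Measurable fun z => normalize (perpProj N x z) :=
  measurable_normalize.comp (perp N x).starProjection.continuous.measurable

/-- The average of `h` over the choice of a uniform unit vector at `v` orthogonal to `x_u`,
`u ∈ N`. -/
noncomputable def perpAvg (N : Finset V) (v : V) (h : (V → Euc d) → ℝ≥0∞) (x : V → Euc d) : ℝ≥0∞ :=
  ∫⁻ y, h (Function.update x v y) ∂sphereUniform (perp N x)

lemma perpAvg_eq {N : Finset V} (hN : N.card < d) (v : V) {h : (V → Euc d) → ℝ≥0∞}
    (hh : Measurable h) (x : V → Euc d) :
    perpAvg N v h x =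
      ∫⁻ z, h (Function.update x v (normalize (perpProj N x z))) ∂ballMeasure (Euc d) := by
  rw [perpAvg, sphereUniform_perp hN,
    lintegral_map (f := fun y => h (Function.update x v y))
      (g := fun z => normalize (perpProj N x z)) (hh.comp (measurable_update x))
      (measurable_normalize_perpProj N x)]

lemma measurable_update_normalize_perpProj (N : Finset V) (v : V) :
    Measurable fun q : (V → Euc d) × Euc d =>
      Function.update q.1 v (normalize (perpProj N q.1 q.2)) := by
  refine measurable_pi_iff.2 fun w => ?_
  by_cases hw : w = v
  · subst hw
    simp only [Function.update_self]
    exact measurable_normalize.comp (measurable_perpProj N)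
  · simp only [Function.update_of_ne hw]
    exact (measurable_pi_apply w).comp measurable_fst

lemma measurable_perpAvg {N : Finset V} (hN : N.card < d) (v : V) {h : (V → Euc d) → ℝ≥0∞}
    (hh : Measurable h) : Measurable (perpAvg N v h) := by
  have : perpAvg N v h = fun x =>
      ∫⁻ z, h (Function.update x v (normalize (perpProj N x z))) ∂ballMeasure (Euc d) :=
    funext fun x => perpAvg_eq hN v hh x
  rw [this]
  exact (hh.comp (measurable_update_normalize_perpProj N v)).lintegral_prod_right'

lemma perpAvg_ball {N : Finset V} (hN : N.card < d) (v : V) {h : (V → Euc d) → ℝ≥0∞}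
    (hh : Measurable h) (x : V → Euc d) :
    perpAvg N v h x = (volume (ball (0 : perp N x) 1))⁻¹ *
      ∫⁻ a : perp N x in ball 0 1, h (Function.update x v (normalize (a : Euc d))) := by
  rw [perpAvg, sphereUniform_eq_map_subtype (perp_ne_bot hN x),
    lintegral_map (f := fun y => h (Function.update x v y))
      (g := fun a : perp N x => normalize (a : Euc d)) (hh.comp (measurable_update x))
      (measurable_normalize.comp measurable_subtype_coe), lintegral_ballMeasure]

/-- The uniform distribution on the unit sphere. -/
noncomputable def sphereLaw (d : ℕ) : Measure (Euc d) := (ballMeasure (Euc d)).map normalize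

instance : IsProbabilityMeasure (sphereLaw d) :=
  Measure.isProbabilityMeasure_map measurable_normalize.aemeasurable

lemma sphereUniform_perp_empty (hd : 0 < d) (x : V → Euc d) :
    sphereUniform (perp ∅ x) = sphereLaw d := by
  rw [sphereUniform_perp (by simpa using hd), sphereLaw]
  simp_rw [perpProj_empty]

lemma continuous_gram_det (S : Finset V) :
    Continuous fun x : V → Euc d => (Matrix.gram ℝ fun i : S => x i).det := by
  refine Continuous.matrix_det (continuous_matrix fun i j => ?_)
  simp only [Matrix.gram_apply]
  exact (continuous_apply _).inner (continuous_apply _)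

lemma continuous_gramDet (S : Finset V) : Continuous fun x : V → Euc d => gramDet S x :=
  (continuous_gram_det S).sqrt

lemma gramDet_nonneg (S : Finset V) (x : V → Euc d) : 0 ≤ gramDet S x := Real.sqrt_nonneg _

lemma gram_det_nonneg (S : Finset V) (x : V → Euc d) :
    0 ≤ (Matrix.gram ℝ fun i : S => x i).det := (Matrix.posSemidef_gram ℝ _).det_nonneg

lemma gramDet_pos_iff {S : Finset V} {x : V → Euc d} :
    0 < gramDet S x ↔ LinearIndependent ℝ fun i : S => x i := by
  rw [gramDet, Real.sqrt_pos, ← Matrix.det_gram_ne_zero_iff_linearIndependent]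
  exact ⟨fun h => h.ne', fun h => (gram_det_nonneg S x).lt_of_ne' h⟩

lemma gramDet_congr {S : Finset V} {x y : V → Euc d} (h : ∀ u ∈ S, x u = y u) :
    gramDet S x = gramDet S y := by
  have : (fun i : S => x i) = fun i : S => y i := funext fun i => h i i.2
  rw [gramDet, gramDet, this]

lemma gramDet_empty (x : V → Euc d) : gramDet ∅ x = 1 := by
  simp [gramDet]

/-- The density factor `s_{d,n}` as an extended nonnegative real. -/
noncomputable def weight (S : Finset V) (x : V → Euc d) : ℝ≥0∞ := ENNReal.ofReal (sDensity S x)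

lemma measurable_sDensity (S : Finset V) : Measurable fun x : V → Euc d => sDensity S x := by
  unfold sDensity
  exact ((continuous_gramDet S).measurable.const_div 1).const_mul _

lemma measurable_weight (S : Finset V) : Measurable fun x : V → Euc d => weight S x :=
  (measurable_sDensity S).ennreal_ofReal

lemma sDensity_congr {S : Finset V} {x y : V → Euc d} (h : ∀ u ∈ S, x u = y u) :
    sDensity S x = sDensity S y := by
  rw [sDensity, sDensity, gramDet_congr h]

lemma weight_congr {S : Finset V} {x y : V → Euc d} (h : ∀ u ∈ S, x u = y u) :
    weight S x = weight S y := by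
  rw [weight, weight, sDensity_congr h]

lemma sphereArea_eq (k : ℕ) : sphereArea k =
    (k + 1 : ℕ) * (volume (ball (0 : Euc (k + 1)) 1)).toReal := by
  rw [sphereArea, Measure.toSphere_real_apply_univ, finrank_euclideanSpace_fin]
  rfl

lemma sphereArea_pos (k : ℕ) : 0 < sphereArea k := by
  rw [sphereArea_eq]
  have := ENNReal.toReal_pos (volume_ball_ne_zero (F := Euc (k + 1))) volume_ball_ne_top
  positivity

lemma sDensity_nonneg (S : Finset V) (x : V → Euc d) : 0 ≤ sDensity S x := by
  have h1 := (sphereArea_pos (d - 1)).le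
  have h2 := (sphereArea_pos (d - 2)).le
  have h3 := (sphereArea_pos (d - S.card - 1)).le
  have h4 := gramDet_nonneg S x
  unfold sDensity
  positivity

lemma weight_empty (x : V → Euc d) : weight ∅ x = 1 := by
  have h := (sphereArea_pos (d - 1)).ne'
  simp [weight, sDensity, gramDet_empty, h]

end Steps

/-! ### Linear coordinates given by inner products with a frame -/

section Frame

variable {d : ℕ} {ι : Type*} [Fintype ι] [DecidableEq ι]

/-- The matrix whose rows are the vectors `r i`, with columns reindexed. -/
noncomputable def frameMatrix (τ : ι ≃ Fin d) (r : ι → Euc d) : Matrix ι ι ℝ :=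
  Matrix.of fun i j => r i (τ j)

/-- The vector having prescribed inner products with the vectors `r i`. -/
noncomputable def frameInv (τ : ι ≃ Fin d) (r : ι → Euc d) (w : ι → ℝ) : Euc d :=
  WithLp.toLp 2 fun k => ((frameMatrix τ r)⁻¹.mulVec w) (τ.symm k)

lemma inner_eq_sum (τ : ι ≃ Fin d) (y z : Euc d) :
    inner ℝ y z = ∑ j, y (τ j) * z (τ j) := by
  rw [PiLp.inner_apply, ← τ.sum_comp]
  exact Finset.sum_congr rfl fun j _ => by simp [mul_comm]

lemma frameMatrix_mul_transpose (τ : ι ≃ Fin d) (r : ι → Euc d) :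
    frameMatrix τ r * (frameMatrix τ r).transpose = Matrix.gram ℝ r := by
  ext i j
  simp [Matrix.mul_apply, frameMatrix, inner_eq_sum τ]

lemma inner_frameInv (τ : ι ≃ Fin d) {r : ι → Euc d} (h : (frameMatrix τ r).det ≠ 0)
    (w : ι → ℝ) (i : ι) : inner ℝ (r i) (frameInv τ r w) = w i := by
  have h1 : (frameMatrix τ r).mulVec ((frameMatrix τ r)⁻¹.mulVec w) = w := by
    rw [Matrix.mulVec_mulVec, Matrix.mul_nonsing_inv _ (Ne.isUnit h), Matrix.one_mulVec]
  have h2 := congrFun h1 i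
  rw [inner_eq_sum τ]
  simpa [frameInv, Matrix.mulVec, dotProduct, frameMatrix] using h2

lemma frameInv_inner (τ : ι ≃ Fin d) {r : ι → Euc d} (h : (frameMatrix τ r).det ≠ 0)
    (z : Euc d) : frameInv τ r (fun i => inner ℝ (r i) z) = z := by
  have h1 : (fun i => inner ℝ (r i) z) = (frameMatrix τ r).mulVec fun j => z (τ j) := by
    funext i
    simp [inner_eq_sum τ, Matrix.mulVec, dotProduct, frameMatrix]
  ext k
  simp only [frameInv, h1, Matrix.mulVec_mulVec, Matrix.nonsing_inv_mul _ (Ne.isUnit h),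
    Matrix.one_mulVec, Equiv.apply_symm_apply]

/-- `frameInv` is the inverse of the frame matrix followed by a volume preserving relabelling of
coordinates. -/
lemma lintegral_comp_frameInv (τ : ι ≃ Fin d) {r : ι → Euc d} (h : (frameMatrix τ r).det ≠ 0)
    {ψ : Euc d → ℝ≥0∞} (hψ : Measurable ψ) :
    ∫⁻ w, ψ (frameInv τ r w) = ENNReal.ofReal |(frameMatrix τ r).det| * ∫⁻ z, ψ z := by
  set A := (frameMatrix τ r)⁻¹ with hA
  have hdet : A.det ≠ 0 := by
    rw [hA, Matrix.det_nonsing_inv, Ring.inverse_eq_inv']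
    exact inv_ne_zero h
  have h1 := Real.map_matrix_volume_pi_eq_smul_volume_pi hdet
  have h2 : MeasurePreserving (fun w : ι → ℝ => (WithLp.toLp 2 fun k => w (τ.symm k) : Euc d)) := by
    have e := volume_measurePreserving_piCongrLeft (fun _ : Fin d => ℝ) τ
    have e' : (⇑(MeasurableEquiv.piCongrLeft (fun _ : Fin d => ℝ) τ) : (ι → ℝ) → Fin d → ℝ) =
        fun w k => w (τ.symm k) := by
      funext w k
      have := Equiv.piCongrLeft_apply_apply (fun _ : Fin d => ℝ) τ w (τ.symm k)
      rw [Equiv.apply_symm_apply] at this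
      exact this
    rw [e'] at e
    exact (PiLp.volume_preserving_toLp (Fin d)).comp e
  have hm : Measurable fun w : ι → ℝ => ψ (WithLp.toLp 2 fun k => w (τ.symm k) : Euc d) :=
    hψ.comp h2.measurable
  have h3 : ∫⁻ w, ψ (frameInv τ r w) =
      ∫⁻ w, ψ (WithLp.toLp 2 fun k => w (τ.symm k) : Euc d)
        ∂(volume.map (Matrix.toLin' A)) := by
    rw [lintegral_map hm (LinearMap.continuous_of_finiteDimensional _).measurable]
    rfl
  rw [h3, h1, lintegral_smul_measure, h2.lintegral_comp hψ, smul_eq_mul, hA,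
    Matrix.det_nonsing_inv, Ring.inverse_eq_inv', inv_inv]

lemma continuous_frameMatrix (τ : ι ≃ Fin d) :
    Continuous fun r : ι → Euc d => frameMatrix τ r := by
  refine continuous_matrix fun i j => ?_
  simp only [frameMatrix, Matrix.of_apply]
  fun_prop

lemma continuousAt_frameInv (τ : ι ≃ Fin d) {r : ι → Euc d} (h : (frameMatrix τ r).det ≠ 0)
    (w : ι → ℝ) :
    ContinuousAt (fun q : (ι → Euc d) × (ι → ℝ) => frameInv τ q.1 q.2) (r, w) := by
  have h1 : Continuous fun q : (ι → Euc d) × (ι → ℝ) => frameMatrix τ q.1 :=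
    (continuous_frameMatrix τ).comp continuous_fst
  have h2 : ContinuousAt (fun q : (ι → Euc d) × (ι → ℝ) => (frameMatrix τ q.1)⁻¹) (r, w) := by
    simp only [Matrix.inv_def, Ring.inverse_eq_inv']
    exact (h1.matrix_det.continuousAt.inv₀ h).smul h1.matrix_adjugate.continuousAt
  have h3 : ContinuousAt (fun q : (ι → Euc d) × (ι → ℝ) =>
      (frameMatrix τ q.1)⁻¹.mulVec q.2) (r, w) := by
    rw [continuousAt_pi]
    intro i
    simp only [Matrix.mulVec, dotProduct]
    refine tendsto_finsetSum _ fun j _ => Tendsto.mul ?_ ?_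
    · exact (((continuous_apply_apply i j).continuousAt (x := (frameMatrix τ r)⁻¹)).tendsto.comp
        h2 :)
    · exact ((continuous_apply j).comp continuous_snd).continuousAt
  have h4 : Continuous fun w : ι → ℝ => (WithLp.toLp 2 fun k => w (τ.symm k) : Euc d) := by
    fun_prop
  exact h4.continuousAt.comp h3

end Frame

/-! ### Charts adapted to a thin slab -/

section Chart

variable {V : Type*} [Fintype V] {d : ℕ} {N : Finset V}

/-- Data adapted to a subspace of dimension `d - |N|`. -/
structure ChartData (N : Finset V) (F : Submodule ℝ (Euc d)) where
  basis : OrthonormalBasis (Fin (d - N.card)) ℝ F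
  reindex : N ⊕ Fin (d - N.card) ≃ Fin d

lemma exists_chartData (hN : N.card < d) {x : V → Euc d}
    (hx : LinearIndependent ℝ fun i : N => x i) : Nonempty (ChartData N (perp N x)) := by
  refine ⟨⟨(stdOrthonormalBasis ℝ (perp N x)).reindex (finCongr (finrank_perp hx)),
    Fintype.equivOfCardEq ?_⟩⟩
  simp
  omega

namespace ChartData

variable {F : Submodule ℝ (Euc d)} (c : ChartData N F)

/-- The vectors `x_u`, `u ∈ N`, together with a fixed orthonormal basis of `F`. -/
noncomputable def frame (x : V → Euc d) : N ⊕ Fin (d - N.card) → Euc d :=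
  Sum.elim (fun u => x u) fun j => (c.basis j : Euc d)

/-- The determinant of the frame. -/
noncomputable def jac (x : V → Euc d) : ℝ := |(frameMatrix c.reindex (c.frame x)).det|

/-- The vector whose inner products with `x_u` are `ε w_u` and whose projection to `F` is `a`. -/
noncomputable def chart (ε : ℝ) (x : V → Euc d) (q : (N → ℝ) × F) : Euc d :=
  frameInv c.reindex (c.frame x) (Sum.elim (ε • q.1) fun j => c.basis.repr q.2 j)

lemma det_ne_zero {x : V → Euc d} (h : c.jac x ≠ 0) :
    (frameMatrix c.reindex (c.frame x)).det ≠ 0 := by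
  rw [jac] at h
  exact abs_ne_zero.1 h

lemma frame_inl (x : V → Euc d) (u : N) : c.frame x (Sum.inl u) = x u := rfl

lemma frame_inr (x : V → Euc d) (j : Fin (d - N.card)) :
    c.frame x (Sum.inr j) = (c.basis j : Euc d) := rfl

lemma continuous_frame : Continuous c.frame := by
  refine continuous_pi fun i => ?_
  rcases i with u | j
  · exact continuous_apply _
  · exact continuous_const

lemma continuous_jac : Continuous c.jac :=
  (((continuous_frameMatrix _).comp c.continuous_frame).matrix_det).abs

lemma inner_chart_left {x : V → Euc d} (h : c.jac x ≠ 0) (ε : ℝ) (q : (N → ℝ) × F) (u : N) :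
    inner ℝ (x u) (c.chart ε x q) = ε * q.1 u := by
  have := inner_frameInv c.reindex (c.det_ne_zero h)
    (Sum.elim (ε • q.1) fun j => c.basis.repr q.2 j) (Sum.inl u)
  rw [frame_inl, Sum.elim_inl, Pi.smul_apply, smul_eq_mul] at this
  exact this

lemma inner_chart_right {x : V → Euc d} (h : c.jac x ≠ 0) (ε : ℝ) (q : (N → ℝ) × F)
    (j : Fin (d - N.card)) :
    inner ℝ (c.basis j : Euc d) (c.chart ε x q) = c.basis.repr q.2 j := by
  have := inner_frameInv c.reindex (c.det_ne_zero h)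
    (Sum.elim (ε • q.1) fun j => c.basis.repr q.2 j) (Sum.inr j)
  rw [frame_inr, Sum.elim_inr] at this
  exact this

/-- The component `q.2` is the orthogonal projection of the chart point to `F`. -/
lemma norm_le_norm_chart {x : V → Euc d} (h : c.jac x ≠ 0) (ε : ℝ) (q : (N → ℝ) × F) :
    ‖q.2‖ ≤ ‖c.chart ε x q‖ := by
  have h1 : F.orthogonalProjectionOnto (c.chart ε x q) = q.2 := by
    apply c.basis.repr.injective
    ext j
    rw [c.basis.repr_apply_apply, ← c.inner_chart_right h ε q j,
      Submodule.inner_orthogonalProjectionOnto_eq_of_mem_left]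
  rw [← h1]
  exact Submodule.norm_orthogonalProjectionOnto_apply_le _ _

/-- At `ε = 0` the slab collapses to `F`. The subspace stays fixed while `x` varies in the charts,
so `F = perp N x` is assumed only at the base point. -/
lemma chart_zero {x : V → Euc d} (h : c.jac x ≠ 0) (hF : F = perp N x) (q : (N → ℝ) × F) :
    c.chart 0 x q = q.2 := by
  have hq : (q.2 : Euc d) ∈ perp N x := hF ▸ q.2.2
  have h1 : (Sum.elim ((0 : ℝ) • q.1) fun j => c.basis.repr q.2 j :
      N ⊕ Fin (d - N.card) → ℝ) = fun i => inner ℝ (c.frame x i) (q.2 : Euc d) := by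
    funext i
    rcases i with u | j
    · rw [frame_inl, mem_perp.1 hq u u.2]
      simp
    · rw [frame_inr, Sum.elim_inr, c.basis.repr_apply_apply, Submodule.coe_inner]
  rw [chart, h1]
  exact frameInv_inner c.reindex (c.det_ne_zero h) _

/-- The basis of `F` is orthonormal and orthogonal to the `x_u`, so the Gram matrix of the frame is
block diagonal with an identity block. This is the origin of the factor `1 / Det` in `s_{d,n}`. -/
lemma jac_eq_gramDet {x : V → Euc d} (hF : F = perp N x) : c.jac x = gramDet N x := by
  have h1 : (frameMatrix c.reindex (c.frame x)).det ^ 2 =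
      (Matrix.gram ℝ fun i : N => x i).det := by
    have h2 := congrArg Matrix.det (frameMatrix_mul_transpose c.reindex (c.frame x))
    rw [Matrix.det_mul, Matrix.det_transpose, ← sq] at h2
    rw [h2]
    have h3 : Matrix.gram ℝ (c.frame x) =
        Matrix.fromBlocks (Matrix.gram ℝ fun i : N => x i) 0 0 1 := by
      ext i j
      rcases i with u | i <;> rcases j with v | j
      · simp [frame]
      · have hq : (c.basis j : Euc d) ∈ perp N x := hF ▸ (c.basis j).2
        simpa [frame] using mem_perp.1 hq u u.2
      · have hq : (c.basis i : Euc d) ∈ perp N x := hF ▸ (c.basis i).2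
        simpa [frame, real_inner_comm] using mem_perp.1 hq v v.2
      · have := orthonormal_iff_ite.1 c.basis.orthonormal i j
        simpa [frame, Matrix.one_apply] using this
    rw [h3, Matrix.det_fromBlocks_zero₂₁, Matrix.det_one, mul_one]
  rw [jac, gramDet, ← h1, Real.sqrt_sq_eq_abs]

/-- Coordinates on the product of `ℝ^N` with the subspace. -/
lemma measurePreserving_coords : MeasurePreserving
    (fun q : (N → ℝ) × F =>
      (Sum.elim q.1 fun j => c.basis.repr q.2 j : N ⊕ Fin (d - N.card) → ℝ)) := by
  have h1 : MeasurePreserving (fun a : F => (fun j => c.basis.repr a j : Fin (d - N.card) → ℝ)) :=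
    (PiLp.volume_preserving_ofLp (Fin (d - N.card))).comp c.basis.measurePreserving_repr
  have h2 := (volume_measurePreserving_sumPiEquivProdPi_symm
    (fun _ : N ⊕ Fin (d - N.card) => ℝ)).comp ((MeasurePreserving.id volume).prod h1)
  have e : (fun q : (N → ℝ) × F =>
      (Sum.elim q.1 fun j => c.basis.repr q.2 j : N ⊕ Fin (d - N.card) → ℝ)) =
      (⇑(MeasurableEquiv.sumPiEquivProdPi fun _ : N ⊕ Fin (d - N.card) => ℝ).symm ∘
        Prod.map id fun (a : F) j => c.basis.repr a j) := by
    funext q i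
    rcases i with u | j <;> rfl
  rw [e]
  exact h2

/-- Dilating the `N`-coordinates by `ε` produces the factor `ε^(-|N|)` that the normalization of
`slabAvg` contains. -/
lemma lintegral_comp_chart {x : V → Euc d} (h : c.jac x ≠ 0) {ε : ℝ} (hε : 0 < ε)
    {ψ : Euc d → ℝ≥0∞} (hψ : Measurable ψ) :
    ∫⁻ q, ψ (c.chart ε x q) =
      ENNReal.ofReal (c.jac x) * (ENNReal.ofReal ε ^ N.card)⁻¹ * ∫⁻ z, ψ z := by
  set G : (N → ℝ) × F → ℝ≥0∞ := fun q => ψ (frameInv c.reindex (c.frame x)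
    (Sum.elim q.1 fun j => c.basis.repr q.2 j)) with hG
  have hψ' : Measurable fun w => ψ (frameInv c.reindex (c.frame x) w) := by
    refine hψ.comp (Continuous.measurable ?_)
    unfold frameInv Matrix.mulVec dotProduct
    fun_prop
  have hGm : Measurable G := hψ'.comp c.measurePreserving_coords.measurable
  have h1 : ∫⁻ q, G q = ENNReal.ofReal (c.jac x) * ∫⁻ z, ψ z := by
    rw [hG, c.measurePreserving_coords.lintegral_comp hψ',
      lintegral_comp_frameInv _ (c.det_ne_zero h) hψ, jac]
  have h2 : ∀ a : F, ∫⁻ w, G (ε • w, a) =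
      (ENNReal.ofReal ε ^ N.card)⁻¹ * ∫⁻ w, G (w, a) := by
    intro a
    have h3 := Measure.map_addHaar_smul (volume : Measure (N → ℝ)) hε.ne'
    have h4 : Measurable fun w => G (w, a) := hGm.comp measurable_prodMk_right
    rw [← lintegral_map (f := fun w => G (w, a)) h4 (measurable_const_smul ε), h3,
      lintegral_smul_measure, smul_eq_mul, finrank_fintype_fun_eq_card, Fintype.card_coe,
      abs_of_nonneg (by positivity), ENNReal.ofReal_inv_of_pos (by positivity),
      ENNReal.ofReal_pow hε.le]
  have h5 : Measurable fun q : (N → ℝ) × F => G (ε • q.1, q.2) :=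
    hGm.comp ((measurable_fst.const_smul ε).prodMk measurable_snd)
  calc ∫⁻ q, ψ (c.chart ε x q) = ∫⁻ q : (N → ℝ) × F, G (ε • q.1, q.2) := rfl
    _ = ∫⁻ a : F, ∫⁻ w, G (ε • w, a) := by
      rw [Measure.volume_eq_prod, lintegral_prod_symm _ h5.aemeasurable]
    _ = (ENNReal.ofReal ε ^ N.card)⁻¹ * ∫⁻ q, G q := by
      simp_rw [h2]
      rw [Measure.volume_eq_prod, lintegral_prod_symm _ hGm.aemeasurable, lintegral_const_mul]
      exact hGm.lintegral_prod_left'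
    _ = _ := by rw [h1]; ring

end ChartData

end Chart

lemma sphereArea_eq_of_finrank {F : Type*} [NormedAddCommGroup F] [InnerProductSpace ℝ F]
    [FiniteDimensional ℝ F] [MeasurableSpace F] [BorelSpace F] {k : ℕ}
    (hF : finrank ℝ F = k + 1) :
    sphereArea k = (k + 1 : ℕ) * (volume (ball (0 : F) 1)).toReal := by
  rw [sphereArea_eq]
  have b : OrthonormalBasis (Fin (k + 1)) ℝ F :=
    (stdOrthonormalBasis ℝ F).reindex (finCongr hF)
  have h := b.measurePreserving_repr.measure_preimage
    (measurableSet_ball (x := (0 : Euc (k + 1))) (ε := 1)).nullMeasurableSet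
  rw [← h]
  congr 3
  ext z
  simp

/-! ### Averages over slabs, and bounds uniform in `ε` -/

section OneStep

variable {V : Type*} [Fintype V] {d : ℕ} {N : Finset V}

/-- The vectors almost orthogonal to `x_u`, `u ∈ N`. -/
def slab (N : Finset V) (x : V → Euc d) (ε : ℝ) : Set (Euc d) :=
  {y | ∀ u ∈ N, |inner ℝ (x u) y| < ε}

lemma measurableSet_slab_prod (N : Finset V) (ε : ℝ) :
    MeasurableSet {q : (V → Euc d) × Euc d | q.2 ∈ slab N q.1 ε} := by
  have : {q : (V → Euc d) × Euc d | q.2 ∈ slab N q.1 ε} =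
      ⋂ u ∈ N, {q : (V → Euc d) × Euc d | |inner ℝ (q.1 u) q.2| < ε} := by
    ext q
    simp [slab]
  rw [this]
  refine Finset.measurableSet_biInter _ fun u _ => ?_
  refine measurableSet_lt ?_ measurable_const
  have h : Continuous fun q : (V → Euc d) × Euc d => |inner ℝ (q.1 u) q.2| :=
    (((continuous_apply u).comp continuous_fst).inner continuous_snd).abs
  exact h.measurable

lemma measurableSet_slab (N : Finset V) (x : V → Euc d) (ε : ℝ) :
    MeasurableSet (slab N x ε) :=
  measurable_prodMk_left (measurableSet_slab_prod N ε)

/-- The limit of `P(|x ⬝ y| < ε) / ε` for random unit vectors. -/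
noncomputable def slabRate (d : ℕ) : ℝ := 2 * sphereArea (d - 2) / sphereArea (d - 1)

lemma slabRate_pos (d : ℕ) : 0 < slabRate d := by
  have h1 := sphereArea_pos (d - 1)
  have h2 := sphereArea_pos (d - 2)
  unfold slabRate
  positivity

/-- The `ε`-approximation of the operator `weight N * perpAvg N v`. -/
noncomputable def slabAvg (N : Finset V) (v : V) (ε : ℝ) (h : (V → Euc d) → ℝ≥0∞)
    (x : V → Euc d) : ℝ≥0∞ :=
  (ENNReal.ofReal (slabRate d * ε))⁻¹ ^ N.card *
    ∫⁻ y, (slab N x ε).indicator (fun y => h (Function.update x v y)) y ∂sphereLaw d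

lemma measurable_slabAvg (N : Finset V) (v : V) (ε : ℝ) {h : (V → Euc d) → ℝ≥0∞}
    (hh : Measurable h) : Measurable (slabAvg N v ε h) := by
  refine Measurable.const_mul ?_ _
  have hu : Measurable fun q : (V → Euc d) × Euc d => Function.update q.1 v q.2 := by
    refine measurable_pi_iff.2 fun w => ?_
    by_cases hw : w = v
    · subst hw
      simp only [Function.update_self]
      exact measurable_snd
    · simp only [Function.update_of_ne hw]
      exact (measurable_pi_apply w).comp measurable_fst
  exact ((hh.comp hu).indicator (measurableSet_slab_prod N ε)).lintegral_prod_right'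

/-- The integrand of `slabAvg` in polar coordinates. -/
noncomputable def slabKernel (N : Finset V) (v : V) (ε : ℝ) (h : (V → Euc d) → ℝ≥0∞)
    (x : V → Euc d) (z : Euc d) : ℝ≥0∞ :=
  (ball (0 : Euc d) 1).indicator
    (fun z => (slab N x ε).indicator (fun y => h (Function.update x v y)) (normalize z)) z

lemma measurable_slabKernel (v : V) (ε : ℝ) {h : (V → Euc d) → ℝ≥0∞} (hh : Measurable h)
    (x : V → Euc d) : Measurable (slabKernel N v ε h x) :=
  ((((hh.comp (measurable_update x)).indicator (measurableSet_slab N x ε))).comp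
    measurable_normalize).indicator measurableSet_ball

/-- All explicit powers of `ε` cancel, which leaves an integral over a domain independent of `ε`. -/
lemma slabAvg_eq_chart {F : Submodule ℝ (Euc d)} (c : ChartData N F) (v : V) {ε : ℝ} (hε : 0 < ε)
    {h : (V → Euc d) → ℝ≥0∞} (hh : Measurable h) {x : V → Euc d} (hx : c.jac x ≠ 0) :
    slabAvg N v ε h x =
      (ENNReal.ofReal (slabRate d))⁻¹ ^ N.card * (volume (ball (0 : Euc d) 1))⁻¹ *
        (ENNReal.ofReal (c.jac x))⁻¹ * ∫⁻ q, slabKernel N v ε h x (c.chart ε x q) := by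
  have hj : 0 < c.jac x := lt_of_le_of_ne (abs_nonneg _) hx.symm
  have hm := measurable_slabKernel (N := N) v ε hh x
  have hj0 : ENNReal.ofReal (c.jac x) ≠ 0 := by simpa using hj
  rw [c.lintegral_comp_chart hx hε hm, slabAvg, sphereLaw,
    lintegral_map (f := (slab N x ε).indicator fun y => h (Function.update x v y))
      ((hh.comp (measurable_update x)).indicator (measurableSet_slab N x ε))
      measurable_normalize, lintegral_ballMeasure, ← lintegral_indicator measurableSet_ball,
    ENNReal.ofReal_mul (slabRate_pos d).le,
    ENNReal.mul_inv (Or.inr ENNReal.ofReal_ne_top) (Or.inl ENNReal.ofReal_ne_top), mul_pow]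
  set I := ∫⁻ z, slabKernel N v ε h x z
  change _ * ((volume (ball (0 : Euc d) 1))⁻¹ * I) = _
  calc _ = (ENNReal.ofReal (slabRate d))⁻¹ ^ N.card * (volume (ball (0 : Euc d) 1))⁻¹ *
        ((ENNReal.ofReal (c.jac x))⁻¹ * ENNReal.ofReal (c.jac x)) *
        ((ENNReal.ofReal ε ^ N.card)⁻¹ * I) := by
        rw [ENNReal.inv_mul_cancel hj0 ENNReal.ofReal_ne_top, ENNReal.inv_pow]; ring
    _ = _ := by ring

/-- For a chart point `z`, the slab condition on `z / ‖z‖` reads `|w_u| < ‖z‖`, with `‖z‖ < 1`. The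
bounding function depends neither on `ε` nor on `x`, as dominated convergence requires. -/
lemma slabKernel_chart_le {F : Submodule ℝ (Euc d)} (c : ChartData N F) (v : V) {ε : ℝ}
    (hε : 0 < ε) {h : (V → Euc d) → ℝ≥0∞} {M : ℝ≥0∞} {x : V → Euc d} (hM : ∀ y, h y ≤ M)
    (hx : c.jac x ≠ 0) (q : (N → ℝ) × F) :
    slabKernel N v ε h x (c.chart ε x q) ≤
      (ball (0 : N → ℝ) 1 ×ˢ ball (0 : F) 1).indicator (fun _ => M) q := by
  unfold slabKernel
  by_cases h1 : c.chart ε x q ∈ ball (0 : Euc d) 1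
  swap
  · rw [indicator_of_notMem h1]; exact zero_le
  rw [indicator_of_mem h1]
  by_cases h2 : normalize (c.chart ε x q) ∈ slab N x ε
  swap
  · rw [indicator_of_notMem h2]; exact zero_le
  rw [indicator_of_mem h2]
  rw [mem_ball_zero_iff] at h1
  have h3 : q ∈ ball (0 : N → ℝ) 1 ×ˢ ball (0 : F) 1 := by
    refine ⟨?_, ?_⟩
    · rw [mem_ball_zero_iff, pi_norm_lt_iff one_pos]
      intro u
      have h4 := h2 u u.2
      rw [normalize, inner_smul_right, c.inner_chart_left hx, abs_mul, abs_mul, abs_of_pos hε,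
        abs_inv, abs_norm] at h4
      rw [Real.norm_eq_abs]
      -- At the origin `normalize` returns `0` and the slab condition says nothing, but there all
      -- the coordinates `q.1 u` vanish.
      by_cases h5 : c.chart ε x q = 0
      · have h6 := c.inner_chart_left hx ε q u
        rw [h5, inner_zero_right] at h6
        have h7 : q.1 u = 0 := by
          rcases mul_eq_zero.1 h6.symm with h | h
          · exact absurd h hε.ne'
          · exact h
        simp [h7]
      · have h6 : 0 < ‖c.chart ε x q‖ := norm_pos_iff.2 h5
        rw [inv_mul_lt_iff₀ h6, mul_comm ε, mul_lt_mul_iff_left₀ hε] at h4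
        exact h4.trans h1
    · rw [mem_ball_zero_iff]
      exact (c.norm_le_norm_chart hx ε q).trans_lt h1
  rw [indicator_of_mem h3]
  exact hM _

lemma volume_cube_prod_ball_lt_top {F : Submodule ℝ (Euc d)} :
    volume (ball (0 : N → ℝ) 1 ×ˢ ball (0 : F) 1) < ∞ := by
  rw [Measure.volume_eq_prod, Measure.prod_prod]
  exact ENNReal.mul_lt_top measure_ball_lt_top measure_ball_lt_top

lemma lintegral_slabKernel_chart_le {F : Submodule ℝ (Euc d)} (c : ChartData N F) (v : V) {ε : ℝ}
    (hε : 0 < ε) {h : (V → Euc d) → ℝ≥0∞} {M : ℝ≥0∞} {x : V → Euc d} (hM : ∀ y, h y ≤ M)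
    (hx : c.jac x ≠ 0) :
    ∫⁻ q, slabKernel N v ε h x (c.chart ε x q) ≤
      M * (2 ^ N.card * volume (ball (0 : F) 1)) := by
  refine (lintegral_mono (slabKernel_chart_le c v hε hM hx)).trans ?_
  rw [lintegral_indicator_const (measurableSet_ball.prod measurableSet_ball),
    Measure.volume_eq_prod, Measure.prod_prod, Real.volume_pi_ball _ one_pos]
  simp

end OneStep

/-! ### The limit of one slab average -/

section OneStepLimit

variable {V : Type*} [Fintype V] {d : ℕ} {N : Finset V}

/-- The pointwise limit of `slabKernel` in the chart. -/
noncomputable def limitKernel {F : Submodule ℝ (Euc d)} (N : Finset V) (v : V)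
    (h : (V → Euc d) → ℝ≥0∞) (x : V → Euc d) (q : (N → ℝ) × F) : ℝ≥0∞ :=
  {q : (N → ℝ) × F | ‖q.2‖ < 1 ∧ ∀ u, |q.1 u| < ‖q.2‖}.indicator
    (fun q => h (Function.update x v (normalize (q.2 : Euc d)))) q

/-- The exceptional set contains the boundary of the region defining `limitKernel`, where pointwise
convergence may fail; it is null because spheres are null. -/
lemma ae_chart_regular {F : Submodule ℝ (Euc d)} (hF : F ≠ ⊥) :
    ∀ᵐ q : (N → ℝ) × F, q.2 ≠ 0 ∧ ‖q.2‖ ≠ 1 ∧ ∀ u, |q.1 u| ≠ ‖q.2‖ := by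
  have : Nontrivial F := Submodule.nontrivial_iff_ne_bot.2 hF
  have h1 : ∀ᵐ a : F, a ≠ 0 ∧ ‖a‖ ≠ 1 := by
    rw [eventually_and]
    refine ⟨?_, ?_⟩
    · exact compl_mem_ae_iff.2 (measure_singleton 0)
    · have := Measure.addHaar_sphere (volume : Measure F) 0 1
      refine measure_mono_null (fun a ha => ?_) this
      simpa using ha
  have h2 : ∀ u : N, ∀ᵐ q : (N → ℝ) × F, |q.1 u| ≠ ‖q.2‖ := by
    intro u
    have hm : MeasurableSet {q : (N → ℝ) × F | |q.1 u| = ‖q.2‖} :=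
      (isClosed_eq (((continuous_apply u).comp continuous_fst).abs) continuous_snd.norm).measurableSet
    have : volume {q : (N → ℝ) × F | |q.1 u| = ‖q.2‖} = 0 := by
      rw [Measure.volume_eq_prod, Measure.measure_prod_null hm]
      refine Eventually.of_forall fun w => ?_
      have := Measure.addHaar_sphere (volume : Measure F) 0 |w u|
      refine measure_mono_null (fun a ha => ?_) this
      simpa using (show |w u| = ‖a‖ from ha).symm
    refine measure_mono_null (fun q hq => ?_) this
    simpa using hq
  have h3 := (Measure.quasiMeasurePreserving_snd (μ := (volume : Measure (N → ℝ)))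
    (ν := (volume : Measure F))).ae h1
  filter_upwards [h3, ae_all_iff.2 h2] with q hq1 hq2
  exact ⟨hq1.1, hq1.2, hq2⟩

/-- The chart point tends to `q.2`, and in the chart the slab condition is `|q.1 u| < ‖chart‖` with
`ε` gone. Strict inequalities at the limit persist nearby, so the kernel is eventually either `0` or
a value of `h` at a convergent argument. -/
lemma tendsto_slabKernel {F : Submodule ℝ (Euc d)} (c : ChartData N F) (v : V)
    {h : ℝ → (V → Euc d) → ℝ≥0∞} {h₀ : (V → Euc d) → ℝ≥0∞}
    (hlim : ∀ x, Tendsto (fun q : ℝ × (V → Euc d) => h q.1 q.2) (𝓝[>] 0 ×ˢ 𝓝 x) (𝓝 (h₀ x)))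
    {x : V → Euc d} (hF : F = perp N x) (hx : c.jac x ≠ 0) {q : (N → ℝ) × F}
    (hq0 : q.2 ≠ 0) (hq1 : ‖q.2‖ ≠ 1) (hq2 : ∀ u, |q.1 u| ≠ ‖q.2‖) :
    Tendsto (fun p : ℝ × (V → Euc d) => slabKernel N v p.1 (h p.1) p.2 (c.chart p.1 p.2 q))
      (𝓝[>] 0 ×ˢ 𝓝 x) (𝓝 (limitKernel N v h₀ x q)) := by
  set l : Filter (ℝ × (V → Euc d)) := 𝓝[>] 0 ×ˢ 𝓝 x with hl
  have hle : l ≤ 𝓝 ((0 : ℝ), x) := by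
    rw [nhds_prod_eq]
    exact Filter.prod_mono nhdsWithin_le_nhds le_rfl
  have hsnd : Tendsto Prod.snd l (𝓝 x) := tendsto_snd
  have hpos : ∀ᶠ p in l, 0 < p.1 :=
    tendsto_fst.eventually (eventually_mem_nhdsWithin (α := ℝ) (a := 0) (s := Ioi 0))
  have hjac : ∀ᶠ p in l, c.jac p.2 ≠ 0 :=
    hsnd.eventually (c.continuous_jac.continuousAt.eventually_ne hx)
  have hchart : Tendsto (fun p : ℝ × (V → Euc d) => c.chart p.1 p.2 q) l (𝓝 (q.2 : Euc d)) := by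
    have h1 := continuousAt_frameInv c.reindex (c.det_ne_zero hx)
      (Sum.elim ((0 : ℝ) • q.1) fun j => c.basis.repr q.2 j)
    have h2 : Continuous fun p : ℝ × (V → Euc d) => (c.frame p.2,
        (Sum.elim (p.1 • q.1) fun j => c.basis.repr q.2 j : N ⊕ Fin (d - N.card) → ℝ)) := by
      refine (c.continuous_frame.comp continuous_snd).prodMk (continuous_pi fun i => ?_)
      rcases i with u | j
      · simp only [Sum.elim_inl, Pi.smul_apply, smul_eq_mul]
        fun_prop
      · exact continuous_const
    have h3 := h1.tendsto.comp ((h2.tendsto ((0 : ℝ), x)).mono_left hle)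
    have h4 := c.chart_zero hx hF q
    rw [ChartData.chart] at h4
    rw [h4] at h3
    exact h3
  have hq0' : (q.2 : Euc d) ≠ 0 := by simpa using hq0
  have hnorm : Tendsto (fun p : ℝ × (V → Euc d) => ‖c.chart p.1 p.2 q‖) l (𝓝 ‖q.2‖) :=
    hchart.norm
  have hne : ∀ᶠ p in l, c.chart p.1 p.2 q ≠ 0 := hchart.eventually_ne hq0'
  have hslab : ∀ᶠ p in l, (normalize (c.chart p.1 p.2 q) ∈ slab N p.2 p.1 ↔
      ∀ u, |q.1 u| < ‖c.chart p.1 p.2 q‖) := by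
    filter_upwards [hpos, hjac, hne] with p hp hj hn
    have hn' := norm_pos_iff.2 hn
    simp only [slab, mem_ofPred_eq, Subtype.forall]
    refine forall₂_congr fun u hu => ?_
    rw [normalize, inner_smul_right, c.inner_chart_left hj p.1 q ⟨u, hu⟩, abs_mul, abs_mul,
      abs_of_pos hp, abs_inv, abs_norm, inv_mul_lt_iff₀ hn', mul_comm p.1,
      mul_lt_mul_iff_left₀ hp]
  unfold limitKernel slabKernel
  by_cases hb : ‖q.2‖ < 1
  swap
  · have hb' : 1 < ‖q.2‖ := lt_of_le_of_ne (not_lt.1 hb) (Ne.symm hq1)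
    rw [indicator_of_notMem (fun hh => hb hh.1)]
    refine tendsto_const_nhds.congr' ?_
    filter_upwards [hnorm.eventually_const_lt hb'] with p hp
    rw [indicator_of_notMem]
    simpa using hp.le
  have hball : ∀ᶠ p in l, c.chart p.1 p.2 q ∈ ball (0 : Euc d) 1 := by
    filter_upwards [hnorm.eventually_lt_const hb] with p hp
    simpa using hp
  by_cases hs : ∀ u, |q.1 u| < ‖q.2‖
  · rw [indicator_of_mem (show q ∈ {q : (N → ℝ) × F | ‖q.2‖ < 1 ∧ ∀ u, |q.1 u| < ‖q.2‖}
      from ⟨hb, hs⟩)]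
    have h1 : Tendsto (fun p : ℝ × (V → Euc d) =>
        (p.1, Function.update p.2 v (normalize (c.chart p.1 p.2 q)))) l
        (𝓝[>] 0 ×ˢ 𝓝 (Function.update x v (normalize (q.2 : Euc d)))) := by
      refine tendsto_fst.prodMk ?_
      exact hsnd.update v ((continuousAt_normalize hq0').tendsto.comp hchart)
    refine ((hlim _).comp h1).congr' ?_
    have h2 : ∀ᶠ p in l, ∀ u, |q.1 u| < ‖c.chart p.1 p.2 q‖ :=
      eventually_all.2 fun u => hnorm.eventually_const_lt (hs u)
    filter_upwards [hball, hslab, h2] with p hp1 hp2 hp3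
    rw [indicator_of_mem hp1, indicator_of_mem (hp2.2 hp3)]
    rfl
  · rw [indicator_of_notMem (fun hh => hs hh.2)]
    push Not at hs
    obtain ⟨u, hu⟩ := hs
    have hu' : ‖q.2‖ < |q.1 u| := lt_of_le_of_ne hu (hq2 u).symm
    refine tendsto_const_nhds.congr' ?_
    filter_upwards [hball, hslab, hnorm.eventually_lt_const hu'] with p hp1 hp2 hp3
    rw [indicator_of_mem hp1, indicator_of_notMem]
    rw [hp2]
    push Not
    exact ⟨u, hp3.le⟩

lemma coe_normalize {F : Submodule ℝ (Euc d)} (a : F) :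
    ((normalize a : F) : Euc d) = normalize (a : Euc d) := rfl

/-- For fixed `a`, the admissible `w` form a cube of volume `(2‖a‖)^|N|`; polar coordinates then
trade the power of the norm for a ratio of dimensions. -/
lemma lintegral_limitKernel {F : Submodule ℝ (Euc d)} (hF : F ≠ ⊥) (v : V)
    {h : (V → Euc d) → ℝ≥0∞} (hh : Measurable h) (x : V → Euc d) :
    ((finrank ℝ F + N.card : ℕ) : ℝ≥0∞) * ∫⁻ q : (N → ℝ) × F, limitKernel N v h x q =
      2 ^ N.card * ((finrank ℝ F : ℝ≥0∞) *
        ∫⁻ a : F in ball 0 1, h (Function.update x v (normalize (a : Euc d)))) := by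
  have : Nontrivial F := Submodule.nontrivial_iff_ne_bot.2 hF
  have hφ : Measurable fun b : F => h (Function.update x v (b : Euc d)) :=
    hh.comp ((measurable_update x).comp measurable_subtype_coe)
  have hφn : Measurable fun b : F => h (Function.update x v (normalize (b : Euc d))) :=
    hh.comp ((measurable_update x).comp (measurable_normalize.comp measurable_subtype_coe))
  have hm : MeasurableSet {q : (N → ℝ) × F | ‖q.2‖ < 1 ∧ ∀ u, |q.1 u| < ‖q.2‖} := by
    have e : {q : (N → ℝ) × F | ‖q.2‖ < 1 ∧ ∀ u, |q.1 u| < ‖q.2‖} =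
        {q | ‖q.2‖ < 1} ∩ ⋂ u, {q | |q.1 u| < ‖q.2‖} := by
      ext q
      simp
    rw [e]
    exact (isOpen_lt continuous_snd.norm continuous_const).measurableSet.inter
      (MeasurableSet.iInter fun u => (isOpen_lt
        (((continuous_apply u).comp continuous_fst).abs) continuous_snd.norm).measurableSet)
  have hk : Measurable fun q : (N → ℝ) × F => limitKernel N v h x q :=
    (hφn.comp measurable_snd).indicator hm
  have h1 : ∀ a : F, ∫⁻ w : N → ℝ, limitKernel N v h x (w, a) =
      (ball (0 : F) 1).indicator (fun a => 2 ^ N.card * (ENNReal.ofReal ‖a‖ ^ N.card *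
        h (Function.update x v (normalize (a : Euc d))))) a := by
    intro a
    by_cases ha : ‖a‖ < 1
    · rw [indicator_of_mem (by simpa using ha)]
      have h2 : ∀ w : N → ℝ, limitKernel N v h x (w, a) =
          (Set.pi univ fun _ : N => Ioo (-‖a‖) ‖a‖).indicator
            (fun _ => h (Function.update x v (normalize (a : Euc d)))) w := by
        intro w
        unfold limitKernel
        by_cases hw : ∀ u, |w u| < ‖a‖
        · rw [indicator_of_mem (by exact ⟨ha, hw⟩), indicator_of_mem]
          exact fun u _ => abs_lt.1 (hw u)
        · rw [indicator_of_notMem (fun hh => hw hh.2), indicator_of_notMem]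
          exact fun hh => hw fun u => abs_lt.2 (hh u trivial)
      simp_rw [h2]
      rw [lintegral_indicator_const (MeasurableSet.univ_pi fun _ => measurableSet_Ioo),
        volume_pi_pi]
      simp only [Real.volume_Ioo, sub_neg_eq_add, ← two_mul, Finset.prod_const, Finset.card_univ,
        Fintype.card_coe, ENNReal.ofReal_mul zero_le_two, ENNReal.ofReal_ofNat, mul_pow]
      ring
    · rw [indicator_of_notMem (by simpa using ha)]
      have h2 : ∀ w : N → ℝ, limitKernel N v h x (w, a) = 0 := fun w =>
        indicator_of_notMem (fun hh => ha hh.1) _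
      simp [h2]
  rw [Measure.volume_eq_prod, lintegral_prod_symm _ hk.aemeasurable]
  simp_rw [h1]
  have h4 := lintegral_ball_norm_pow_mul N.card hφ
  simp only [coe_normalize] at h4
  rw [lintegral_indicator measurableSet_ball, lintegral_const_mul, mul_left_comm, h4]
  exact (measurable_norm.ennreal_ofReal.pow_const _).mul hφn

/-- Surface areas are dimension times ball volume: `A_{d-1} = d B` and `A_{d-n-1} = (d-n) β`, with
`n = |N|` and `B`, `β` the unit ball volumes of the ambient space and of `perp N x`. Together with
`2 / slabRate d = A_{d-1} / A_{d-2}` this yields `s_{d,n}`. -/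
lemma weight_const_identity (hN : N.card < d) {x : V → Euc d}
    (hx : LinearIndependent ℝ fun i : N => x i) :
    (ENNReal.ofReal (slabRate d))⁻¹ ^ N.card * (volume (ball (0 : Euc d) 1))⁻¹ *
        (ENNReal.ofReal (gramDet N x))⁻¹ *
        (2 ^ N.card * ((d - N.card : ℕ) * volume (ball (0 : perp N x) 1))) = d * weight N x := by
  obtain ⟨k, hk⟩ : ∃ k, d = N.card + k + 1 := ⟨d - N.card - 1, by omega⟩
  have hg := gramDet_pos_iff.2 hx
  have hF : finrank ℝ (perp N x) = k + 1 := by rw [finrank_perp hx]; omega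
  have hE : finrank ℝ (Euc d) = (d - 1) + 1 := by rw [finrank_euclideanSpace_fin]; omega
  have a1 := sphereArea_eq_of_finrank hF
  have a2 := sphereArea_eq_of_finrank hE
  have a3 := sphereArea_pos (d - 2)
  have a4 := sphereArea_pos (d - 1)
  have a5 := sphereArea_pos k
  have b1 : 0 < (volume (ball (0 : perp N x) 1)).toReal :=
    ENNReal.toReal_pos volume_ball_ne_zero volume_ball_ne_top
  have b2 : 0 < (volume (ball (0 : Euc d) 1)).toReal :=
    ENNReal.toReal_pos volume_ball_ne_zero volume_ball_ne_top
  rw [← ENNReal.ofReal_toReal (volume_ball_ne_top (F := perp N x)),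
    ← ENNReal.ofReal_toReal (volume_ball_ne_top (F := Euc d))]
  set β := (volume (ball (0 : perp N x) 1)).toReal
  set B := (volume (ball (0 : Euc d) 1)).toReal
  have e1 : d - N.card - 1 = k := by omega
  have e2 : d - N.card = k + 1 := by omega
  have e3 : d - 1 + 1 = d := by omega
  rw [e3] at a2
  have hd0 : (0 : ℝ) < d := by exact_mod_cast (by omega : 0 < d)
  have hκ := slabRate_pos d
  rw [weight, ← ENNReal.ofReal_inv_of_pos hκ, ← ENNReal.ofReal_inv_of_pos b2,
    ← ENNReal.ofReal_inv_of_pos hg, ← ENNReal.ofReal_pow (by positivity),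
    ← ENNReal.ofReal_natCast, ← ENNReal.ofReal_natCast d,
    show (2 : ℝ≥0∞) = ENNReal.ofReal 2 by simp, ← ENNReal.ofReal_pow zero_le_two,
    ← ENNReal.ofReal_mul (by positivity), ← ENNReal.ofReal_mul (by positivity),
    ← ENNReal.ofReal_mul (by positivity), ← ENNReal.ofReal_mul (by positivity),
    ← ENNReal.ofReal_mul (by positivity), ← ENNReal.ofReal_mul (by positivity)]
  congr 1
  rw [sDensity, e1, e2, zpow_sub_one₀ a4.ne', zpow_natCast, slabRate]
  have hd' : sphereArea (d - 1) = d * B := a2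
  have hk' : sphereArea k = ((k + 1 : ℕ) : ℝ) * β := a1
  rw [hk', inv_pow, div_pow, mul_pow]
  field_simp
  rw [hd']
  field_simp

/-- The kernel is supported in cube times ball, whose volume gives `d * weight N x` up to the factor
`d - |N| ≥ 1`, which is dropped. -/
lemma slabAvg_le {v : V} {ε : ℝ} (hε : 0 < ε) (hN : N.card < d) {h : (V → Euc d) → ℝ≥0∞}
    (hh : Measurable h) {M : ℝ≥0∞} (hM : ∀ y, h y ≤ M) {x : V → Euc d}
    (hx : LinearIndependent ℝ fun i : N => x i) :
    slabAvg N v ε h x ≤ M * (d * weight N x) := by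
  obtain ⟨c⟩ := exists_chartData hN hx
  have hj := c.jac_eq_gramDet rfl
  have hg := gramDet_pos_iff.2 hx
  have hj0 : c.jac x ≠ 0 := by rw [hj]; exact hg.ne'
  rw [slabAvg_eq_chart c v hε hh hj0, ← weight_const_identity hN hx, hj]
  refine (mul_le_mul_right (lintegral_slabKernel_chart_le c v hε hM hj0) _).trans ?_
  rw [mul_left_comm]
  gcongr
  refine le_mul_of_one_le_left zero_le ?_
  exact_mod_cast (by omega : 1 ≤ d - N.card)

theorem tendsto_slabAvg {v : V} (hN : N.card < d)
    {h : ℝ → (V → Euc d) → ℝ≥0∞} {h₀ : (V → Euc d) → ℝ≥0∞} (hm : ∀ ε, Measurable (h ε))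
    (hm₀ : Measurable h₀) {M : ℝ≥0∞} (hMt : M ≠ ∞) (hM : ∀ ε, 0 < ε → ∀ x, h ε x ≤ M)
    (hlim : ∀ x, Tendsto (fun q : ℝ × (V → Euc d) => h q.1 q.2) (𝓝[>] 0 ×ˢ 𝓝 x) (𝓝 (h₀ x)))
    {x : V → Euc d} (hx : LinearIndependent ℝ fun i : N => x i) :
    Tendsto (fun q : ℝ × (V → Euc d) => slabAvg N v q.1 (h q.1) q.2) (𝓝[>] 0 ×ˢ 𝓝 x)
      (𝓝 (weight N x * perpAvg N v h₀ x)) := by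
  obtain ⟨c⟩ := exists_chartData hN hx
  have hj := c.jac_eq_gramDet rfl
  have hg := gramDet_pos_iff.2 hx
  have hj0 : c.jac x ≠ 0 := by rw [hj]; exact hg.ne'
  have hF := perp_ne_bot hN x
  set l : Filter (ℝ × (V → Euc d)) := 𝓝[>] 0 ×ˢ 𝓝 x with hl
  have hpos : ∀ᶠ p in l, 0 < p.1 :=
    tendsto_fst.eventually (eventually_mem_nhdsWithin (α := ℝ) (a := 0) (s := Ioi 0))
  have hjac : ∀ᶠ p in l, c.jac p.2 ≠ 0 :=
    (tendsto_snd : Tendsto Prod.snd l (𝓝 x)).eventually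
      (c.continuous_jac.continuousAt.eventually_ne hj0)
  have hint : Tendsto (fun p : ℝ × (V → Euc d) =>
      ∫⁻ q, slabKernel N v p.1 (h p.1) p.2 (c.chart p.1 p.2 q)) l
      (𝓝 (∫⁻ q : (N → ℝ) × perp N x, limitKernel N v h₀ x q)) := by
    refine tendsto_lintegral_filter_of_dominated_convergence
      ((ball (0 : N → ℝ) 1 ×ˢ ball (0 : perp N x) 1).indicator fun _ => M) ?_ ?_ ?_ ?_
    · refine Eventually.of_forall fun p => ?_
      refine (measurable_slabKernel v p.1 (hm p.1) p.2).comp ?_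
      have : Continuous fun w => frameInv c.reindex (c.frame p.2) w := by
        unfold frameInv Matrix.mulVec dotProduct
        fun_prop
      refine this.measurable.comp ?_
      exact c.measurePreserving_coords.measurable.comp
        ((measurable_fst.const_smul p.1).prodMk measurable_snd)
    · filter_upwards [hpos, hjac] with p hp hpj
      exact Eventually.of_forall fun q => slabKernel_chart_le c v hp (hM p.1 hp) hpj q
    · rw [lintegral_indicator_const (measurableSet_ball.prod measurableSet_ball)]
      exact ENNReal.mul_ne_top hMt volume_cube_prod_ball_lt_top.ne
    · filter_upwards [ae_chart_regular (N := N) hF] with q hq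
      exact tendsto_slabKernel c v hlim rfl hj0 hq.1 hq.2.1 hq.2.2
  -- Finiteness excludes the product `0 * ∞`, where multiplication of extended reals is not
  -- continuous.
  have hlimfin : ∫⁻ q : (N → ℝ) × perp N x, limitKernel N v h₀ x q ≠ ∞ := by
    refine ne_top_of_le_ne_top (ENNReal.mul_ne_top hMt (ENNReal.mul_ne_top
      (ENNReal.pow_ne_top (a := 2) (n := N.card) (by simp))
      (volume_ball_ne_top (F := perp N x)))) (le_of_tendsto hint ?_)
    filter_upwards [hpos, hjac] with p hp hpj
    exact lintegral_slabKernel_chart_le c v hp (hM p.1 hp) hpj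
  have hjlim : Tendsto (fun p : ℝ × (V → Euc d) => (ENNReal.ofReal (c.jac p.2))⁻¹) l
      (𝓝 (ENNReal.ofReal (c.jac x))⁻¹) :=
    (ENNReal.tendsto_ofReal ((c.continuous_jac.tendsto x).comp tendsto_snd)).inv
  have hd0 : (d : ℝ≥0∞) ≠ 0 := by exact_mod_cast (by omega : d ≠ 0)
  have hconst : (ENNReal.ofReal (slabRate d))⁻¹ ^ N.card *
      (volume (ball (0 : Euc d) 1))⁻¹ ≠ ∞ := by
    refine ENNReal.mul_ne_top (ENNReal.pow_ne_top ?_) ?_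
    · simpa using slabRate_pos d
    · exact ENNReal.inv_ne_top.2 volume_ball_ne_zero
  have hjfin : (ENNReal.ofReal (c.jac x))⁻¹ ≠ ∞ := by
    rw [hj]
    simpa using hg
  have hfinal : (ENNReal.ofReal (slabRate d))⁻¹ ^ N.card * (volume (ball (0 : Euc d) 1))⁻¹ *
      (ENNReal.ofReal (c.jac x))⁻¹ * ∫⁻ q : (N → ℝ) × perp N x, limitKernel N v h₀ x q =
      weight N x * perpAvg N v h₀ x := by
    -- Multiplication by `d = (d - |N|) + |N|` brings in the dimension factor of
    -- `lintegral_limitKernel`.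
    rw [← ENNReal.mul_right_inj hd0 (ENNReal.natCast_ne_top d), ← mul_assoc (d : ℝ≥0∞) (weight N x),
      ← weight_const_identity hN hx, perpAvg_ball hN v hm₀, hj]
    have h1 := lintegral_limitKernel (N := N) hF v hm₀ x
    rw [finrank_perp hx, Nat.sub_add_cancel hN.le] at h1
    rw [mul_left_comm, h1]
    set J := ∫⁻ a : perp N x in ball 0 1, h₀ (Function.update x v (normalize (a : Euc d)))
    set β := volume (ball (0 : perp N x) 1)
    have hβ : β * β⁻¹ = 1 := ENNReal.mul_inv_cancel volume_ball_ne_zero volume_ball_ne_top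
    calc _ = (ENNReal.ofReal (slabRate d))⁻¹ ^ N.card * (volume (ball (0 : Euc d) 1))⁻¹ *
        (ENNReal.ofReal (gramDet N x))⁻¹ * (2 ^ N.card * ((d - N.card : ℕ) * J)) * (β * β⁻¹) := by
          rw [hβ, mul_one]
      _ = _ := by ring
  rw [← hfinal]
  have hmain : Tendsto (fun p : ℝ × (V → Euc d) =>
      (ENNReal.ofReal (slabRate d))⁻¹ ^ N.card * (volume (ball (0 : Euc d) 1))⁻¹ *
      (ENNReal.ofReal (c.jac p.2))⁻¹ *
        ∫⁻ q, slabKernel N v p.1 (h p.1) p.2 (c.chart p.1 p.2 q)) l (𝓝 _) :=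
    ENNReal.Tendsto.mul (ENNReal.Tendsto.const_mul hjlim (Or.inr hconst)) (Or.inr hlimfin) hint
      (Or.inr (ENNReal.mul_ne_top hconst hjfin))
  refine hmain.congr' ?_
  filter_upwards [hpos, hjac] with p hp hpj
  exact (slabAvg_eq_chart c v hp (hm p.1) hpj).symm

end OneStepLimit

/-! ### Iterated averages and independence of the order -/

section Iter

variable {V : Type*} [Fintype V] {d : ℕ} (G : SimpleGraph V)

/-- The neighbors of `v` in `S`. -/
noncomputable def nbrsIn (S : Finset V) (v : V) : Finset V := S.filter fun u => G.Adj u v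

/-- Expectation of `g`, weighted by the density factors, when the nodes of the list are placed one
by one, the nodes of `S` having been placed before. -/
noncomputable def iter : Finset V → List V → ((V → Euc d) → ℝ≥0∞) → (V → Euc d) → ℝ≥0∞
  | _, [], g => g
  | S, v :: l, g => fun x =>
      weight (nbrsIn G S v) x * perpAvg (nbrsIn G S v) v (iter (insert v S) l g) x

/-- The `ε`-approximation of `iter`. -/
noncomputable def slabIter (ε : ℝ) :
    Finset V → List V → ((V → Euc d) → ℝ≥0∞) → (V → Euc d) → ℝ≥0∞
  | _, [], g => g
  | S, v :: l, g => slabAvg (nbrsIn G S v) v ε (slabIter ε (insert v S) l g)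

variable {G}

lemma nbrsIn_subset (S : Finset V) (v : V) : nbrsIn G S v ⊆ S := Finset.filter_subset _ _

lemma mem_nbrsIn {S : Finset V} {u v : V} : u ∈ nbrsIn G S v ↔ u ∈ S ∧ G.Adj u v := by
  simp [nbrsIn]

lemma notMem_nbrsIn_self (S : Finset V) (v : V) : v ∉ nbrsIn G S v := by
  simp [nbrsIn]

lemma measurable_iter (hdeg : ∀ S v, (nbrsIn G S v).card < d) (S : Finset V) (l : List V)
    {g : (V → Euc d) → ℝ≥0∞} (hg : Measurable g) : Measurable (iter G S l g) := by
  induction l generalizing S with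
  | nil => exact hg
  | cons v l ih => exact (measurable_weight _).mul (measurable_perpAvg (hdeg S v) v (ih _))

lemma measurable_slabIter (ε : ℝ) (S : Finset V) (l : List V)
    {g : (V → Euc d) → ℝ≥0∞} (hg : Measurable g) : Measurable (slabIter G ε S l g) := by
  induction l generalizing S with
  | nil => exact hg
  | cons v l ih => exact measurable_slabAvg _ v ε (ih _)

lemma iter_mono (S : Finset V) (l : List V) {g h : (V → Euc d) → ℝ≥0∞} (hgh : g ≤ h) :
    iter G S l g ≤ iter G S l h := by
  induction l generalizing S with
  | nil => exact hgh
  | cons v l ih =>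
    intro x
    simp only [iter, perpAvg]
    gcongr
    exact ih _ _

lemma iter_iSup (hdeg : ∀ S v, (nbrsIn G S v).card < d) (S : Finset V) (l : List V)
    {g : ℕ → (V → Euc d) → ℝ≥0∞} (hg : ∀ k, Measurable (g k)) (hmono : Monotone g)
    (x : V → Euc d) : iter G S l (fun x => ⨆ k, g k x) x = ⨆ k, iter G S l (g k) x := by
  induction l generalizing S x with
  | nil => rfl
  | cons v l ih =>
    simp only [iter, perpAvg]
    rw [← ENNReal.mul_iSup, ← lintegral_iSup]
    · simp_rw [ih]
    · exact fun k => (measurable_iter hdeg _ l (hg k)).comp (measurable_update x)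
    · exact fun i j hij y => iter_mono _ _ (hmono hij) _

lemma notMem_insert_of_nodup_cons {v : V} {S : Finset V} {l : List V} (hl : (v :: l).Nodup)
    (hS : ∀ w ∈ v :: l, w ∉ S) : ∀ w ∈ l, w ∉ insert v S := by
  intro w hw
  rw [Finset.mem_insert, not_or]
  exact ⟨fun e => (List.nodup_cons.1 hl).1 (e ▸ hw), hS w (by simp [hw])⟩

/-- A function that vanishes where some at most `d` of the vectors are close to being dependent. -/
def VanishesNearDegenerate (d : ℕ) (δ : ℝ) (S : Finset V) (g : (V → Euc d) → ℝ≥0∞) : Prop :=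
  ∀ T ⊆ S, T.card ≤ d → ∀ x, gramDet T x < δ → g x = 0

lemma gramDet_update {T : Finset V} {v : V} (hv : v ∉ T) (x : V → Euc d) (y : Euc d) :
    gramDet T (Function.update x v y) = gramDet T x :=
  gramDet_congr fun _ hu => Function.update_of_ne (fun h => hv (by rw [← h]; exact hu)) _ _

/-- Later choices do not move the vectors of `S`, so a near degeneracy inside `S` survives to the
end and kills the integrand. -/
lemma VanishesNearDegenerate.slabIter {δ : ℝ} {g : (V → Euc d) → ℝ≥0∞}
    (hg : VanishesNearDegenerate d δ Finset.univ g) (ε : ℝ) {S : Finset V} {l : List V}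
    (hl : l.Nodup) (hS : ∀ v ∈ l, v ∉ S) :
    VanishesNearDegenerate d δ S (slabIter G ε S l g) := by
  induction l generalizing S with
  | nil => exact fun T _ hT x hx => hg T (Finset.subset_univ _) hT x hx
  | cons v l ih =>
    intro T hTS hT x hx
    have hv : v ∉ S := hS v (by simp)
    have h := ih (S := insert v S) hl.of_cons (notMem_insert_of_nodup_cons hl hS)
    have h2 : ∀ y, OrthoHom.slabIter G ε (insert v S) l g (Function.update x v y) = 0 := by
      intro y
      refine h T (hTS.trans (Finset.subset_insert _ _)) hT _ ?_
      rwa [gramDet_update (fun h => hv (hTS h))]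
    simp [OrthoHom.slabIter, slabAvg, h2]

lemma VanishesNearDegenerate.iter {δ : ℝ} {g : (V → Euc d) → ℝ≥0∞}
    (hg : VanishesNearDegenerate d δ Finset.univ g) {S : Finset V} {l : List V}
    (hl : l.Nodup) (hS : ∀ v ∈ l, v ∉ S) :
    VanishesNearDegenerate d δ S (iter G S l g) := by
  induction l generalizing S with
  | nil => exact fun T _ hT x hx => hg T (Finset.subset_univ _) hT x hx
  | cons v l ih =>
    intro T hTS hT x hx
    have hv : v ∉ S := hS v (by simp)
    have h := ih (S := insert v S) hl.of_cons (notMem_insert_of_nodup_cons hl hS)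
    have h2 : ∀ y, OrthoHom.iter G (insert v S) l g (Function.update x v y) = 0 := by
      intro y
      refine h T (hTS.trans (Finset.subset_insert _ _)) hT _ ?_
      rwa [gramDet_update (fun h => hv (hTS h))]
    simp [OrthoHom.iter, perpAvg, h2]

lemma exists_weight_le (N : Finset V) {δ : ℝ} (hδ : 0 < δ) :
    ∃ W : ℝ≥0∞, W ≠ ∞ ∧ ∀ x : V → Euc d, δ ≤ gramDet N x → weight N x ≤ W := by
  refine ⟨ENNReal.ofReal (sphereArea (d - 1) ^ ((N.card : ℤ) - 1) * sphereArea (d - N.card - 1) /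
    sphereArea (d - 2) ^ N.card * (1 / δ)), ENNReal.ofReal_ne_top, fun x hx => ?_⟩
  have h1 := (sphereArea_pos (d - 1)).le
  have h2 := (sphereArea_pos (d - 2)).le
  have h3 := (sphereArea_pos (d - N.card - 1)).le
  unfold weight sDensity
  gcongr

/-- The weights blow up only near degenerate configurations, and there the function is already zero.
This supplies the constant `M` of `tendsto_slabAvg` at the next step. -/
lemma exists_slabIter_le (hdeg : ∀ S v, (nbrsIn G S v).card < d) {δ : ℝ} (hδ : 0 < δ)
    {g : (V → Euc d) → ℝ≥0∞} (hgm : Measurable g)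
    (hg : VanishesNearDegenerate d δ Finset.univ g) (hg1 : ∀ x, g x ≤ 1) {S : Finset V}
    {l : List V} (hl : l.Nodup) (hS : ∀ v ∈ l, v ∉ S) :
    ∃ M : ℝ≥0∞, M ≠ ∞ ∧ ∀ ε, 0 < ε → ∀ x, slabIter G ε S l g x ≤ M := by
  induction l generalizing S with
  | nil => exact ⟨1, ENNReal.one_ne_top, fun ε _ x => hg1 x⟩
  | cons v l ih =>
    have hS' := notMem_insert_of_nodup_cons hl hS
    obtain ⟨M, hMt, hM⟩ := ih hl.of_cons hS'
    obtain ⟨W, hWt, hW⟩ := exists_weight_le (d := d) (nbrsIn G S v) hδ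
    refine ⟨M * (d * W), ENNReal.mul_ne_top hMt
      (ENNReal.mul_ne_top (ENNReal.natCast_ne_top d) hWt), fun ε hε x => ?_⟩
    by_cases hx : gramDet (nbrsIn G S v) x < δ
    · rw [hg.slabIter ε hl hS _ (nbrsIn_subset S v) (hdeg S v).le x hx]
      exact zero_le
    · push Not at hx
      refine (slabAvg_le hε (hdeg S v) (measurable_slabIter ε _ l hgm) (hM ε hε)
        (gramDet_pos_iff.1 (hδ.trans_le hx))).trans ?_
      gcongr
      exact hW x hx

/-- The inner function itself changes with `ε` and is evaluated at moving points, so the induction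
needs convergence jointly in `(ε, x)`. Where the placed neighbors are nearly dependent, both sides
vanish on a neighborhood; elsewhere `tendsto_slabAvg` applies. -/
theorem tendsto_slabIter (hdeg : ∀ S v, (nbrsIn G S v).card < d) {δ : ℝ} (hδ : 0 < δ)
    {g : (V → Euc d) → ℝ≥0∞} (hgc : Continuous g)
    (hg : VanishesNearDegenerate d δ Finset.univ g) (hg1 : ∀ x, g x ≤ 1) {S : Finset V}
    {l : List V} (hl : l.Nodup) (hS : ∀ v ∈ l, v ∉ S) (x : V → Euc d) :
    Tendsto (fun q : ℝ × (V → Euc d) => slabIter G q.1 S l g q.2) (𝓝[>] 0 ×ˢ 𝓝 x)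
      (𝓝 (iter G S l g x)) := by
  induction l generalizing S x with
  | nil => exact (hgc.tendsto x).comp tendsto_snd
  | cons v l ih =>
    have hS' := notMem_insert_of_nodup_cons hl hS
    by_cases hx : gramDet (nbrsIn G S v) x < δ
    · rw [hg.iter hl hS _ (nbrsIn_subset S v) (hdeg S v).le x hx]
      refine tendsto_const_nhds.congr' ?_
      have h1 : ∀ᶠ y in 𝓝 x, gramDet (nbrsIn G S v) y < δ :=
        (continuous_gramDet _).continuousAt.eventually_lt_const hx
      filter_upwards [tendsto_snd.eventually h1] with q hq
      exact (hg.slabIter q.1 hl hS _ (nbrsIn_subset S v) (hdeg S v).le q.2 hq).symm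
    · push Not at hx
      obtain ⟨M, hMt, hM⟩ := exists_slabIter_le hdeg hδ hgc.measurable hg hg1 hl.of_cons hS'
      exact tendsto_slabAvg (hdeg S v) (fun ε => measurable_slabIter ε _ l hgc.measurable)
        (measurable_iter hdeg _ l hgc.measurable) hMt hM (ih hl.of_cons hS')
        (gramDet_pos_iff.1 (hδ.trans_le hx))

variable (G) in
/-- The maps taking adjacent nodes of `S` to almost orthogonal vectors. -/
def almostOrtho (S : Finset V) (ε : ℝ) : Set (V → Euc d) :=
  {x | ∀ u ∈ S, ∀ w ∈ S, G.Adj u w → |inner ℝ (x u) (x w)| < ε}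

lemma measurableSet_almostOrtho (S : Finset V) (ε : ℝ) :
    MeasurableSet (almostOrtho (d := d) G S ε) := by
  have : almostOrtho (d := d) G S ε =
      ⋂ u ∈ S, ⋂ w ∈ S, {x | G.Adj u w → |inner ℝ (x u) (x w)| < ε} := by
    ext x
    simp [almostOrtho]
  rw [this]
  refine Finset.measurableSet_biInter _ fun u _ => Finset.measurableSet_biInter _ fun w _ => ?_
  by_cases h : G.Adj u w
  · simp only [h, forall_const]
    have hc : Continuous fun x : V → Euc d => |inner ℝ (x u) (x w)| :=
      ((continuous_apply u).inner (continuous_apply w)).abs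
    exact (isOpen_lt hc continuous_const).measurableSet
  · simp [h]

lemma update_mem_almostOrtho {S : Finset V} {v : V} (hv : v ∉ S) {ε : ℝ} {x : V → Euc d}
    {y : Euc d} : Function.update x v y ∈ almostOrtho G (insert v S) ε ↔
      x ∈ almostOrtho G S ε ∧ y ∈ slab (nbrsIn G S v) x ε := by
  have hne : ∀ u ∈ S, Function.update x v y u = x u := fun u hu =>
    Function.update_of_ne (fun h => hv (by rw [← h]; exact hu)) _ _
  constructor
  · intro h
    refine ⟨fun u hu w hw ha => ?_, fun u hu => ?_⟩
    · have := h u (Finset.mem_insert_of_mem hu) w (Finset.mem_insert_of_mem hw) ha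
      rwa [hne u hu, hne w hw] at this
    · rw [mem_nbrsIn] at hu
      have := h u (Finset.mem_insert_of_mem hu.1) v (Finset.mem_insert_self _ _) hu.2
      rwa [hne u hu.1, Function.update_self] at this
  · rintro ⟨h1, h2⟩ u hu w hw ha
    rcases Finset.mem_insert.1 hu with rfl | hu' <;> rcases Finset.mem_insert.1 hw with rfl | hw'
    · exact absurd ha (G.loopless.irrefl _)
    · rw [hne w hw', Function.update_self, real_inner_comm]
      exact h2 w (mem_nbrsIn.2 ⟨hw', ha.symm⟩)
    · rw [hne u hu', Function.update_self]
      exact h2 u (mem_nbrsIn.2 ⟨hu', ha⟩)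
    · rw [hne u hu', hne w hw']
      exact h1 u hu' w hw' ha

variable (G) in
/-- The number of edges closed while the nodes of the list are placed. -/
noncomputable def edgeCount : Finset V → List V → ℕ
  | _, [] => 0
  | S, v :: l => (nbrsIn G S v).card + edgeCount (insert v S) l

/-- `slabIter` checks only the edges closed by nodes of the list, so the indicator on the left
accounts for the edges inside `S`. -/
lemma indicator_mul_slabIter (ε : ℝ) {g : (V → Euc d) → ℝ≥0∞} (hg : Measurable g) {S : Finset V}
    {l : List V} (hl : l.Nodup) (hS : ∀ v ∈ l, v ∉ S) (hcov : ∀ v, v ∈ S ∨ v ∈ l)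
    (x : V → Euc d) :
    (almostOrtho G S ε).indicator 1 x * slabIter G ε S l g x =
      (ENNReal.ofReal (slabRate d * ε))⁻¹ ^ edgeCount G S l *
        (∫⋯∫⁻_l.toFinset, (almostOrtho G Finset.univ ε).indicator g ∂fun _ => sphereLaw d) x := by
  induction l generalizing S x with
  | nil =>
    have : S = Finset.univ := by
      ext v
      simpa using hcov v
    subst this
    simp only [slabIter, edgeCount, pow_zero, one_mul, List.toFinset_nil, lmarginal_empty]
    by_cases hx : x ∈ almostOrtho G Finset.univ ε
    · simp [hx]
    · simp [hx]
  | cons v l ih =>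
    have hS' := notMem_insert_of_nodup_cons hl hS
    have hv : v ∉ S := hS v (by simp)
    have hcov' : ∀ w, w ∈ insert v S ∨ w ∈ l := by
      intro w
      have := hcov w
      simp only [Finset.mem_insert, List.mem_cons] at this ⊢
      tauto
    have hgi : Measurable ((almostOrtho (d := d) G Finset.univ ε).indicator g) :=
      hg.indicator (measurableSet_almostOrtho _ ε)
    have hvl : v ∉ l.toFinset := by
      rw [List.mem_toFinset]
      exact (List.nodup_cons.1 hl).1
    rw [List.toFinset_cons, lmarginal_insert _ hgi hvl, edgeCount, pow_add, mul_assoc,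
      ← lintegral_const_mul (f := fun y => (∫⋯∫⁻_l.toFinset,
        (almostOrtho G Finset.univ ε).indicator g ∂fun _ => sphereLaw d)
        (Function.update x v y)) _ ((hgi.lmarginal _).comp (measurable_update x))]
    simp_rw [← ih hl.of_cons hS' hcov']
    rw [slabIter, slabAvg, mul_left_comm, ← lintegral_const_mul
      (f := (slab (nbrsIn G S v) x ε).indicator fun y =>
        slabIter G ε (insert v S) l g (Function.update x v y)) _
      (((measurable_slabIter ε _ l hg).comp (measurable_update x)).indicator
        (measurableSet_slab _ x ε))]
    congr 1
    refine lintegral_congr fun y => ?_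
    by_cases h1 : x ∈ almostOrtho G S ε <;> by_cases h2 : y ∈ slab (nbrsIn G S v) x ε
    · rw [indicator_of_mem h1, indicator_of_mem h2,
        indicator_of_mem ((update_mem_almostOrtho hv).2 ⟨h1, h2⟩)]
      rfl
    · rw [indicator_of_notMem h2, mul_zero,
        indicator_of_notMem fun h => h2 ((update_mem_almostOrtho hv).1 h).2, zero_mul]
    · rw [indicator_of_notMem h1, zero_mul,
        indicator_of_notMem fun h => h1 ((update_mem_almostOrtho hv).1 h).1, zero_mul]
    · rw [indicator_of_notMem h1, zero_mul,
        indicator_of_notMem fun h => h1 ((update_mem_almostOrtho hv).1 h).1, zero_mul]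

lemma sum_card_nbrsIn_insert {S : Finset V} {v : V} (hv : v ∉ S) :
    ∑ w ∈ insert v S, (nbrsIn G (insert v S) w).card =
      ∑ w ∈ S, (nbrsIn G S w).card + 2 * (nbrsIn G S v).card := by
  rw [Finset.sum_insert hv]
  have h1 : nbrsIn G (insert v S) v = nbrsIn G S v := by
    ext u
    simp only [mem_nbrsIn, Finset.mem_insert]
    constructor
    · rintro ⟨rfl | h, ha⟩
      · exact absurd ha (G.loopless.irrefl _)
      · exact ⟨h, ha⟩
    · exact fun h => ⟨Or.inr h.1, h.2⟩
  have h2 : ∀ w ∈ S, (nbrsIn G (insert v S) w).card =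
      (nbrsIn G S w).card + if G.Adj v w then 1 else 0 := by
    intro w _
    have hv' : v ∉ S.filter fun u => G.Adj u w := fun h => hv (Finset.mem_filter.1 h).1
    rw [nbrsIn, nbrsIn, Finset.filter_insert]
    split_ifs with h
    · rw [Finset.card_insert_of_notMem hv']
    · rfl
  rw [h1, Finset.sum_congr rfl h2, Finset.sum_add_distrib, ← Finset.card_filter]
  have h3 : (S.filter fun w => G.Adj v w) = nbrsIn G S v := by
    ext w
    simp [mem_nbrsIn, G.adj_comm]
  rw [h3]
  ring

/-- The sum is the degree sum of the graph induced on `S`: moving a node into `S` raises it by twice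
the number of edges closed. For empty `S`, `edgeCount` is the number of all edges. -/
lemma edgeCount_eq {S : Finset V} {l : List V} (hl : l.Nodup) (hS : ∀ v ∈ l, v ∉ S)
    (hcov : ∀ v, v ∈ S ∨ v ∈ l) :
    2 * edgeCount G S l + ∑ w ∈ S, (nbrsIn G S w).card = 2 * G.edgeSet.ncard := by
  induction l generalizing S with
  | nil =>
    have : S = Finset.univ := by
      ext v
      simpa using hcov v
    subst this
    have h1 := G.sum_degrees_eq_twice_card_edges
    rw [← G.coe_edgeFinset, Set.ncard_coe_finset, ← h1]
    simp only [edgeCount, mul_zero, zero_add]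
    refine Finset.sum_congr rfl fun w _ => ?_
    rw [← SimpleGraph.card_neighborFinset_eq_degree]
    congr 1
    ext u
    simp [mem_nbrsIn, G.adj_comm]
  | cons v l ih =>
    have hv : v ∉ S := hS v (by simp)
    have h := ih (S := insert v S) hl.of_cons (notMem_insert_of_nodup_cons hl hS) (by
      intro w
      have := hcov w
      simp only [Finset.mem_insert, List.mem_cons] at this ⊢
      tauto)
    rw [sum_card_nbrsIn_insert hv] at h
    rw [edgeCount]
    omega

/-- The density of `ε`-almost orthogonal maps, without normalization. -/
noncomputable def almostMass (G : SimpleGraph V) (ε : ℝ) (g : (V → Euc d) → ℝ≥0∞) : ℝ≥0∞ :=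
  ∫⁻ x, (almostOrtho G Finset.univ ε).indicator g x ∂Measure.pi fun _ => sphereLaw d

/-- The list is absent from the right-hand side; order independence of the limit rests on this. -/
lemma slabIter_empty (ε : ℝ) {g : (V → Euc d) → ℝ≥0∞} (hg : Measurable g)
    {l : List V} (hl : l.Nodup) (hcov : ∀ v, v ∈ l) (x : V → Euc d) :
    slabIter G ε ∅ l g x =
      (ENNReal.ofReal (slabRate d * ε))⁻¹ ^ G.edgeSet.ncard * almostMass G ε g := by
  have h := indicator_mul_slabIter (G := G) ε hg hl (S := ∅) (by simp) (fun v => Or.inr (hcov v)) x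
  have h1 := edgeCount_eq (G := G) hl (S := ∅) (by simp) (fun v => Or.inr (hcov v))
  have h2 : edgeCount G ∅ l = G.edgeSet.ncard := by simpa using h1
  have h3 : l.toFinset = Finset.univ := by
    ext v
    simpa using hcov v
  rw [h2, h3, lmarginal_univ] at h
  rw [almostMass, ← h, indicator_of_mem (by simp [almostOrtho])]
  simp

lemma iter_eq_of_vanishesNearDegenerate (hdeg : ∀ S v, (nbrsIn G S v).card < d) {δ : ℝ}
    (hδ : 0 < δ) {g : (V → Euc d) → ℝ≥0∞} (hgc : Continuous g)
    (hg : VanishesNearDegenerate d δ Finset.univ g) (hg1 : ∀ x, g x ≤ 1) {l l' : List V}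
    (hl : l.Nodup) (hcov : ∀ v, v ∈ l) (hl' : l'.Nodup) (hcov' : ∀ v, v ∈ l') (x : V → Euc d) :
    iter G ∅ l g x = iter G ∅ l' g x := by
  have h0 : Tendsto (fun ε : ℝ => (ε, x)) (𝓝[>] 0) (𝓝[>] 0 ×ˢ 𝓝 x) :=
    tendsto_id.prodMk tendsto_const_nhds
  have h1 := (tendsto_slabIter hdeg hδ hgc hg hg1 hl (S := ∅) (by simp) x).comp h0
  have h2 := (tendsto_slabIter hdeg hδ hgc hg hg1 hl' (S := ∅) (by simp) x).comp h0
  refine tendsto_nhds_unique h1 (h2.congr fun ε => ?_)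
  simp only [Function.comp_apply]
  rw [slabIter_empty ε hgc.measurable hl hcov, slabIter_empty ε hgc.measurable hl' hcov']

/-- The maps taking any at most `d` nodes to linearly independent vectors. -/
def independentMaps (V : Type*) [Fintype V] (d : ℕ) : Set (V → Euc d) :=
  {x | ∀ T : Finset V, T.card ≤ d → LinearIndependent ℝ fun i : T => x i}

/-- Continuous approximations of the indicator function of `independentMaps`. -/
noncomputable def cutoff (k : ℕ) (x : V → Euc d) : ℝ≥0∞ :=
  ENNReal.ofReal (∏ T : Finset V with T.card ≤ d, max 0 (min 1 ((k + 1) * gramDet T x - 1)))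

lemma continuous_cutoff (k : ℕ) : Continuous (cutoff k : (V → Euc d) → ℝ≥0∞) := by
  refine ENNReal.continuous_ofReal.comp (continuous_finsetProd _ fun T _ => ?_)
  exact continuous_const.max (continuous_const.min
    ((continuous_const.mul (continuous_gramDet T)).sub continuous_const))

lemma cutoff_le_one (k : ℕ) (x : V → Euc d) : cutoff k x ≤ 1 := by
  rw [cutoff, ← ENNReal.ofReal_one]
  refine ENNReal.ofReal_le_ofReal (Finset.prod_le_one (fun T _ => le_max_left _ _) fun T _ => ?_)
  exact max_le zero_le_one (min_le_left _ _)

lemma monotone_cutoff : Monotone (cutoff : ℕ → (V → Euc d) → ℝ≥0∞) := by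
  intro i j hij x
  refine ENNReal.ofReal_le_ofReal (Finset.prod_le_prod (fun T _ => le_max_left _ _) fun T _ => ?_)
  have := gramDet_nonneg T x
  gcongr

lemma vanishesNearDegenerate_cutoff (k : ℕ) :
    VanishesNearDegenerate d (1 / (k + 1)) Finset.univ (cutoff k : (V → Euc d) → ℝ≥0∞) := by
  intro T _ hT x hx
  have hk : (0 : ℝ) < k + 1 := by positivity
  rw [lt_div_iff₀ hk] at hx
  rw [cutoff, Finset.prod_eq_zero (i := T) (by simpa using hT), ENNReal.ofReal_zero]
  refine max_eq_left ((min_le_right _ _).trans ?_)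
  linarith

lemma iSup_cutoff (x : V → Euc d) :
    ⨆ k, cutoff k x = (independentMaps V d).indicator 1 x := by
  refine iSup_eq_of_tendsto (fun i j hij => monotone_cutoff hij x) ?_
  by_cases hx : x ∈ independentMaps V d
  · rw [indicator_of_mem hx]
    refine tendsto_const_nhds.congr' ?_
    have h1 : ∀ T : Finset V, ∀ᶠ k : ℕ in atTop, T.card ≤ d →
        max 0 (min 1 (((k : ℝ) + 1) * gramDet T x - 1)) = 1 := by
      intro T
      by_cases hT : T.card ≤ d
      swap
      · exact Eventually.of_forall fun k h => absurd h hT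
      have hg := gramDet_pos_iff.2 (hx T hT)
      filter_upwards [eventually_ge_atTop ⌈2 / gramDet T x⌉₊] with k hk _
      have h2 := (Nat.ceil_le.1 hk)
      rw [div_le_iff₀ hg] at h2
      rw [min_eq_left (by nlinarith), max_eq_right zero_le_one]
    filter_upwards [eventually_all.2 h1] with k hk
    rw [cutoff, Finset.prod_eq_one fun T hT => hk T (by simpa using hT)]
    simp
  · rw [indicator_of_notMem hx]
    refine tendsto_const_nhds.congr fun k => ?_
    have : ∃ T : Finset V, T.card ≤ d ∧ ¬ LinearIndependent ℝ fun i : T => x i := by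
      simpa [independentMaps] using hx
    obtain ⟨T, hT, hd⟩ := this
    have hg : gramDet T x = 0 := by
      by_contra h
      exact hd (gramDet_pos_iff.1 ((gramDet_nonneg T x).lt_of_ne' h))
    refine (vanishesNearDegenerate_cutoff k T (Finset.subset_univ _) hT x ?_).symm
    rw [hg]
    positivity

/-- The weighted mass of the maps in general position does not depend on the order. -/
theorem iter_independentMaps_eq (hdeg : ∀ S v, (nbrsIn G S v).card < d) {l l' : List V}
    (hl : l.Nodup) (hcov : ∀ v, v ∈ l) (hl' : l'.Nodup) (hcov' : ∀ v, v ∈ l') (x : V → Euc d) :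
    iter G ∅ l ((independentMaps V d).indicator 1) x =
      iter G ∅ l' ((independentMaps V d).indicator 1) x := by
  have e : (independentMaps V d).indicator 1 = fun x => ⨆ k, cutoff k x :=
    funext fun x => (iSup_cutoff x).symm
  rw [e, iter_iSup hdeg _ _ (fun k => (continuous_cutoff k).measurable) monotone_cutoff,
    iter_iSup hdeg _ _ (fun k => (continuous_cutoff k).measurable) monotone_cutoff]
  exact iSup_congr fun k => iter_eq_of_vanishesNearDegenerate hdeg (by positivity)
    (continuous_cutoff k) (vanishesNearDegenerate_cutoff k) (cutoff_le_one k) hl hcov hl' hcov' x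

end Iter

/-! ### The density `φ_p(Σ)` as an iterated integral -/

section Sequential

variable {V : Type*} [Fintype V] {d : ℕ} {G : SimpleGraph V} (p : V ≃ Fin (Fintype.card V))

/-- The nodes among the first `k` in the ordering. -/
noncomputable def initialNodes (k : ℕ) : Finset V := Finset.univ.filter fun w => (p w : ℕ) < k

/-- The nodes in the ordering, without the first `k`. -/
noncomputable def remainingNodes (k : ℕ) : List V :=
  ((List.finRange (Fintype.card V)).drop k).map p.symm

lemma mem_initialNodes {k : ℕ} {w : V} : w ∈ initialNodes p k ↔ (p w : ℕ) < k := by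
  simp [initialNodes]

lemma initialNodes_succ {k : ℕ} (hk : k < Fintype.card V) :
    initialNodes p (k + 1) = insert (p.symm ⟨k, hk⟩) (initialNodes p k) := by
  ext w
  rw [Finset.mem_insert, mem_initialNodes, mem_initialNodes, Equiv.eq_symm_apply, Fin.ext_iff]
  simp only
  omega

lemma notMem_initialNodes {k : ℕ} (hk : k < Fintype.card V) :
    p.symm ⟨k, hk⟩ ∉ initialNodes p k := by
  simp [mem_initialNodes]

lemma remainingNodes_eq_cons {k : ℕ} (hk : k < Fintype.card V) :
    remainingNodes p k = p.symm ⟨k, hk⟩ :: remainingNodes p (k + 1) := by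
  rw [remainingNodes, remainingNodes, List.drop_eq_getElem_cons (by simpa using hk),
    List.map_cons]
  simp

lemma backNbrs_eq_nbrsIn {k : ℕ} (hk : k < Fintype.card V) :
    backNbrs G p (p.symm ⟨k, hk⟩) = nbrsIn G (initialNodes p k) (p.symm ⟨k, hk⟩) := by
  ext w
  simp [backNbrs, mem_nbrsIn, mem_initialNodes, Fin.lt_def]

lemma seqStep_eq {v : V} (hN : (backNbrs G p v).card < d) (x : V → Euc d) :
    seqStep G p v x = (ballMeasure (Euc d)).map
      fun z => Function.update x v (normalize (perpProj (backNbrs G p v) x z)) := by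
  have h : seqStep G p v x =
      (sphereUniform (perp (backNbrs G p v) x)).map fun y => Function.update x v y := rfl
  rw [h, sphereUniform_perp hN, Measure.map_map (measurable_update x)
    (measurable_normalize_perpProj _ x)]
  rfl

/-- `Measure.bind` computes integrals as expected only for a measurable kernel. -/
lemma measurable_seqStep {v : V} (hN : (backNbrs G p v).card < d) :
    Measurable (seqStep (d := d) G p v) := by
  refine Measure.measurable_of_measurable_coe _ fun s hs => ?_
  have hm := measurable_update_normalize_perpProj (d := d) (backNbrs G p v) v
  have h : (fun x => seqStep (d := d) G p v x s) = fun x => ballMeasure (Euc d) (Prod.mk x ⁻¹'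
      ((fun q : (V → Euc d) × Euc d => Function.update q.1 v
        (normalize (perpProj (backNbrs G p v) q.1 q.2))) ⁻¹' s)) := by
    funext x
    have hx : Measurable fun z : Euc d =>
        Function.update x v (normalize (perpProj (backNbrs G p v) x z)) :=
      (measurable_update x).comp (measurable_normalize_perpProj _ x)
    rw [seqStep_eq p hN, Measure.map_apply hx hs]
    rfl
  rw [h]
  exact measurable_measure_prodMk_left (hm hs)

lemma lintegral_seqStep {v : V} {F : (V → Euc d) → ℝ≥0∞}
    (hF : Measurable F) (x : V → Euc d) :
    ∫⁻ y, F y ∂seqStep G p v x = perpAvg (backNbrs G p v) v F x :=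
  lintegral_map hF (measurable_update x)

lemma seqLawAux_succ {k : ℕ} (hk : k < Fintype.card V) :
    seqLawAux G d p (k + 1) = (seqLawAux G d p k).bind (seqStep G p (p.symm ⟨k, hk⟩)) := by
  rw [seqLawAux, dif_pos hk]

/-- The expectation of `g`, weighted by all density factors, after `k` steps. -/
lemma lintegral_seqLawAux (hdeg : ∀ S v, (nbrsIn G S v).card < d)
    {g : (V → Euc d) → ℝ≥0∞} (hg : Measurable g) {k : ℕ} (hk : k ≤ Fintype.card V) :
    ∫⁻ x, (∏ w ∈ initialNodes p k, weight (backNbrs G p w) x) *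
        iter G (initialNodes p k) (remainingNodes p k) g x ∂seqLawAux G d p k =
      iter G ∅ (remainingNodes p 0) g 0 := by
  have hm : ∀ k, Measurable fun x : V → Euc d =>
      (∏ w ∈ initialNodes p k, weight (backNbrs G p w) x) *
        iter G (initialNodes p k) (remainingNodes p k) g x := fun k =>
    (Finset.measurable_prod _ fun w _ => measurable_weight _).mul (measurable_iter hdeg _ _ hg)
  -- The left-hand side is the same for all `k`: placing one more node moves its weight and its
  -- average from `iter` into the product and the law.
  induction k with
  | zero =>
    rw [seqLawAux, lintegral_dirac' _ (hm 0)]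
    have : initialNodes p 0 = ∅ := by
      ext w
      simp [mem_initialNodes]
    simp [this]
  | succ k ih =>
    have hk' : k < Fintype.card V := hk
    rw [← ih hk'.le, seqLawAux_succ p hk']
    set v := p.symm ⟨k, hk'⟩ with hv
    have hb : backNbrs G p v = nbrsIn G (initialNodes p k) v := backNbrs_eq_nbrsIn p hk'
    have hN : (backNbrs G p v).card < d := by rw [hb]; exact hdeg _ _
    rw [Measure.lintegral_bind (measurable_seqStep p hN).aemeasurable (hm _).aemeasurable]
    refine lintegral_congr fun x => ?_
    rw [lintegral_seqStep p (hm _), perpAvg]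
    -- The weights of the first `k + 1` nodes involve only vectors of nodes strictly before them,
    -- hence not the new vector at `v`.
    have h1 : ∀ y : Euc d, ∏ w ∈ initialNodes p (k + 1),
        weight (backNbrs G p w) (Function.update x v y) =
        ∏ w ∈ initialNodes p (k + 1), weight (backNbrs G p w) x := by
      intro y
      refine Finset.prod_congr rfl fun w hw => weight_congr fun u hu => ?_
      refine Function.update_of_ne (fun e => ?_) _ _
      have h2 : p u < p w := (Finset.mem_filter.1 hu).2.1
      have h3 := (mem_initialNodes p).1 hw
      rw [e, hv, Equiv.apply_symm_apply, Fin.lt_def] at h2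
      simp only at h2
      omega
    simp_rw [h1]
    rw [lintegral_const_mul (f := fun y => iter G (initialNodes p (k + 1))
      (remainingNodes p (k + 1)) g (Function.update x v y)) _
      ((measurable_iter hdeg _ _ hg).comp (measurable_update x)),
      remainingNodes_eq_cons p hk', ← hv, iter]
    simp only [perpAvg]
    rw [initialNodes_succ p hk', ← hv,
      Finset.prod_insert (notMem_initialNodes p hk'), hb]
    ring

/-- The projection vanishes on a proper subspace only, so `normalize` almost surely returns a unit
vector. -/
lemma ae_perpProj_ne_zero {N : Finset V} (hN : N.card < d) (x : V → Euc d) :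
    ∀ᵐ z ∂ballMeasure (Euc d), perpProj N x z ≠ 0 := by
  have hd : (perp N x)ᗮ ≠ ⊤ := fun h => perp_ne_bot hN x ((Submodule.orthogonal_eq_top_iff _).1 h)
  refine ballMeasure_absolutelyContinuous.ae_le ?_
  refine measure_mono_null (fun z hz => ?_) (Measure.addHaar_submodule volume _ hd)
  have hz' : perpProj N x z = 0 := by simpa using hz
  exact (Submodule.starProjection_apply_eq_zero_iff _).1 hz'

/-- The constraints satisfied by the vectors of the first `k` nodes. -/
def initialOrtho (d : ℕ) (G : SimpleGraph V) (k : ℕ) : Set (V → Euc d) :=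
  {x | (∀ v ∈ initialNodes p k, ‖x v‖ = 1) ∧
    ∀ u ∈ initialNodes p k, ∀ v ∈ initialNodes p k, G.Adj u v → inner ℝ (x u) (x v) = 0}

lemma measurableSet_initialOrtho (k : ℕ) : MeasurableSet (initialOrtho p d G k) := by
  have : initialOrtho p d G k = (⋂ v ∈ initialNodes p k, {x | ‖x v‖ = 1}) ∩
      ⋂ u ∈ initialNodes p k, ⋂ v ∈ initialNodes p k,
        {x | G.Adj u v → inner ℝ (x u) (x v) = 0} := by
    ext x
    simp [initialOrtho]
  rw [this]
  refine MeasurableSet.inter ?_ ?_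
  · exact Finset.measurableSet_biInter _ fun v _ =>
      (isClosed_eq (continuous_apply v).norm continuous_const).measurableSet
  · refine Finset.measurableSet_biInter _ fun u _ => Finset.measurableSet_biInter _ fun v _ => ?_
    by_cases h : G.Adj u v
    · simp only [h, forall_const]
      exact (isClosed_eq ((continuous_apply u).inner (continuous_apply v))
        continuous_const).measurableSet
    · simp [h]

/-- Norms and orthogonality hold almost surely by construction, so of the conditions defining
`generalPosition` only independence matters. -/
lemma ae_mem_initialOrtho (hdeg : ∀ S v, (nbrsIn G S v).card < d) {k : ℕ}
    (hk : k ≤ Fintype.card V) : ∀ᵐ x ∂seqLawAux G d p k, x ∈ initialOrtho p d G k := by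
  induction k with
  | zero => exact Eventually.of_forall fun x => by simp [initialOrtho, mem_initialNodes]
  | succ k ih =>
    have hk' : k < Fintype.card V := hk
    have ih := ih hk'.le
    rw [seqLawAux_succ p hk']
    set v := p.symm ⟨k, hk'⟩ with hv
    have hb : backNbrs G p v = nbrsIn G (initialNodes p k) v := backNbrs_eq_nbrsIn p hk'
    have hN : (backNbrs G p v).card < d := by rw [hb]; exact hdeg _ _
    rw [ae_iff]
    change Measure.bind _ _ (initialOrtho p d G (k + 1))ᶜ = 0
    have hms := (measurableSet_initialOrtho (d := d) (G := G) p (k + 1)).compl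
    rw [Measure.bind_apply hms (measurable_seqStep p hN).aemeasurable]
    have hms' : Measurable fun x : V → Euc d =>
        seqStep G p v x (initialOrtho p d G (k + 1))ᶜ :=
      (Measure.measurable_coe hms).comp (measurable_seqStep p hN)
    rw [lintegral_eq_zero_iff' hms'.aemeasurable]
    filter_upwards [ih] with x hx
    have hxm : Measurable fun z : Euc d =>
        Function.update x v (normalize (perpProj (backNbrs G p v) x z)) :=
      (measurable_update x).comp (measurable_normalize_perpProj _ x)
    rw [Pi.zero_apply, seqStep_eq p hN, Measure.map_apply hxm hms]
    refine measure_mono_null (fun z hz => ?_) (ae_iff.1 (ae_perpProj_ne_zero hN x))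
    simp only [ne_eq, not_not, mem_ofPred_eq]
    by_contra h0
    refine hz ?_
    change Function.update x v (normalize (perpProj (backNbrs G p v) x z)) ∈
      initialOrtho p d G (k + 1)
    have hvn : v ∉ initialNodes p k := notMem_initialNodes p hk'
    have hne : ∀ u ∈ initialNodes p k, ∀ y : Euc d, Function.update x v y u = x u := fun u hu y =>
      Function.update_of_ne (fun h => hvn (by rw [← h]; exact hu)) _ _
    have hmem : normalize (perpProj (backNbrs G p v) x z) ∈ perp (backNbrs G p v) x :=
      normalize_mem (Submodule.starProjection_apply_mem _ _)
    rw [mem_perp] at hmem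
    constructor
    · intro u hu
      rw [initialNodes_succ p hk', ← hv, Finset.mem_insert] at hu
      rcases hu with rfl | hu
      · rw [Function.update_self]
        exact norm_normalize h0
      · rw [hne u hu]
        exact hx.1 u hu
    · intro u hu w hw ha
      rw [initialNodes_succ p hk', ← hv, Finset.mem_insert] at hu hw
      by_cases huv : u = v
      · by_cases hwv : w = v
        · exact absurd (huv.trans hwv.symm) ha.ne
        · have hw' := hw.resolve_left hwv
          rw [hne w hw', huv, Function.update_self, real_inner_comm]
          refine hmem w ?_
          rw [hb, mem_nbrsIn]
          exact ⟨hw', huv ▸ ha.symm⟩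
      · have hu' := hu.resolve_left huv
        by_cases hwv : w = v
        · rw [hne u hu', hwv, Function.update_self]
          refine hmem u ?_
          rw [hb, mem_nbrsIn]
          exact ⟨hu', hwv ▸ ha⟩
        · rw [hne u hu', hne w (hw.resolve_left hwv)]
          exact hx.2 u hu' w (hw.resolve_left hwv) ha

lemma measurableSet_independentMaps : MeasurableSet (independentMaps V d) := by
  have : independentMaps V d =
      ⋂ T ∈ (Finset.univ.filter fun T : Finset V => T.card ≤ d), {x | 0 < gramDet T x} := by
    ext x
    simp [independentMaps, gramDet_pos_iff]
  rw [this]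
  exact Finset.measurableSet_biInter _ fun T _ =>
    (isOpen_lt continuous_const (continuous_gramDet T)).measurableSet

lemma initialNodes_card : initialNodes p (Fintype.card V) = Finset.univ := by
  ext w
  simp [mem_initialNodes]

lemma generalPosition_eq : generalPosition G d =
    initialOrtho p d G (Fintype.card V) ∩ independentMaps V d := by
  ext x
  simp [generalPosition, initialOrtho, independentMaps, initialNodes_card, and_assoc]

/-- The ortho-homomorphism density as an iterated integral. -/
theorem orthoDensity_eq_iter (hdeg : ∀ S v, (nbrsIn G S v).card < d) :
    orthoDensity G d p =
      iter G ∅ (remainingNodes p 0) ((independentMaps V d).indicator 1) 0 := by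
  have hmi := measurableSet_independentMaps (V := V) (d := d)
  have hmg : MeasurableSet (generalPosition G d) := by
    rw [generalPosition_eq p]
    exact (measurableSet_initialOrtho p _).inter hmi
  rw [← lintegral_seqLawAux p hdeg (measurable_one.indicator hmi) le_rfl, orthoDensity,
    orthoMeasure, withDensity_apply _ hmg, ← lintegral_indicator hmg, seqLaw]
  refine lintegral_congr_ae ?_
  filter_upwards [ae_mem_initialOrtho (G := G) (d := d) p hdeg le_rfl] with x hx
  have h1 : remainingNodes p (Fintype.card V) = [] := by
    simp [remainingNodes]
  have h2 : x ∈ generalPosition G d ↔ x ∈ independentMaps V d := by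
    rw [generalPosition_eq p]
    exact and_iff_right hx
  rw [h1, iter, initialNodes_card]
  by_cases h : x ∈ independentMaps V d
  · rw [indicator_of_mem (h2.2 h), indicator_of_mem h, Pi.one_apply, mul_one, seqDensity,
      ENNReal.ofReal_prod_of_nonneg fun v _ => sDensity_nonneg _ _]
    rfl
  · rw [indicator_of_notMem fun h' => h (h2.1 h'), indicator_of_notMem h, mul_zero]

lemma nodup_remainingNodes : (remainingNodes p 0).Nodup := by
  rw [remainingNodes, List.drop_zero]
  exact (List.nodup_finRange _).map p.symm.injective

lemma mem_remainingNodes (v : V) : v ∈ remainingNodes p 0 := by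
  rw [remainingNodes, List.drop_zero, List.mem_map]
  exact ⟨p v, List.mem_finRange _, by simp⟩

end Sequential

/-! ### From finite graphs to measurable relations by sampling -/

section Sampling

variable {Ω : Type*} [MeasurableSpace Ω] (ν : Measure Ω) [IsProbabilityMeasure ν]

lemma lintegral_pi_comp_injective {W ι : Type*} [Fintype W] [Fintype ι] {φ : W → ι}
    (hφ : Function.Injective φ) {f : (W → Ω) → ℝ≥0∞} (hf : Measurable f) :
    ∫⁻ X, f (fun w => X (φ w)) ∂Measure.pi (fun _ : ι => ν) =
      ∫⁻ x, f x ∂Measure.pi fun _ : W => ν := by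
  have : Nonempty Ω := nonempty_of_isProbabilityMeasure ν
  have X₀ : ι → Ω := fun _ => Classical.arbitrary Ω
  have hm : Measurable fun X : ι → Ω => fun w => X (φ w) :=
    measurable_pi_lambda _ fun w => measurable_pi_apply _
  have h1 : (∫⋯∫⁻_Finset.univ.image φ, (fun X : ι → Ω => f fun w => X (φ w)) ∂fun _ => ν) =
      fun _ => ∫⁻ x, f x ∂Measure.pi fun _ : W => ν := by
    funext X
    have := lmarginal_image (μ := fun _ : ι => ν) hφ Finset.univ (f := f) hf X
    rw [lmarginal_univ] at this
    exact this
  rw [lintegral_eq_lmarginal_univ X₀, ← Finset.union_sdiff_of_subset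
    (Finset.subset_univ (Finset.univ.image φ)), lmarginal_union' (f := fun X : ι → Ω => f fun w => X (φ w)) _ (hf.comp hm)
    Finset.disjoint_sdiff, h1, lmarginal]
  simp

/-- The homomorphism density of a graph in a measurable relation. -/
noncomputable def relDensity {W : Type*} [Fintype W] (K : SimpleGraph W) (R : Ω → Ω → Prop) : ℝ :=
  (Measure.pi fun _ : W => ν).real {x | ∀ u v, K.Adj u v → R (x u) (x v)}

/-- The random graph on sampled points. -/
def sampleGraph {ι : Type*} (R : Ω → Ω → Prop) (hR : ∀ a b, R a b → R b a) (X : ι → Ω) :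
    SimpleGraph ι where
  Adj i j := i ≠ j ∧ R (X i) (X j)
  symm := ⟨fun _ _ h => ⟨h.1.symm, hR _ _ h.2⟩⟩
  loopless := ⟨fun _ h => h.1 rfl⟩

variable {W : Type*} [Fintype W] (K : SimpleGraph W) {R : Ω → Ω → Prop}
  (hR : ∀ a b, R a b → R b a)

/-- The event that a given map is a homomorphism to the random graph. -/
def homEvent {ι : Type*} (R : Ω → Ω → Prop) (φ : W → ι) : Set (ι → Ω) :=
  {X | ∀ u v, K.Adj u v → φ u ≠ φ v ∧ R (X (φ u)) (X (φ v))}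

lemma card_hom_sampleGraph {ι : Type*} [Fintype ι] (X : ι → Ω) :
    (Nat.card (K →g sampleGraph R hR X) : ℝ) =
      ∑ φ : W → ι, (homEvent K R φ).indicator (fun _ => (1 : ℝ)) X := by
  have e : (K →g sampleGraph R hR X) ≃ {φ : W → ι // X ∈ homEvent K R φ} :=
    { toFun := fun f => ⟨f, fun u v h => f.map_rel h⟩
      invFun := fun φ => ⟨φ.1, fun {u v} h => φ.2 u v h⟩
      left_inv := fun f => rfl
      right_inv := fun φ => rfl }
  rw [Nat.card_congr e, Nat.card_eq_fintype_card, Fintype.card_subtype, Finset.card_filter]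
  push_cast
  refine Finset.sum_congr rfl fun φ _ => ?_
  by_cases h : X ∈ homEvent K R φ <;> simp [h]

lemma measurableSet_homEvent (hRm : MeasurableSet {q : Ω × Ω | R q.1 q.2})
    {ι : Type*} [Fintype ι] (φ : W → ι) :
    MeasurableSet (homEvent K R φ) := by
  have : homEvent K R φ = ⋂ u, ⋂ v, {X : ι → Ω | K.Adj u v → φ u ≠ φ v ∧ R (X (φ u)) (X (φ v))} := by
    ext X
    simp [homEvent]
  rw [this]
  refine MeasurableSet.iInter fun u => MeasurableSet.iInter fun v => ?_
  by_cases h : K.Adj u v <;> by_cases h' : φ u = φ v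
  · simp [h, h']
  · simp only [h, h', ne_eq, not_false_eq_true, true_and, forall_const]
    have hm : Measurable fun X : ι → Ω => (X (φ u), X (φ v)) :=
      (measurable_pi_apply (φ u)).prodMk (measurable_pi_apply (φ v))
    exact hm hRm
  · simp [h]
  · simp [h]

lemma measurableSet_relDensity (hRm : MeasurableSet {q : Ω × Ω | R q.1 q.2}) :
    MeasurableSet {x : W → Ω | ∀ u v, K.Adj u v → R (x u) (x v)} := by
  have : {x : W → Ω | ∀ u v, K.Adj u v → R (x u) (x v)} = homEvent K R id := by
    ext x
    refine forall₃_congr fun u v h => ?_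
    simp [h.ne]
  rw [this]
  exact measurableSet_homEvent K hRm id

lemma measureReal_homEvent (hRm : MeasurableSet {q : Ω × Ω | R q.1 q.2})
    {ι : Type*} [Fintype ι] {φ : W → ι} (hφ : Function.Injective φ) :
    (Measure.pi fun _ : ι => ν).real (homEvent K R φ) = relDensity ν K R := by
  have h1 := lintegral_pi_comp_injective ν hφ (f := {x : W → Ω | ∀ u v, K.Adj u v →
    R (x u) (x v)}.indicator 1) (measurable_one.indicator (measurableSet_relDensity K hRm))
  rw [lintegral_indicator_one (measurableSet_relDensity K hRm)] at h1
  rw [relDensity, measureReal_def, measureReal_def, ← h1,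
    ← lintegral_indicator_one (measurableSet_homEvent K hRm φ)]
  congr 1
  refine lintegral_congr fun X => ?_
  have : X ∈ homEvent K R φ ↔
      (fun w => X (φ w)) ∈ {x : W → Ω | ∀ u v, K.Adj u v → R (x u) (x v)} := by
    refine forall₃_congr fun u v h => ?_
    exact ⟨fun h' => h'.2, fun h' => ⟨hφ.ne h.ne, h'⟩⟩
  by_cases h : X ∈ homEvent K R φ
  · rw [indicator_of_mem h, indicator_of_mem (this.1 h)]
    rfl
  · rw [indicator_of_notMem h, indicator_of_notMem fun h' => h (this.2 h')]

lemma integrable_homDensity (hRm : MeasurableSet {q : Ω × Ω | R q.1 q.2})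
    (n : ℕ) : Integrable
    (fun X : Fin (n + 1) → Ω => homDensity K (sampleGraph R hR X))
    (Measure.pi fun _ => ν) := by
  unfold homDensity
  simp_rw [card_hom_sampleGraph K hR]
  refine Integrable.div_const (integrable_finsetSum _ fun φ _ => ?_) _
  exact (integrable_const 1).indicator (measurableSet_homEvent K hRm φ)

lemma integral_homDensity (hRm : MeasurableSet {q : Ω × Ω | R q.1 q.2})
    (n : ℕ) :
    ∫ X, homDensity K (sampleGraph R hR X) ∂Measure.pi (fun _ : Fin (n + 1) => ν) =
      (∑ φ : W → Fin (n + 1), (Measure.pi fun _ : Fin (n + 1) => ν).real (homEvent K R φ)) /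
        ((n + 1 : ℕ) : ℝ) ^ Fintype.card W := by
  unfold homDensity
  simp_rw [card_hom_sampleGraph K hR]
  rw [integral_div, integral_finsetSum]
  · simp only [Nat.card_eq_fintype_card, Fintype.card_fin]
    congr 1
    refine Finset.sum_congr rfl fun φ _ => ?_
    rw [integral_indicator_const _ (measurableSet_homEvent K hRm φ)]
    simp
  · exact fun φ _ => (integrable_const 1).indicator (measurableSet_homEvent K hRm φ)

lemma card_injective_fin (n : ℕ) :
    ((Finset.univ.filter fun φ : W → Fin n => Function.Injective φ).card : ℝ) =
      n.descFactorial (Fintype.card W) := by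
  rw [← Fintype.card_subtype, Fintype.card_congr (Equiv.subtypeInjectiveEquivEmbedding W (Fin n)),
    Fintype.card_embedding_eq, Fintype.card_fin]

/-- An injective map picks distinct, hence independent, sample points, so it is a homomorphism with
probability exactly `relDensity ν K R`. The other maps are discarded. -/
lemma le_integral_homDensity (hRm : MeasurableSet {q : Ω × Ω | R q.1 q.2}) (n : ℕ) :
    ((n + 1).descFactorial (Fintype.card W) : ℝ) / ((n + 1 : ℕ) : ℝ) ^ Fintype.card W *
        relDensity ν K R ≤
      ∫ X, homDensity K (sampleGraph R hR X) ∂Measure.pi (fun _ : Fin (n + 1) => ν) := by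
  rw [integral_homDensity ν K hR hRm, div_mul_eq_mul_div]
  gcongr
  rw [← card_injective_fin, ← nsmul_eq_mul, ← Finset.sum_const]
  refine (Finset.sum_le_sum fun φ hφ => ?_).trans (Finset.sum_le_sum_of_subset_of_nonneg
    (Finset.filter_subset _ _) fun φ _ _ => measureReal_nonneg)
  exact (measureReal_homEvent ν K hRm (Finset.mem_filter.1 hφ).2).ge

/-- Each non-injective map is given probability at most `1`; their proportion tends to `0`. -/
lemma integral_homDensity_le (hRm : MeasurableSet {q : Ω × Ω | R q.1 q.2}) (n : ℕ) :
    ∫ X, homDensity K (sampleGraph R hR X) ∂Measure.pi (fun _ : Fin (n + 1) => ν) ≤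
      relDensity ν K R + (1 -
        ((n + 1).descFactorial (Fintype.card W) : ℝ) / ((n + 1 : ℕ) : ℝ) ^ Fintype.card W) := by
  have hpos : (0 : ℝ) < ((n + 1 : ℕ) : ℝ) ^ Fintype.card W := by positivity
  have hrel : 0 ≤ relDensity ν K R := measureReal_nonneg
  rw [integral_homDensity ν K hR hRm, div_le_iff₀ hpos, add_mul, sub_mul, one_mul,
    div_mul_cancel₀ _ hpos.ne', ← Finset.sum_filter_add_sum_filter_not Finset.univ
      fun φ : W → Fin (n + 1) => Function.Injective φ]
  have h1 : ∑ φ : W → Fin (n + 1) with Function.Injective φ,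
      (Measure.pi fun _ : Fin (n + 1) => ν).real (homEvent K R φ) ≤
      relDensity ν K R * ((n + 1 : ℕ) : ℝ) ^ Fintype.card W := by
    rw [Finset.sum_congr rfl fun φ hφ =>
      measureReal_homEvent ν K hRm (Finset.mem_filter.1 hφ).2, Finset.sum_const, nsmul_eq_mul,
      mul_comm, card_injective_fin]
    gcongr
    exact_mod_cast Nat.descFactorial_le_pow _ _
  have h2 : ∑ φ : W → Fin (n + 1) with ¬ Function.Injective φ,
      (Measure.pi fun _ : Fin (n + 1) => ν).real (homEvent K R φ) ≤
      ((n + 1 : ℕ) : ℝ) ^ Fintype.card W - (n + 1).descFactorial (Fintype.card W) := by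
    refine (Finset.sum_le_card_nsmul _ _ 1 fun φ _ => measureReal_le_one).trans ?_
    rw [nsmul_eq_mul, mul_one, ← card_injective_fin]
    have := Finset.card_filter_add_card_filter_not (s := Finset.univ)
      (fun φ : W → Fin (n + 1) => Function.Injective φ)
    rw [Finset.card_univ, Fintype.card_fun, Fintype.card_fin] at this
    have h3 := congrArg (Nat.cast : ℕ → ℝ) this
    push_cast at h3 ⊢
    linarith
  linarith

lemma tendsto_descFactorial_div (k : ℕ) :
    Tendsto (fun n : ℕ => ((n + 1).descFactorial k : ℝ) / ((n + 1 : ℕ) : ℝ) ^ k) atTop (𝓝 1) := by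
  have hz : ∀ᶠ n : ℕ in atTop, (n : ℝ) ^ k ≠ 0 := by
    filter_upwards [eventually_ge_atTop 1] with n hn
    positivity
  exact ((Asymptotics.isEquivalent_iff_tendsto_one hz).1
    (isEquivalent_descFactorial k)).comp (tendsto_add_atTop_nat 1)

/-- Sidorenko's inequality for graphs implies it for measurable relations. -/
theorem SatisfiesSidorenko.relDensity {K : SimpleGraph W} (hK : SatisfiesSidorenko K)
    (hR : ∀ a b, R a b → R b a) (hRm : MeasurableSet {q : Ω × Ω | R q.1 q.2}) :
    relDensity ν (⊤ : SimpleGraph (Fin 2)) R ^ K.edgeSet.ncard ≤ relDensity ν K R := by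
  set e := K.edgeSet.ncard
  have h1 : ∀ n : ℕ, (((n + 1).descFactorial (Fintype.card (Fin 2)) : ℝ) /
      ((n + 1 : ℕ) : ℝ) ^ Fintype.card (Fin 2) *
        OrthoHom.relDensity ν (⊤ : SimpleGraph (Fin 2)) R) ^ e ≤
      OrthoHom.relDensity ν K R + (1 -
        ((n + 1).descFactorial (Fintype.card W) : ℝ) / ((n + 1 : ℕ) : ℝ) ^ Fintype.card W) := by
    intro n
    set f : (Fin (n + 1) → Ω) → ℝ :=
      fun X => homDensity (⊤ : SimpleGraph (Fin 2)) (sampleGraph R hR X) with hf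
    have hfi : Integrable f (Measure.pi fun _ => ν) := integrable_homDensity ν _ hR hRm n
    have hf0 : ∀ X, 0 ≤ f X := fun X => by
      simp only [hf, homDensity]
      positivity
    have hf1 : ∀ X, f X ^ e ≤ homDensity K (sampleGraph R hR X) := fun X => hK n _
    have hKi := integrable_homDensity ν K hR hRm n
    have hfei : Integrable (fun X => f X ^ e) (Measure.pi fun _ => ν) := by
      refine hKi.mono' (hfi.aestronglyMeasurable.pow e) (Eventually.of_forall fun X => ?_)
      rw [Real.norm_eq_abs, abs_of_nonneg (pow_nonneg (hf0 X) e)]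
      exact hf1 X
    have hpos : 0 ≤ ((n + 1).descFactorial (Fintype.card (Fin 2)) : ℝ) /
      ((n + 1 : ℕ) : ℝ) ^ Fintype.card (Fin 2) *
        OrthoHom.relDensity ν (⊤ : SimpleGraph (Fin 2)) R :=
      mul_nonneg (by positivity) measureReal_nonneg
    -- Jensen's inequality for `t ↦ t^e` moves the power inside the expectation, where Sidorenko's
    -- inequality holds for every sample.
    calc _ ≤ (∫ X, f X ∂Measure.pi fun _ => ν) ^ e :=
          pow_le_pow_left₀ hpos (le_integral_homDensity ν _ hR hRm n) e
      _ ≤ ∫ X, f X ^ e ∂Measure.pi fun _ => ν :=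
          (convexOn_pow e).map_integral_le (continuousOn_pow e) isClosed_Ici
            (Eventually.of_forall hf0) hfi hfei
      _ ≤ ∫ X, homDensity K (sampleGraph R hR X) ∂Measure.pi (fun _ : Fin (n + 1) => ν) :=
          integral_mono hfei hKi hf1
      _ ≤ _ := integral_homDensity_le ν K hR hRm n
  have h2 := ((tendsto_descFactorial_div (Fintype.card (Fin 2))).mul_const
    (OrthoHom.relDensity ν (⊤ : SimpleGraph (Fin 2)) R)).pow e
  have h3 := ((tendsto_descFactorial_div (Fintype.card W)).const_sub 1).const_add
    (OrthoHom.relDensity ν K R)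
  have := le_of_tendsto_of_tendsto' h2 h3 h1
  simpa using this

end Sampling

/-! ### Null zero sets of analytic functions -/

section ZeroSets

open scoped ContDiff

variable {E : Type*} [NormedAddCommGroup E] [NormedSpace ℝ E]

lemma contDiff_det {n : Type*} [Fintype n] [DecidableEq n] {M : E → Matrix n n ℝ}
    (h : ∀ i j, ContDiff ℝ ω fun x => M x i j) : ContDiff ℝ ω fun x => (M x).det := by
  simp_rw [Matrix.det_apply]
  exact ContDiff.sum fun σ _ => ContDiff.const_smul _ (contDiff_prod fun i _ => h _ _)

lemma contDiff_adjugate {n : Type*} [Fintype n] [DecidableEq n] {M : E → Matrix n n ℝ}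
    (h : ∀ i j, ContDiff ℝ ω fun x => M x i j) (i j : n) :
    ContDiff ℝ ω fun x => (M x).adjugate i j := by
  simp_rw [Matrix.adjugate_apply]
  refine contDiff_det fun k l => ?_
  simp only [Matrix.updateRow_apply]
  split_ifs
  · exact contDiff_const
  · exact h k l

lemma contDiff_gram_det {F : Type*} [NormedAddCommGroup F] [InnerProductSpace ℝ F]
    {n : Type*} [Fintype n] [DecidableEq n] {w : E → n → F}
    (h : ∀ i, ContDiff ℝ ω fun x => w x i) :
    ContDiff ℝ ω fun x => (Matrix.gram ℝ (w x)).det :=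
  contDiff_det fun i j => (h i).inner ℝ (h j)

lemma gram_det_ne_zero_iff {d : ℕ} {n : Type*} [Fintype n] [DecidableEq n] {w : n → Euc d} :
    (Matrix.gram ℝ w).det ≠ 0 ↔ LinearIndependent ℝ w := by
  have h0 : (Matrix.gram ℝ w).PosSemidef := Matrix.posSemidef_gram ℝ w
  rw [← Matrix.posDef_gram_iff_linearIndependent (𝕜 := ℝ), h0.posDef_iff_isUnit,
    Matrix.isUnit_iff_isUnit_det, isUnit_iff_ne_zero]

variable [FiniteDimensional ℝ E] [MeasurableSpace E] [BorelSpace E]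

/-- The zero set of a nonzero real analytic function is a null set. -/
lemma ae_ne_zero_of_contDiff (μ : Measure E) [μ.IsAddHaarMeasure] {f : E → ℝ}
    (hf : ContDiff ℝ ω f) {w : E} (hw : f w ≠ 0) : ∀ᵐ z ∂μ, f z ≠ 0 := by
  -- On each line through `w` the restriction is analytic and nonzero at `t = 0`, so its zeros form
  -- a null set.
  have h1 : ∀ z, ∀ᵐ t : ℝ, f (w + t • z) ≠ 0 := by
    intro z
    have hg : ContDiff ℝ ω fun t : ℝ => f (w + t • z) := hf.comp (by fun_prop)
    have h := hg.analyticOnNhd (s := univ).preimage_zero_mem_codiscrete (x := 0) (by simpa using hw)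
    have h2 := ae_restrict_le_codiscreteWithin (α := ℝ) MeasurableSet.univ (μ := volume) h
    rw [Measure.restrict_univ] at h2
    exact h2
  have hm : MeasurableSet {q : E × ℝ | f (w + q.2 • q.1) ≠ 0} := by
    have : Measurable fun q : E × ℝ => f (w + q.2 • q.1) :=
      (hf.continuous.comp (by fun_prop)).measurable
    exact this (measurableSet_singleton 0).compl
  have h2 : ∀ᵐ t : ℝ, ∀ᵐ z ∂μ, f (w + t • z) ≠ 0 :=
    (Measure.ae_ae_comm (p := fun z t => f (w + t • z) ≠ 0) hm).1
      (Eventually.of_forall h1)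
  have h3 : ∀ᵐ t : ℝ, t ≠ 0 := by simp [ae_iff]
  -- One `t ≠ 0` suffices: the affine bijection `z ↦ w + t • z` carries null sets to null sets.
  obtain ⟨t, ht, ht0⟩ := (h2.and h3).exists
  rw [ae_iff] at ht ⊢
  have e : {z | ¬f (w + t • z) ≠ 0} = (t • ·) ⁻¹' ((w + ·) ⁻¹' {z | ¬f z ≠ 0}) := rfl
  rw [e, Measure.addHaar_preimage_smul μ ht0, measure_preimage_add, mul_eq_zero] at ht
  refine ht.resolve_left ?_
  simp [ht0]

end ZeroSets

/-! ### Products of ball and sphere measures -/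

section PiBall

open scoped ContDiff

variable {V : Type*} [Fintype V] {d : ℕ}

lemma pi_ballMeasure_absolutelyContinuous :
    Measure.pi (fun _ : V => ballMeasure (Euc d)) ≪ Measure.pi fun _ : V => volume := by
  have h : Measure.pi (fun _ : V => ballMeasure (Euc d)) =
      (∏ _v : V, (volume (ball (0 : Euc d) 1))⁻¹) •
        (Measure.pi fun _ : V => volume).restrict (univ.pi fun _ : V => ball (0 : Euc d) 1) := by
    refine Measure.pi_eq fun s hs => ?_
    rw [Measure.smul_apply, Measure.restrict_apply (MeasurableSet.univ_pi hs),
      ← pi_inter_distrib, Measure.pi_pi, smul_eq_mul, ← Finset.prod_mul_distrib]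
    refine Finset.prod_congr rfl fun v _ => ?_
    rw [ballMeasure, Measure.smul_apply, Measure.restrict_apply (hs v), smul_eq_mul]
  rw [h]
  exact (Measure.absolutelyContinuous_of_le Measure.restrict_le_self).smul_left _

lemma ae_pi_ballMeasure {f : (V → Euc d) → ℝ} (hf : ContDiff ℝ ω f) {w : V → Euc d}
    (hw : f w ≠ 0) : ∀ᵐ z ∂Measure.pi fun _ : V => ballMeasure (Euc d), f z ≠ 0 :=
  pi_ballMeasure_absolutelyContinuous.ae_le (ae_ne_zero_of_contDiff _ hf hw)

lemma pi_sphereLaw : Measure.pi (fun _ : V => sphereLaw d) =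
    (Measure.pi fun _ : V => ballMeasure (Euc d)).map fun z v => normalize (z v) := by
  have : ∀ _ : V, SigmaFinite ((ballMeasure (Euc d)).map normalize) := fun _ => by
    change SigmaFinite (sphereLaw d); infer_instance
  exact (Measure.pi_map_pi fun _ => measurable_normalize.aemeasurable).symm

lemma lintegral_pi_sphereLaw {F : (V → Euc d) → ℝ≥0∞} (hF : Measurable F) :
    ∫⁻ x, F x ∂Measure.pi (fun _ : V => sphereLaw d) =
      ∫⁻ z, F (fun v => normalize (z v)) ∂Measure.pi fun _ : V => ballMeasure (Euc d) := by
  rw [pi_sphereLaw, lintegral_map hF]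
  exact measurable_pi_lambda _ fun v => measurable_normalize.comp (measurable_pi_apply v)

end PiBall

/-! ### A polynomial form of the orthogonal projection -/

section Cramer

open scoped ContDiff

variable {V : Type*} [Fintype V] {d : ℕ}

/-- The projection to the orthogonal complement, scaled by the Gram determinant. -/
noncomputable def scaledProj (N : Finset V) (x : V → Euc d) (z : Euc d) : Euc d :=
  (Matrix.gram ℝ fun i : N => x i).det • z -
    ∑ u : N, (∑ k : N, (Matrix.gram ℝ fun i : N => x i).adjugate u k * inner ℝ (x k) z) • x u

/-- Unlike the projection itself, this multiple is polynomial in `x` everywhere, including dependent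
families, so the zero set argument applies. -/
lemma contDiff_scaledProj (N : Finset V) (z : Euc d) :
    ContDiff ℝ ω fun x : V → Euc d => scaledProj N x z := by
  have h1 : ∀ u : V, ContDiff ℝ ω fun x : V → Euc d => x u := fun u => contDiff_apply _ _ u
  have h2 : ∀ i j : N, ContDiff ℝ ω fun x : V → Euc d => (Matrix.gram ℝ fun i : N => x i) i j :=
    fun i j => (h1 i).inner ℝ (h1 j)
  unfold scaledProj
  refine ((contDiff_det h2).smul contDiff_const).sub (ContDiff.sum fun u _ => ContDiff.smul
    (ContDiff.sum fun k _ => (contDiff_adjugate h2 u k).mul ((h1 k).inner ℝ contDiff_const)) (h1 u))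

/-- Cramer's rule, `M * adj M = det M`, puts the left-hand side in `perp N x`; its difference from
`det M • z` lies in the span. -/
lemma scaledProj_eq (N : Finset V) (x : V → Euc d) (z : Euc d) :
    scaledProj N x z = (Matrix.gram ℝ fun i : N => x i).det • perpProj N x z := by
  set M := Matrix.gram ℝ fun i : N => x i with hM
  have h1 : scaledProj N x z ∈ perp N x := by
    rw [mem_perp]
    intro k hk
    have h := congrFun (congrArg (fun A : Matrix N N ℝ =>
      A.mulVec fun k : N => inner ℝ (x k) z) (Matrix.mul_adjugate M)) ⟨k, hk⟩
    simp only [Matrix.smul_mulVec, Matrix.one_mulVec, ← Matrix.mulVec_mulVec] at h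
    rw [scaledProj, inner_sub_right, inner_smul_right, inner_sum, sub_eq_zero]
    simp only [inner_smul_right]
    simp only [Pi.smul_apply, smul_eq_mul] at h
    rw [← hM, ← h, Matrix.mulVec, dotProduct]
    refine Finset.sum_congr rfl fun u _ => ?_
    rw [mul_comm]
    rfl
  have h2 : M.det • z - scaledProj N x z ∈ (perp N x)ᗮ := by
    rw [perp, Submodule.orthogonal_orthogonal, scaledProj, sub_sub_cancel]
    exact Submodule.sum_mem _ fun u _ => Submodule.smul_mem _ _
      (Submodule.subset_span ⟨u, u.2, rfl⟩)
  have h3 : M.det • perpProj N x z = perpProj N x (M.det • z) := (map_smul _ _ _).symm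
  rw [h3]
  have h4 : M.det • z = scaledProj N x z + (M.det • z - scaledProj N x z) := by abel
  rw [h4, perpProj, map_add, Submodule.starProjection_eq_self_iff.2 h1,
    (Submodule.starProjection_apply_eq_zero_iff _).2 h2, add_zero]

end Cramer

/-! ### Generic independence under sparsity -/

section GeneralPosition

open scoped ContDiff

variable {V : Type*} [Fintype V] {d : ℕ}

lemma perpProj_of_mem {N : Finset V} {x : V → Euc d} {z : Euc d} (h : z ∈ perp N x) :
    perpProj N x z = z := Submodule.starProjection_eq_self_iff.2 h

lemma perpProj_smul (N : Finset V) (x : V → Euc d) (c : ℝ) (z : Euc d) :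
    perpProj N x (c • z) = c • perpProj N x z := map_smul _ _ _

lemma perpProj_smul_family (N : Finset V) (x : V → Euc d) {c : V → ℝ} (hc : ∀ v ∈ N, c v ≠ 0)
    (z : Euc d) : perpProj N (fun v => c v • x v) z = perpProj N x z := by
  have : perp N (fun v => c v • x v) = perp N x := by
    ext w
    rw [mem_perp, mem_perp]
    refine forall₂_congr fun u hu => ?_
    rw [inner_smul_left, mul_eq_zero]
    simp [hc u hu]
  simp only [perpProj, this]

lemma linearIndependent_smul_iff {ι F : Type*} [AddCommGroup F] [Module ℝ F] {w : ι → F}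
    {c : ι → ℝ} (hc : ∀ i, c i ≠ 0) :
    LinearIndependent ℝ (fun i => c i • w i) ↔ LinearIndependent ℝ w := by
  have := LinearIndependent.units_smul_iff (R := ℝ) (v := w) (w := fun i => Units.mk0 (c i) (hc i))
  rw [← this]
  rfl

lemma linearIndependent_of_eq {ι F : Type*} [AddCommGroup F] [Module ℝ F] {w w' : ι → F}
    (h : ∀ i, w i = w' i) (hw : LinearIndependent ℝ w) : LinearIndependent ℝ w' :=
  funext h ▸ hw

lemma linearIndependent_single {ι : Type*} {e : ι → Fin d} (he : Function.Injective e) :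
    LinearIndependent ℝ fun i => (EuclideanSpace.single (e i) (1 : ℝ) : Euc d) := by
  have := ((EuclideanSpace.basisFun (Fin d) ℝ).orthonormal.comp e he).linearIndependent
  have h : (EuclideanSpace.basisFun (Fin d) ℝ : Fin d → Euc d) ∘ e =
      fun i => EuclideanSpace.single (e i) (1 : ℝ) := funext fun i => by simp
  rwa [h] at this

/-- Some choice of vectors orthogonal to the given families makes the family of vectors with
indices in `T` independent. -/
def Extendable (B : Finset V) (N : V → Finset V) (T : Finset V) (x : V → Euc d) : Prop :=
  ∃ z : V → Euc d,
    LinearIndependent ℝ fun i : T => if (i : V) ∈ B then perpProj (N i) x (z i) else x i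

/-- Erase from the vector of `a` the coordinates of the nodes of `C` with `a` in their sets. -/
noncomputable def maskCoords (N : V → Finset V) {T : Finset V} (C : Finset T) (e : T → Fin d)
    (y : V → Euc d) (a : V) : Euc d :=
  WithLp.toLp 2 fun i => if ∃ t ∈ C, a ∈ N t ∧ e t = i then 0 else y a i

lemma contDiff_maskCoords (N : V → Finset V) {T : Finset V} (C : Finset T) (e : T → Fin d)
    (a : V) : ContDiff ℝ ω fun y : V → Euc d => maskCoords N C e y a := by
  rw [contDiff_euclidean]
  intro i
  by_cases h : ∃ t ∈ C, a ∈ N t ∧ e t = i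
  · simp only [maskCoords, if_pos h]
    exact contDiff_const
  · simp only [maskCoords, if_neg h]
    exact contDiff_euclidean.1 (contDiff_apply ℝ (Euc d) a) i

lemma maskCoords_eq_single (N : V → Finset V) {T : Finset V} {C : Finset T} {e : T → Fin d}
    {y : V → Euc d} {a : V} {j : Fin d} (hy : y a = EuclideanSpace.single j 1)
    (hj : ∀ t ∈ C, a ∈ N t → e t ≠ j) : maskCoords N C e y a = EuclideanSpace.single j 1 := by
  ext i
  change (if ∃ t ∈ C, a ∈ N t ∧ e t = i then 0 else y a i) = _
  split_ifs with h
  · obtain ⟨t, ht, hat, rfl⟩ := h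
    simp [hj t ht hat]
  · rw [hy]

/-- A transversal of the unmasked coordinates. -/
lemma exists_unmasked {B : Finset V} {N : V → Finset V}
    (hK : ∀ J C : Finset V, J.Nonempty → C.Nonempty → C ⊆ B → (∀ v ∈ C, J ⊆ N v) →
      J.card + C.card ≤ d) {T : Finset V} {C : Finset T} (hC : ∀ t ∈ C, (t : V) ∈ B)
    {e : T → Fin d} (he : Function.Injective e) {t : T} (ht : t ∈ C) :
    ∃ ψ : N t → Fin d, Function.Injective ψ ∧ ∀ u : N t, ∀ s ∈ C, (u : V) ∈ N s → e s ≠ ψ u := by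
  -- Hall's theorem: each `u` in `N t` is to receive its own coordinate among those not masked for
  -- it.
  have h := (Finset.all_card_le_biUnion_card_iff_exists_injective
    (fun u : N t => ((C.filter fun s : T => (u : V) ∈ N s).image e)ᶜ)).1 ?_
  · obtain ⟨ψ, hψ, hψ'⟩ := h
    refine ⟨ψ, hψ, fun u s hs hus heq => ?_⟩
    have := hψ' u
    rw [Finset.mem_compl] at this
    exact this (Finset.mem_image.2 ⟨s, by simp [hs, hus], heq⟩)
  · intro J
    rcases J.eq_empty_or_nonempty with rfl | hJ
    · simp
    -- A coordinate masked for all of `J` is `e s` for a single `s`, as `e` is injective, so it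
    -- comes from `C'`. `J` and `C'` span a complete bipartite pattern, so `|J| ≤ d - |C'|`, which
    -- is Hall's condition.
    set C' : Finset T := C.filter fun s => ∀ u ∈ J, (u : V) ∈ N s with hC'
    have h1 : (C'.image e)ᶜ ⊆ J.biUnion fun u : N t =>
        ((C.filter fun s : T => (u : V) ∈ N s).image e)ᶜ := by
      intro i hi
      by_contra hcon
      apply Finset.mem_compl.1 hi
      simp only [Finset.mem_biUnion, Finset.mem_compl, not_exists, not_and, not_not] at hcon
      obtain ⟨u₀, hu₀⟩ := hJ
      obtain ⟨s, hs, rfl⟩ := Finset.mem_image.1 (hcon u₀ hu₀)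
      refine Finset.mem_image.2 ⟨s, ?_, rfl⟩
      refine Finset.mem_filter.2 ⟨(Finset.mem_filter.1 hs).1, fun u hu => ?_⟩
      obtain ⟨s', hs', h⟩ := Finset.mem_image.1 (hcon u hu)
      rw [← he h]
      exact (Finset.mem_filter.1 hs').2
    refine le_trans ?_ (Finset.card_le_card h1)
    rw [Finset.card_compl, Fintype.card_fin, Finset.card_image_of_injective _ he]
    have h2 := hK (J.map (Function.Embedding.subtype _)) (C'.map (Function.Embedding.subtype _))
      (hJ.map) ⟨t, Finset.mem_map.2 ⟨t, Finset.mem_filter.2 ⟨ht, fun u _ => u.2⟩, rfl⟩⟩ ?_ ?_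
    · rw [Finset.card_map, Finset.card_map] at h2
      omega
    · intro v hv
      obtain ⟨s, hs, rfl⟩ := Finset.mem_map.1 hv
      exact hC s (Finset.mem_filter.1 hs).1
    · intro v hv u hu
      obtain ⟨s, hs, rfl⟩ := Finset.mem_map.1 hv
      obtain ⟨u', hu', rfl⟩ := Finset.mem_map.1 hu
      exact (Finset.mem_filter.1 hs).2 u' hu'

lemma ae_linearIndependent {N : Finset V} (hN : N.card ≤ d) :
    ∀ᵐ z ∂Measure.pi fun _ : V => ballMeasure (Euc d), LinearIndependent ℝ fun u : N => z u := by
  obtain ⟨e⟩ : Nonempty (N ↪ Fin d) := by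
    rw [Function.Embedding.nonempty_iff_card_le]
    simpa using hN
  have hf : ContDiff ℝ ω fun z : V → Euc d => (Matrix.gram ℝ fun u : N => z u).det :=
    contDiff_gram_det fun u => contDiff_apply ℝ (Euc d) (u : V)
  refine (ae_pi_ballMeasure hf (w := fun v : V => if h : v ∈ N then
    (EuclideanSpace.single (e ⟨v, h⟩) 1 : Euc d) else 0) ?_).mono
    fun z hz => gram_det_ne_zero_iff.1 hz
  rw [gram_det_ne_zero_iff]
  exact linearIndependent_of_eq (fun u => by simp) (linearIndependent_single e.injective)

/-- Nodes of `T` get distinct coordinate axes. Masking the axis of `t` in the vectors of `N t` makes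
them orthogonal to that axis; a generic choice of the remaining coordinates gives the independence
statements. -/
lemma exists_masked_independent {B : Finset V} {N : V → Finset V}
    (hK : ∀ J C : Finset V, J.Nonempty → C.Nonempty → C ⊆ B → (∀ v ∈ C, J ⊆ N v) →
      J.card + C.card ≤ d) {T : Finset V}
    {C : Finset T} (hC : ∀ t, t ∈ C ↔ (t : V) ∈ B)
    {e : T → Fin d} (he : Function.Injective e) :
    ∃ x : V → Euc d,
      (∀ t ∈ C, perpProj (N t) x (EuclideanSpace.single (e t) 1) =
        EuclideanSpace.single (e t) 1) ∧
      (∀ t ∈ C, LinearIndependent ℝ fun u : N t => x u) ∧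
      LinearIndependent ℝ fun i : T =>
        if (i : V) ∈ B then (EuclideanSpace.single (e i) 1 : Euc d) else x i := by
  have hf : ∀ t : T, ContDiff ℝ ω fun y : V → Euc d =>
      (Matrix.gram ℝ fun u : N t => maskCoords N C e y u).det :=
    fun t => contDiff_gram_det fun u => contDiff_maskCoords N C e u
  have hf₀ : ContDiff ℝ ω fun y : V → Euc d => (Matrix.gram ℝ fun i : T =>
      if (i : V) ∈ B then (EuclideanSpace.single (e i) 1 : Euc d)
      else maskCoords N C e y i).det := by
    refine contDiff_gram_det fun i => ?_
    split_ifs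
    · exact contDiff_const
    · exact contDiff_maskCoords N C e i
  have h : ∀ t : T, ∀ᵐ y ∂Measure.pi fun _ : V => ballMeasure (Euc d), t ∈ C →
      (Matrix.gram ℝ fun u : N t => maskCoords N C e y u).det ≠ 0 := by
    intro t
    by_cases ht : t ∈ C
    swap
    · exact Eventually.of_forall fun y h => absurd h ht
    obtain ⟨ψ, hψ, hψC⟩ := exists_unmasked hK (fun t ht => (hC t).1 ht) he ht
    refine (ae_pi_ballMeasure (hf t) (w := fun v : V => if h : v ∈ N t then
      (EuclideanSpace.single (ψ ⟨v, h⟩) 1 : Euc d) else 0) ?_).mono fun y hy _ => hy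
    rw [gram_det_ne_zero_iff]
    refine linearIndependent_of_eq (fun u => ?_) (linearIndependent_single hψ)
    exact (maskCoords_eq_single N (by simp) (hψC u)).symm
  have h₀ : ∀ᵐ y ∂Measure.pi fun _ : V => ballMeasure (Euc d), (Matrix.gram ℝ fun i : T =>
      if (i : V) ∈ B then (EuclideanSpace.single (e i) 1 : Euc d)
      else maskCoords N C e y i).det ≠ 0 := by
    refine ae_pi_ballMeasure hf₀ (w := fun v : V => if h : v ∈ T then
      (EuclideanSpace.single (e ⟨v, h⟩) 1 : Euc d) else 0) ?_
    rw [gram_det_ne_zero_iff]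
    refine linearIndependent_of_eq (fun i => ?_) (linearIndependent_single he)
    split_ifs with hi
    · rfl
    · refine (maskCoords_eq_single N (by simp) fun t ht hit heq => hi ?_).symm
      rw [← he heq]
      exact (hC t).1 ht
  -- Each determinant has its own witness of nonvanishing; genericity gives one `y` that serves for
  -- all of them.
  obtain ⟨y, hy, hy₀⟩ := ((ae_all_iff.2 h).and h₀).exists
  refine ⟨maskCoords N C e y, fun t ht => perpProj_of_mem (mem_perp.2 fun u hu => ?_),
    fun t ht => gram_det_ne_zero_iff.1 (hy t ht), gram_det_ne_zero_iff.1 hy₀⟩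
  have h' : ∃ s ∈ C, u ∈ N s ∧ e s = e t := ⟨t, ht, hu, rfl⟩
  rw [EuclideanSpace.inner_single_right]
  simp only [maskCoords, if_pos h', map_zero, mul_zero]

lemma ae_extendable {B : Finset V} {N : V → Finset V}
    (hK : ∀ J C : Finset V, J.Nonempty → C.Nonempty → C ⊆ B → (∀ v ∈ C, J ⊆ N v) →
      J.card + C.card ≤ d) {T : Finset V} (hT : T.card ≤ d) :
    ∀ᵐ x ∂Measure.pi fun _ : V => ballMeasure (Euc d), Extendable B N T x := by
  obtain ⟨e⟩ : Nonempty (T ↪ Fin d) := by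
    rw [Function.Embedding.nonempty_iff_card_le]
    simpa using hT
  obtain ⟨w, hw1, hw2, hw3⟩ := exists_masked_independent hK
    (C := Finset.univ.filter fun t : T => (t : V) ∈ B) (by simp) e.injective
  have hf : ContDiff ℝ ω fun x : V → Euc d => (Matrix.gram ℝ fun i : T =>
      if (i : V) ∈ B then scaledProj (N i) x (EuclideanSpace.single (e i) 1) else x i).det := by
    refine contDiff_gram_det fun i => ?_
    split_ifs
    · exact contDiff_scaledProj _ _
    · exact contDiff_apply ℝ (Euc d) (i : V)
  refine (ae_pi_ballMeasure hf (w := w) ?_).mono fun x hx => ?_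
  swap
  -- The Gram determinant is put into `z`, so that projecting gives exactly `scaledProj`.
  · refine ⟨fun v => if h : v ∈ T then (Matrix.gram ℝ fun u : N v => x u).det •
      (EuclideanSpace.single (e ⟨v, h⟩) 1 : Euc d) else 0, ?_⟩
    refine linearIndependent_of_eq (fun i => ?_) (gram_det_ne_zero_iff.1 hx)
    split_ifs with h
    · simp [scaledProj_eq, perpProj_smul]
    · rfl
  · rw [gram_det_ne_zero_iff]
    have hc : ∀ i : T, (if (i : V) ∈ B then (Matrix.gram ℝ fun u : N i => w u).det else 1) ≠ 0 := by
      intro i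
      split_ifs with h
      · exact gram_det_ne_zero_iff.2 (hw2 i (by simpa using h))
      · exact one_ne_zero
    refine linearIndependent_of_eq (fun i => ?_)
      ((linearIndependent_smul_iff hc).2 hw3)
    split_ifs with h
    · rw [scaledProj_eq, hw1 i (by simpa using h)]
    · rw [one_smul]

/-- Almost every choice of vectors orthogonal to the given families is independent. -/
lemma Extendable.ae {B : Finset V} {N : V → Finset V} {T : Finset V} {x : V → Euc d}
    (h : Extendable B N T x) :
    ∀ᵐ z ∂Measure.pi fun _ : V => ballMeasure (Euc d),
      LinearIndependent ℝ fun i : T => if (i : V) ∈ B then perpProj (N i) x (z i) else x i := by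
  obtain ⟨w, hw⟩ := h
  have hf : ContDiff ℝ ω fun z : V → Euc d => (Matrix.gram ℝ fun i : T =>
      if (i : V) ∈ B then perpProj (N i) x (z i) else x i).det := by
    refine contDiff_gram_det fun i => ?_
    split_ifs
    · exact (perp (N i) x).starProjection.contDiff.comp (contDiff_apply ℝ (Euc d) (i : V))
    · exact contDiff_const
  filter_upwards [ae_pi_ballMeasure hf (gram_det_ne_zero_iff.2 hw)] with z hz
  exact gram_det_ne_zero_iff.1 hz

/-- Used to pass from points of the ball to their radial projections. -/
lemma Extendable.smul {B : Finset V} {N : V → Finset V} {T : Finset V} {x : V → Euc d}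
    (h : Extendable B N T x) {c : V → ℝ} (hc : ∀ v, c v ≠ 0) :
    Extendable B N T fun v => c v • x v := by
  obtain ⟨z, hz⟩ := h
  refine ⟨z, ?_⟩
  have hc' : ∀ i : T, (if (i : V) ∈ B then 1 else c i) ≠ 0 := by
    intro i
    split_ifs
    · exact one_ne_zero
    · exact hc i
  refine linearIndependent_of_eq (fun i => ?_)
    ((linearIndependent_smul_iff hc').2 hz)
  split_ifs with h
  · rw [perpProj_smul_family _ _ (fun v _ => hc v), one_smul]
  · rfl

end GeneralPosition

/-! ### Placing an independent set of nodes -/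

section Bipartite

variable {V : Type*} [Fintype V] {d : ℕ} {G : SimpleGraph V}

lemma iter_congr {S : Finset V} {l : List V} (hS : ∀ v ∈ l, v ∉ S)
    (hind : ∀ u ∈ l, ∀ v ∈ l, ¬ G.Adj u v) {g : (V → Euc d) → ℝ≥0∞}
    (hl : l.Nodup) {x y : V → Euc d} (h : ∀ v ∉ l, x v = y v) : iter G S l g x = iter G S l g y := by
  induction l generalizing S x y with
  | nil => exact congrArg g (funext fun v => h v (by simp))
  | cons v l ih =>
    have hN : ∀ u ∈ nbrsIn G S v, x u = y u := fun u hu =>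
      h u fun hu' => hS u hu' (nbrsIn_subset S v hu)
    have hp : perp (nbrsIn G S v) x = perp (nbrsIn G S v) y := perp_congr hN
    simp only [iter, perpAvg, weight_congr hN, hp]
    congr 1
    refine lintegral_congr fun z => ?_
    refine ih (notMem_insert_of_nodup_cons hl hS)
      (fun a ha b hb => hind a (by simp [ha]) b (by simp [hb])) hl.of_cons fun w hw => ?_
    rcases eq_or_ne w v with rfl | hwv
    · simp
    · simp only [Function.update_of_ne hwv]
      exact h w (by simp [hw, hwv])

lemma slab_empty (x : V → Euc d) (ε : ℝ) : slab ∅ x ε = univ := by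
  simp [slab]

lemma slab_congr {N : Finset V} {x y : V → Euc d} (h : ∀ u ∈ N, x u = y u) (ε : ℝ) :
    slab N x ε = slab N y ε := by
  ext z
  simp only [slab, mem_ofPred_eq]
  exact forall₂_congr fun u hu => by rw [h u hu]

/-- Nodes without placed neighbors have weight `1` and uniform vectors, so the iterated average is a
plain marginal. -/
lemma iter_append_of_independent (hd : 0 < d) (hdeg : ∀ S v, (nbrsIn G S v).card < d)
    {S : Finset V} {l l' : List V} (hl : l.Nodup) (hS : ∀ v ∈ l, nbrsIn G S v = ∅)
    (hind : ∀ u ∈ l, ∀ v ∈ l, ¬ G.Adj u v) {g : (V → Euc d) → ℝ≥0∞} (hg : Measurable g)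
    (x : V → Euc d) :
    iter G S (l ++ l') g x =
      (∫⋯∫⁻_l.toFinset, iter G (l.toFinset ∪ S) l' g ∂fun _ => sphereLaw d) x := by
  induction l generalizing S x with
  | nil => simp
  | cons v l ih =>
    have hv := hS v (by simp)
    have h1 : ∀ w ∈ l, nbrsIn G (insert v S) w = ∅ := by
      intro w hw
      have := hS w (by simp [hw])
      rw [nbrsIn, Finset.filter_insert, if_neg (hind v (by simp) w (by simp [hw]))]
      exact this
    have h2 : iter G S (v :: l ++ l') g x = ∫⁻ y, iter G (insert v S) (l ++ l') g
        (Function.update x v y) ∂sphereLaw d := by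
      rw [List.cons_append, iter, hv]
      simp only [weight_empty, one_mul, perpAvg, sphereUniform_perp_empty hd]
    rw [h2, List.toFinset_cons, lmarginal_insert _ (measurable_iter hdeg _ _ hg)
      (by simpa using (List.nodup_cons.1 hl).1)]
    refine lintegral_congr fun y => ?_
    rw [ih hl.of_cons h1 (fun a ha b hb => hind a (by simp [ha]) b (by simp [hb])),
      Finset.insert_union, Finset.union_insert]

lemma slabAvg_empty (v : V) (ε : ℝ) (h : (V → Euc d) → ℝ≥0∞) (x : V → Euc d) :
    slabAvg ∅ v ε h x = ∫⁻ y, h (Function.update x v y) ∂sphereLaw d := by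
  simp [slabAvg, slab_empty]

lemma slabIter_append_of_independent (ε : ℝ)
    {S : Finset V} {l l' : List V} (hl : l.Nodup) (hS : ∀ v ∈ l, nbrsIn G S v = ∅)
    (hind : ∀ u ∈ l, ∀ v ∈ l, ¬ G.Adj u v) {g : (V → Euc d) → ℝ≥0∞} (hg : Measurable g)
    (x : V → Euc d) :
    slabIter G ε S (l ++ l') g x =
      (∫⋯∫⁻_l.toFinset, slabIter G ε (l.toFinset ∪ S) l' g ∂fun _ => sphereLaw d) x := by
  induction l generalizing S x with
  | nil => simp
  | cons v l ih =>
    have hv := hS v (by simp)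
    have h1 : ∀ w ∈ l, nbrsIn G (insert v S) w = ∅ := by
      intro w hw
      have := hS w (by simp [hw])
      rw [nbrsIn, Finset.filter_insert, if_neg (hind v (by simp) w (by simp [hw]))]
      exact this
    rw [List.cons_append, slabIter, hv, slabAvg_empty,
      List.toFinset_cons, lmarginal_insert _ (measurable_slabIter ε _ _ hg)
      (by simpa using (List.nodup_cons.1 hl).1)]
    refine lintegral_congr fun y => ?_
    rw [ih hl.of_cons h1 (fun a ha b hb => hind a (by simp [ha]) b (by simp [hb])),
      Finset.insert_union, Finset.union_insert]

lemma lmarginal_eq_lintegral {Ω : Type*} [MeasurableSpace Ω] (ν : Measure Ω)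
    [IsProbabilityMeasure ν] {A : Finset V} {F : (V → Ω) → ℝ≥0∞} (hF : Measurable F)
    (h : ∀ x y : V → Ω, (∀ v ∈ A, x v = y v) → F x = F y) (x : V → Ω) :
    (∫⋯∫⁻_A, F ∂fun _ => ν) x = ∫⁻ y, F y ∂Measure.pi fun _ => ν := by
  have h1 : (∫⋯∫⁻_Aᶜ, F ∂fun _ => ν) = F := by
    funext y
    rw [lmarginal]
    have : ∀ z, F (Function.updateFinset y Aᶜ z) = F y := fun z => h _ _ fun v hv => by
      simp [Function.updateFinset, hv]
    simp [this]
  rw [lintegral_eq_lmarginal_univ x, ← Finset.union_compl A,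
    lmarginal_union (μ := fun _ => ν) F hF disjoint_compl_right, h1]

lemma measurable_update_swap {Ω : Type*} [MeasurableSpace Ω] (v : V) :
    Measurable fun q : Ω × (V → Ω) => Function.update q.2 v q.1 := by
  refine measurable_pi_lambda _ fun w => ?_
  rcases eq_or_ne w v with rfl | h
  · simpa using measurable_fst
  · simp only [Function.update_of_ne h]
    exact (measurable_pi_apply w).comp measurable_snd

lemma lintegral_lintegral_update {Ω : Type*} [MeasurableSpace Ω] (ν : Measure Ω)
    [IsProbabilityMeasure ν] (v : V) {F : (V → Ω) → ℝ≥0∞} (hF : Measurable F) :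
    ∫⁻ y, ∫⁻ z, F (Function.update z v y) ∂(Measure.pi fun _ : V => ν) ∂ν =
      ∫⁻ z, F z ∂Measure.pi fun _ : V => ν := by
  have hm := measurable_update_swap (Ω := Ω) v
  rw [lintegral_lintegral_swap (f := fun y z => F (Function.update z v y))
    (hF.comp hm).aemeasurable]
  refine lintegral_eq_of_lmarginal_eq {v} ?_ hF ?_
  · exact Measurable.lintegral_prod_left' (f := fun q : Ω × (V → Ω) =>
      F (Function.update q.2 v q.1)) (hF.comp hm)
  · funext x
    simp [lmarginal_singleton]

/-- The neighbors of `v`. -/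
noncomputable abbrev nbrs (G : SimpleGraph V) (v : V) : Finset V := nbrsIn G Finset.univ v

lemma nbrsIn_eq_nbrs {S : Finset V} {v : V} (h : nbrs G v ⊆ S) : nbrsIn G S v = nbrs G v := by
  ext u
  refine ⟨fun hu => ?_, fun hu => ?_⟩
  · simpa [mem_nbrsIn] using (mem_nbrsIn.1 hu).2
  · exact mem_nbrsIn.2 ⟨h hu, (mem_nbrsIn.1 hu).2⟩

/-- Replace the vectors of the nodes of a list by normalized projections. -/
noncomputable def fill (G : SimpleGraph V) (l : List V) (x z : V → Euc d) (v : V) : Euc d :=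
  if v ∈ l then normalize (perpProj (nbrs G v) x (z v)) else x v

lemma measurable_fill (l : List V) (x : V → Euc d) : Measurable (fill G l x) := by
  refine measurable_pi_lambda _ fun v => ?_
  unfold fill
  split_ifs
  · exact (measurable_normalize_perpProj _ x).comp (measurable_pi_apply v)
  · exact measurable_const

lemma fill_update {v : V} {l : List V} (hv : v ∉ l) (hl : ∀ w ∈ l, v ∉ nbrs G w)
    (x z : V → Euc d) (y : Euc d) :
    fill G l (Function.update x v (normalize (perpProj (nbrs G v) x y))) z =
      fill G (v :: l) x (Function.update z v y) := by
  funext w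
  rcases eq_or_ne w v with rfl | hwv
  · simp [fill, hv]
  · by_cases hw : w ∈ l
    · simp [fill, hw, hwv, perpProj, perp_update (hl w hw)]
    · simp [fill, hw, hwv]

/-- Once `A` is fixed, the remaining choices do not interact: the weights factor out and the vectors
are normalized projections of independent ball points. -/
lemma iter_eq_lintegral_fill (hdeg : ∀ S v, (nbrsIn G S v).card < d) {A S : Finset V}
    (hAS : A ⊆ S) {l : List V} (hl : l.Nodup) (hA : ∀ v ∈ l, v ∉ A)
    (hN : ∀ v ∈ l, nbrs G v ⊆ A) {g : (V → Euc d) → ℝ≥0∞} (hg : Measurable g) (x : V → Euc d) :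
    iter G S l g x = (∏ v ∈ l.toFinset, weight (nbrs G v) x) *
      ∫⁻ z, g (fill G l x z) ∂Measure.pi fun _ => ballMeasure (Euc d) := by
  induction l generalizing S x with
  | nil =>
    have h : ∀ z, fill G [] x z = x := fun z => funext fun v => by simp [fill]
    simp [iter, h]
  | cons v l ih =>
    have hv : v ∉ A := hA v (by simp)
    have hvl := (List.nodup_cons.1 hl).1
    have hvN : ∀ w ∈ l, v ∉ nbrs G w := fun w hw h => hv (hN w (by simp [hw]) h)
    have h0 : iter G S (v :: l) g x = weight (nbrs G v) x *
        ∫⁻ y, iter G (insert v S) l g (Function.update x v (normalize (perpProj (nbrs G v) x y)))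
          ∂ballMeasure (Euc d) := by
      rw [iter, nbrsIn_eq_nbrs ((hN v (by simp)).trans hAS),
        ← perpAvg_eq (hdeg _ _) v (measurable_iter hdeg _ _ hg)]
    have h1 : ∀ y : Euc d, iter G (insert v S) l g
        (Function.update x v (normalize (perpProj (nbrs G v) x y))) =
        (∏ w ∈ l.toFinset, weight (nbrs G w) x) *
          ∫⁻ z, g (fill G (v :: l) x (Function.update z v y))
            ∂Measure.pi fun _ => ballMeasure (Euc d) := by
      intro y
      rw [ih (hAS.trans (Finset.subset_insert _ _)) hl.of_cons (fun w hw => hA w (by simp [hw]))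
        (fun w hw => hN w (by simp [hw]))]
      congr 1
      · refine Finset.prod_congr rfl fun w hw => weight_congr fun u hu => ?_
        exact Function.update_of_ne (fun h : u = v => hvN w (by simpa using hw) (h ▸ hu)) _ _
      · exact lintegral_congr fun z => by rw [fill_update hvl hvN]
    have hgm := hg.comp (measurable_fill (G := G) (v :: l) x)
    have hm := measurable_update_swap (Ω := Euc d) v
    simp_rw [h0, h1]
    rw [lintegral_const_mul, lintegral_lintegral_update (ballMeasure (Euc d)) v
      (F := fun z => g (fill G (v :: l) x z)) hgm,
      List.toFinset_cons, Finset.prod_insert (by simpa using hvl), mul_assoc]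
    exact (hgm.comp hm).lintegral_prod_right'

lemma slabAvg_congr {N : Finset V} {v : V} {ε : ℝ} {x y : V → Euc d}
    (h : ∀ u ∈ N, x u = y u) : slabAvg N v ε 1 x = slabAvg N v ε 1 y := by
  simp only [slabAvg, slab_congr h]
  rfl

lemma slabIter_one_eq_prod (ε : ℝ) {A S : Finset V} (hAS : A ⊆ S) {l : List V} (hl : l.Nodup)
    (hA : ∀ v ∈ l, v ∉ A) (hN : ∀ v ∈ l, nbrs G v ⊆ A) (x : V → Euc d) :
    slabIter G ε S l 1 x = ∏ v ∈ l.toFinset, slabAvg (nbrs G v) v ε 1 x := by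
  induction l generalizing S x with
  | nil => simp [slabIter]
  | cons v l ih =>
    have hv : v ∉ A := hA v (by simp)
    have hvl := (List.nodup_cons.1 hl).1
    rw [slabIter, nbrsIn_eq_nbrs ((hN v (by simp)).trans hAS), List.toFinset_cons,
      Finset.prod_insert (by simpa using hvl)]
    have h1 : ∀ y : Euc d, slabIter G ε (insert v S) l 1 (Function.update x v y) =
        ∏ w ∈ l.toFinset, slabAvg (nbrs G w) w ε 1 x := by
      intro y
      rw [ih (hAS.trans (Finset.subset_insert _ _)) hl.of_cons (fun w hw => hA w (by simp [hw]))
        (fun w hw => hN w (by simp [hw]))]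
      refine Finset.prod_congr rfl fun w hw => slabAvg_congr fun u hu => ?_
      have hw' : w ∈ l := by simpa using hw
      exact Function.update_of_ne (fun h : u = v => hv (hN w (by simp [hw']) (h ▸ hu))) _ _
    simp only [slabAvg, h1]
    rw [mul_assoc]
    congr 1
    rw [lintegral_indicator_const (measurableSet_slab _ _ _)]
    simp only [Pi.one_apply]
    rw [lintegral_indicator_const (measurableSet_slab _ _ _), one_mul, mul_comm]

end Bipartite

/-! ### The density as an expectation over one color class -/

section BipartiteDensity

variable {V : Type*} [Fintype V] {d : ℕ} {G : SimpleGraph V} {A : Finset V}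

lemma nbrs_subset_of_notMem (hB : ∀ u ∉ A, ∀ v ∉ A, ¬ G.Adj u v) {v : V} (hv : v ∉ A) :
    nbrs G v ⊆ A := fun u hu => by
  by_contra h
  exact hB u h v hv (mem_nbrsIn.1 hu).2

lemma iter_eq_lintegral_iter (hA : ∀ u ∈ A, ∀ v ∈ A, ¬ G.Adj u v)
    (hB : ∀ u ∉ A, ∀ v ∉ A, ¬ G.Adj u v) (hd : 0 < d) (hdeg : ∀ S v, (nbrsIn G S v).card < d)
    {g : (V → Euc d) → ℝ≥0∞} (hg : Measurable g) (x : V → Euc d) :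
    iter G ∅ (A.toList ++ Aᶜ.toList) g x =
      ∫⁻ y, iter G A Aᶜ.toList g y ∂Measure.pi fun _ => sphereLaw d := by
  rw [iter_append_of_independent hd hdeg A.nodup_toList (fun v _ => by simp [nbrsIn])
    (fun u hu v hv => hA u (by simpa using hu) v (by simpa using hv)) hg, Finset.toList_toFinset,
    Finset.union_empty]
  refine lmarginal_eq_lintegral _ (measurable_iter hdeg _ _ hg) (fun y z h => ?_) x
  refine iter_congr (fun v hv => by simpa using hv) (fun u hu v hv => hB u (by simpa using hu) v
    (by simpa using hv)) (Finset.nodup_toList _) fun v hv => h v (by simpa using hv)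

lemma slabIter_one_eq_lintegral (hA : ∀ u ∈ A, ∀ v ∈ A, ¬ G.Adj u v)
    (hB : ∀ u ∉ A, ∀ v ∉ A, ¬ G.Adj u v) (ε : ℝ) (x : V → Euc d) :
    slabIter G ε ∅ (A.toList ++ Aᶜ.toList) 1 x =
      ∫⁻ y, ∏ v ∈ Aᶜ, slabAvg (nbrs G v) v ε 1 y ∂Measure.pi fun _ => sphereLaw d := by
  rw [slabIter_append_of_independent ε A.nodup_toList (fun v _ => by simp [nbrsIn])
    (fun u hu v hv => hA u (by simpa using hu) v (by simpa using hv)) measurable_one,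
    Finset.toList_toFinset, Finset.union_empty]
  have e : slabIter G ε A Aᶜ.toList 1 =
      fun y : V → Euc d => ∏ v ∈ Aᶜ, slabAvg (nbrs G v) v ε 1 y := funext fun y => by
    rw [slabIter_one_eq_prod ε subset_rfl (Finset.nodup_toList _) (fun v hv => by simpa using hv)
      (fun v hv => nbrs_subset_of_notMem hB (by simpa using hv)), Finset.toList_toFinset]
  rw [e]
  refine lmarginal_eq_lintegral _ ?_ (fun y z h => ?_) x
  · exact Finset.measurable_fun_prod _ fun v _ => measurable_slabAvg _ v ε measurable_one
  · refine Finset.prod_congr rfl fun v hv => slabAvg_congr fun u hu => h u ?_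
    exact nbrs_subset_of_notMem hB (by simpa using hv) hu

lemma ae_pi_sphereLaw_linearIndependent {N : Finset V} (hN : N.card ≤ d) :
    ∀ᵐ x ∂Measure.pi fun _ : V => sphereLaw d, LinearIndependent ℝ fun u : N => x u := by
  have hm : MeasurableSet {x : V → Euc d | LinearIndependent ℝ fun u : N => x u} := by
    simp_rw [← gramDet_pos_iff]
    exact (continuous_gramDet N).measurable measurableSet_Ioi
  have hn : Measurable fun (z : V → Euc d) v => normalize (z v) :=
    measurable_pi_lambda _ fun v => measurable_normalize.comp (measurable_pi_apply v)
  rw [pi_sphereLaw, ae_map_iff hn.aemeasurable hm]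
  filter_upwards [ae_linearIndependent hN] with z hz
  exact (linearIndependent_smul_iff
    fun i => inv_ne_zero (norm_ne_zero_iff.2 (hz.ne_zero i))).2 hz

/-- Almost all maps are in general position, when the vectors of the nodes outside of `A` are
chosen after those in `A`. -/
lemma ae_fill_mem_independentMaps (hd : 0 < d)
    (hK : ∀ J C : Finset V, J.Nonempty → C.Nonempty → C ⊆ Aᶜ → (∀ v ∈ C, J ⊆ nbrs G v) →
      J.card + C.card ≤ d) :
    ∀ᵐ x ∂Measure.pi fun _ : V => ballMeasure (Euc d),
      ∀ᵐ z ∂Measure.pi fun _ : V => ballMeasure (Euc d),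
        fill G Aᶜ.toList (fun v => normalize (x v)) z ∈ independentMaps V d := by
  have h0 : ∀ᵐ x ∂Measure.pi fun _ : V => ballMeasure (Euc d), ∀ v, x v ≠ 0 := by
    refine ae_all_iff.2 fun v => ?_
    filter_upwards [ae_linearIndependent (N := {v}) (by rw [Finset.card_singleton]; exact hd)] with x hx
    exact hx.ne_zero ⟨v, by simp⟩
  have h1 : ∀ᵐ x ∂Measure.pi fun _ : V => ballMeasure (Euc d), ∀ T : Finset V, T.card ≤ d →
      Extendable Aᶜ (nbrs G) T x := by
    refine ae_all_iff.2 fun T => ?_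
    by_cases hT : T.card ≤ d
    · filter_upwards [ae_extendable hK hT] with x hx _ using hx
    · exact Eventually.of_forall fun x h => absurd h hT
  filter_upwards [h0, h1] with x hx0 hx1
  have h2 : ∀ᵐ z ∂Measure.pi fun _ : V => ballMeasure (Euc d), ∀ T : Finset V, T.card ≤ d →
      LinearIndependent ℝ fun i : T => if (i : V) ∈ Aᶜ then
        perpProj (nbrs G i) (fun v => normalize (x v)) (z i) else normalize (x i) := by
    refine ae_all_iff.2 fun T => ?_
    by_cases hT : T.card ≤ d
    · filter_upwards [((hx1 T hT).smul (c := fun v => ‖x v‖⁻¹)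
        fun v => inv_ne_zero (norm_ne_zero_iff.2 (hx0 v))).ae] with z hz _ using hz
    · exact Eventually.of_forall fun x h => absurd h hT
  filter_upwards [h2] with z hz T hT
  have h3 := hz T hT
  have hc : ∀ i : T, (if (i : V) ∈ Aᶜ then
      ‖perpProj (nbrs G i) (fun v => normalize (x v)) (z i)‖⁻¹ else 1) ≠ 0 := by
    intro i
    have h4 := h3.ne_zero i
    split_ifs with hi
    · rw [if_pos hi] at h4
      exact inv_ne_zero (norm_ne_zero_iff.2 h4)
    · exact one_ne_zero
  refine linearIndependent_of_eq (fun i => ?_) ((linearIndependent_smul_iff hc).2 h3)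
  by_cases hi : (i : V) ∈ Aᶜ
  · simp only [fill, Finset.mem_toList, if_pos hi]
    rfl
  · simp only [fill, Finset.mem_toList, if_neg hi, one_smul]

/-- The indicator is almost surely `1`, so the choices outside `A` integrate to `1` and only the
weights remain. -/
lemma iter_one_independentMaps_eq_lintegral (hA : ∀ u ∈ A, ∀ v ∈ A, ¬ G.Adj u v)
    (hB : ∀ u ∉ A, ∀ v ∉ A, ¬ G.Adj u v) (hd : 0 < d) (hdeg : ∀ S v, (nbrsIn G S v).card < d)
    (hK : ∀ J C : Finset V, J.Nonempty → C.Nonempty → C ⊆ Aᶜ → (∀ v ∈ C, J ⊆ nbrs G v) →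
      J.card + C.card ≤ d) (x : V → Euc d) :
    iter G ∅ (A.toList ++ Aᶜ.toList) ((independentMaps V d).indicator 1) x =
      ∫⁻ y, ∏ v ∈ Aᶜ, weight (nbrs G v) y ∂Measure.pi fun _ => sphereLaw d := by
  have hg : Measurable ((independentMaps V d).indicator (1 : (V → Euc d) → ℝ≥0∞)) :=
    measurable_one.indicator measurableSet_independentMaps
  rw [iter_eq_lintegral_iter hA hB hd hdeg hg, lintegral_pi_sphereLaw (measurable_iter hdeg _ _ hg),
    lintegral_pi_sphereLaw (Finset.measurable_fun_prod _ fun v _ => measurable_weight _)]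
  refine lintegral_congr_ae ?_
  filter_upwards [ae_fill_mem_independentMaps hd hK] with z hz
  rw [iter_eq_lintegral_fill hdeg subset_rfl (Finset.nodup_toList _)
    (fun v hv => by simpa using hv)
    (fun v hv => nbrs_subset_of_notMem hB (by simpa using hv)) hg, Finset.toList_toFinset]
  have h1 : ∫⁻ z', (independentMaps V d).indicator 1
      (fill G Aᶜ.toList (fun v => normalize (z v)) z') ∂Measure.pi (fun _ : V => ballMeasure (Euc d))
      = ∫⁻ _, 1 ∂Measure.pi fun _ : V => ballMeasure (Euc d) := by
    refine lintegral_congr_ae ?_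
    filter_upwards [hz] with z' hz'
    rw [indicator_of_mem hz', Pi.one_apply]
  rw [h1]
  simp

lemma perpAvg_one {N : Finset V} (hN : N.card < d) (v : V) (x : V → Euc d) :
    perpAvg N v 1 x = 1 := by
  rw [perpAvg_eq hN v measurable_one]
  simp

lemma weight_ne_top (N : Finset V) (x : V → Euc d) : weight N x ≠ ∞ := ENNReal.ofReal_ne_top

lemma tendsto_slabAvg_one {N : Finset V} (v : V) (hN : N.card < d) {x : V → Euc d}
    (hx : LinearIndependent ℝ fun i : N => x i) :
    Tendsto (fun ε => slabAvg N v ε 1 x) (𝓝[>] 0) (𝓝 (weight N x)) := by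
  have hlim : ∀ y : V → Euc d, Tendsto (fun _ : ℝ × (V → Euc d) => (1 : ℝ≥0∞))
      (𝓝[>] 0 ×ˢ 𝓝 y) (𝓝 1) := fun y => tendsto_const_nhds
  have h := tendsto_slabAvg (v := v) hN (h := fun _ => (1 : (V → Euc d) → ℝ≥0∞))
    (h₀ := 1) (M := 1) (fun _ => measurable_one) measurable_one ENNReal.one_ne_top
    (fun _ _ _ => le_rfl) hlim hx
  have hp : Tendsto (fun ε : ℝ => (ε, x)) (𝓝[>] 0) (𝓝[>] 0 ×ˢ 𝓝 x) :=
    tendsto_id.prodMk tendsto_const_nhds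
  have h' := h.comp hp
  rwa [perpAvg_one hN v, mul_one] at h'

/-- With constant test function `1` the slab averages outside `A` multiply, and each is at most `d`
times its limit. Under `hfin` the product of these bounds is integrable, which replaces the cutoff.
-/
lemma tendsto_almostMass (hA : ∀ u ∈ A, ∀ v ∈ A, ¬ G.Adj u v)
    (hB : ∀ u ∉ A, ∀ v ∉ A, ¬ G.Adj u v) (hdeg : ∀ S v, (nbrsIn G S v).card < d)
    (hfin : ∫⁻ y, ∏ v ∈ Aᶜ, weight (nbrs G v) y ∂Measure.pi (fun _ => sphereLaw d) ≠ ∞) :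
    Tendsto (fun ε => (ENNReal.ofReal (slabRate d * ε))⁻¹ ^ G.edgeSet.ncard *
        almostMass (d := d) G ε 1) (𝓝[>] 0)
      (𝓝 (∫⁻ y, ∏ v ∈ Aᶜ, weight (nbrs G v) y ∂Measure.pi fun _ => sphereLaw d)) := by
  have e : ∀ ε, (ENNReal.ofReal (slabRate d * ε))⁻¹ ^ G.edgeSet.ncard *
      almostMass (d := d) G ε 1 = ∫⁻ y, ∏ v ∈ Aᶜ, slabAvg (nbrs G v) v ε 1 y
        ∂Measure.pi fun _ => sphereLaw d := by
    intro ε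
    rw [← slabIter_one_eq_lintegral hA hB ε 0, slabIter_empty ε measurable_one]
    · refine List.Nodup.append A.nodup_toList Aᶜ.nodup_toList fun v hv hv' => ?_
      simp at hv hv'
      exact hv' hv
    · intro v
      by_cases hv : v ∈ A <;> simp [hv]
  simp_rw [e]
  have hLI : ∀ᵐ x ∂Measure.pi fun _ : V => sphereLaw d,
      ∀ v, LinearIndependent ℝ fun u : nbrs G v => x u :=
    ae_all_iff.2 fun v => ae_pi_sphereLaw_linearIndependent (hdeg _ v).le
  refine tendsto_lintegral_filter_of_dominated_convergence
    (fun y => ∏ v ∈ Aᶜ, (1 * (d * weight (nbrs G v) y))) ?_ ?_ ?_ ?_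
  · exact Eventually.of_forall fun ε =>
      Finset.measurable_fun_prod _ fun v _ => measurable_slabAvg _ v ε measurable_one
  · filter_upwards [self_mem_nhdsWithin] with ε hε
    filter_upwards [hLI] with x hx
    exact Finset.prod_le_prod' fun v _ =>
      slabAvg_le hε (hdeg _ v) measurable_one (fun _ => le_rfl) (hx v)
  · simp_rw [one_mul, Finset.prod_mul_distrib]
    rw [lintegral_const_mul _ (Finset.measurable_fun_prod _ fun v _ => measurable_weight _)]
    exact ENNReal.mul_ne_top (ENNReal.prod_ne_top fun v _ => ENNReal.natCast_ne_top d) hfin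
  · filter_upwards [hLI] with x hx
    exact ENNReal.tendsto_finsetProd_of_ne_top _
      (fun v _ => tendsto_slabAvg_one v (hdeg Finset.univ v) (hx v)) (fun v _ => weight_ne_top _ _)

lemma almostMass_eq_relDensity (ε : ℝ) : almostMass (d := d) G ε 1 =
    ENNReal.ofReal (relDensity (sphereLaw d) G fun a b => |inner ℝ a b| < ε) := by
  rw [almostMass, lintegral_indicator_one (measurableSet_almostOrtho _ _), relDensity,
    Measure.real, ENNReal.ofReal_toReal (measure_ne_top _ _)]
  congr 1
  ext x
  simp [almostOrtho]

end BipartiteDensity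

/-! ### Sparsity, the single edge, and the conclusion -/

section Final

variable {V : Type*} [Fintype V] {d : ℕ} {G : SimpleGraph V}

lemma IsSparse.card_add_card_le (h : IsSparse G d) {J C : Finset V} (hJ : J.Nonempty)
    (hC : C.Nonempty) (hJC : ∀ u ∈ J, ∀ v ∈ C, G.Adj u v) : J.card + C.card ≤ d := by
  by_contra! hlt
  refine h J.card C.card hJ.card_pos hC.card_pos hlt ⟨⟨⟨Sum.elim
    (fun i => (J.equivFin.symm i : V)) (fun i => (C.equivFin.symm i : V)), ?_⟩, ?_⟩⟩
  · rintro (i | i) (j | j) hij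
    · simp at hij
    · exact hJC _ (J.equivFin.symm i).2 _ (C.equivFin.symm j).2
    · exact (hJC _ (J.equivFin.symm j).2 _ (C.equivFin.symm i).2).symm
    · simp at hij
  · refine Function.Injective.sumElim (Subtype.val_injective.comp J.equivFin.symm.injective)
      (Subtype.val_injective.comp C.equivFin.symm.injective) fun i j hij => ?_
    have := hJC _ (J.equivFin.symm i).2 _ (C.equivFin.symm j).2
    rw [hij] at this
    exact G.loopless.irrefl _ this

lemma IsSparse.card_nbrsIn_lt (h : IsSparse G d) (hd : 0 < d) (S : Finset V) (v : V) :
    (nbrsIn G S v).card < d := by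
  rcases (nbrsIn G S v).eq_empty_or_nonempty with he | hne
  · rwa [he, Finset.card_empty]
  · have := h.card_add_card_le hne (Finset.singleton_nonempty v) fun u hu w hw => by
      rw [Finset.mem_singleton.1 hw]
      exact (mem_nbrsIn.1 hu).2
    simpa using this

lemma weight_singleton_of_norm_eq_one {v : V} {x : V → Euc d} (hx : ‖x v‖ = 1) :
    weight {v} x = 1 := by
  have h : gramDet {v} x = 1 := by
    have : (Matrix.gram ℝ fun i : ({v} : Finset V) => x i).det = 1 := by
      rw [Matrix.det_unique]
      have hv : ∀ i : ({v} : Finset V), (i : V) = v := fun i => Finset.mem_singleton.1 i.2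
      simp [Matrix.gram, hv, hx]
    rw [gramDet, this, Real.sqrt_one]
  rw [weight, sDensity, h]
  have h1 := (sphereArea_pos (d - 2)).ne'
  have h2 : d - 1 - 1 = d - 2 := by omega
  simp [h1, h2]

lemma nbrsIn_top_card_lt (hd : 2 ≤ d) (S : Finset (Fin 2)) (v : Fin 2) :
    (nbrsIn (⊤ : SimpleGraph (Fin 2)) S v).card < d := by
  have : (nbrsIn (⊤ : SimpleGraph (Fin 2)) S v).card < Fintype.card (Fin 2) :=
    Finset.card_lt_univ_of_notMem (notMem_nbrsIn_self S v)
  simp at this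
  omega

lemma ncard_edgeSet_top : (⊤ : SimpleGraph (Fin 2)).edgeSet.ncard = 1 := by
  rw [ncard_eq_toFinset_card']
  have := SimpleGraph.card_edgeFinset_top_eq_card_choose_two (V := Fin 2)
  simpa [SimpleGraph.edgeFinset] using this

/-- The density of edges in the graph of almost orthogonality. -/
lemma tendsto_almostMass_top (hd : 2 ≤ d) :
    Tendsto (fun ε => (ENNReal.ofReal (slabRate d * ε))⁻¹ *
      almostMass (d := d) (⊤ : SimpleGraph (Fin 2)) ε 1) (𝓝[>] 0) (𝓝 1) := by
  have hdeg := nbrsIn_top_card_lt hd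
  have e : ∫⁻ y, ∏ v ∈ ({0} : Finset (Fin 2))ᶜ, weight (nbrs ⊤ v) y
      ∂Measure.pi (fun _ => sphereLaw d) = 1 := by
    have hc : ({0} : Finset (Fin 2))ᶜ = {1} := by decide
    have hn : nbrs (⊤ : SimpleGraph (Fin 2)) 1 = {0} := by
      ext u
      fin_cases u <;> simp [mem_nbrsIn]
    simp_rw [hc, Finset.prod_singleton, hn]
    rw [lintegral_pi_sphereLaw (measurable_weight _)]
    have h1 : ∀ᵐ z ∂Measure.pi fun _ : Fin 2 => ballMeasure (Euc d),
        weight {0} (fun v => normalize (z v)) = 1 := by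
      filter_upwards [ae_linearIndependent (V := Fin 2) (d := d) (N := {0})
        (by rw [Finset.card_singleton]; omega)] with z hz
      exact weight_singleton_of_norm_eq_one (norm_normalize (hz.ne_zero ⟨0, by simp⟩))
    rw [lintegral_congr_ae h1]
    simp
  have h := tendsto_almostMass (G := (⊤ : SimpleGraph (Fin 2))) (A := {0}) (d := d) (by simp)
    (fun u hu v hv => by
      have : u = v := by
        simp at hu hv
        omega
      simp [this]) hdeg
    (ne_of_eq_of_ne (by convert e) ENNReal.one_ne_top)
  simp_rw [ncard_edgeSet_top, pow_one] at h
  exact h.trans_eq (congrArg 𝓝 (by convert e))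

lemma SatisfiesSidorenko.almostMass_le (h : SatisfiesSidorenko G) (ε : ℝ) :
    almostMass (d := d) (⊤ : SimpleGraph (Fin 2)) ε 1 ^ G.edgeSet.ncard ≤
      almostMass (d := d) G ε 1 := by
  rw [almostMass_eq_relDensity, almostMass_eq_relDensity,
    ← ENNReal.ofReal_pow (by exact measureReal_nonneg)]
  refine ENNReal.ofReal_le_ofReal (h.relDensity (sphereLaw d) (fun a b hab => ?_) ?_)
  · rwa [real_inner_comm]
  · exact (Continuous.inner (𝕜 := ℝ) (E := Euc d) continuous_fst continuous_snd).abs.measurable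
      measurableSet_Iio

/-- Both sides of Sidorenko's inequality are divided by `(slabRate d * ε)^|E|`; the edge side tends
to `1`. -/
lemma SatisfiesSidorenko.one_le_lintegral (h : SatisfiesSidorenko G) {A : Finset V}
    (hA : ∀ u ∈ A, ∀ v ∈ A, ¬ G.Adj u v)
    (hB : ∀ u ∉ A, ∀ v ∉ A, ¬ G.Adj u v) (hd : 2 ≤ d) (hdeg : ∀ S v, (nbrsIn G S v).card < d) :
    1 ≤ ∫⁻ y, ∏ v ∈ Aᶜ, weight (nbrs G v) y ∂Measure.pi (fun _ => sphereLaw d) := by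
  by_cases hfin : ∫⁻ y, ∏ v ∈ Aᶜ, weight (nbrs G v) y ∂Measure.pi (fun _ => sphereLaw d) = ∞
  · rw [hfin]
    exact le_top
  have h1 := tendsto_almostMass hA hB hdeg hfin
  have h2 := ENNReal.Tendsto.pow (n := G.edgeSet.ncard) (tendsto_almostMass_top hd)
  rw [one_pow] at h2
  refine le_of_tendsto_of_tendsto' h2 h1 fun ε => ?_
  rw [mul_pow]
  gcongr
  exact h.almostMass_le ε

end Final

end OrthoHom

theorem corollary27 {V : Type*} [Fintype V] (H : SimpleGraph V) (d : ℕ) (hd : 3 ≤ d)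
    (hsparse : OrthoHom.IsSparse H d) (hbip : H.IsBipartite)
    (hsid : OrthoHom.SatisfiesSidorenko H)
    (p : V ≃ Fin (Fintype.card V)) :
    1 ≤ OrthoHom.orthoDensity H d p := by
  classical
  obtain ⟨c⟩ := hbip
  set A : Finset V := Finset.univ.filter fun v => c v = 0 with hAdef
  have hA : ∀ u ∈ A, ∀ v ∈ A, ¬ H.Adj u v := fun u hu v hv huv => by
    rw [hAdef, Finset.mem_filter] at hu hv
    exact c.valid huv (hu.2.trans hv.2.symm)
  have hB : ∀ u ∉ A, ∀ v ∉ A, ¬ H.Adj u v := fun u hu v hv huv => by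
    have := c.valid huv
    simp only [hAdef, Finset.mem_filter, Finset.mem_univ, true_and] at hu hv
    omega
  have hdeg := hsparse.card_nbrsIn_lt (by omega)
  -- The given order is exchanged for one that lists the color class `A` first.
  rw [OrthoHom.orthoDensity_eq_iter p hdeg, OrthoHom.iter_independentMaps_eq hdeg
    (OrthoHom.nodup_remainingNodes p) (OrthoHom.mem_remainingNodes p) (l' := A.toList ++ Aᶜ.toList),
    OrthoHom.iter_one_independentMaps_eq_lintegral hA hB (by omega) hdeg]
  · exact hsid.one_le_lintegral hA hB (by omega) hdeg
  · exact fun J C hJ hC _ hJC => hsparse.card_add_card_le hJ hC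
      fun u hu v hv => (OrthoHom.mem_nbrsIn.1 (hJC v hv hu)).2
  · refine List.Nodup.append A.nodup_toList Aᶜ.nodup_toList fun v hv hv' => ?_
    rw [Finset.mem_toList] at hv hv'
    exact Finset.mem_compl.1 hv' hv
  · intro v
    by_cases hv : v ∈ A <;> simp [hv]
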